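/- Let $d\ge 1$. For $V=\mathbb R^n$, a Schwartz window $g\in\mathcal S(V)$, $g\neq0$, and $f\in\mathcal S'(V)$ put $V_gf(x,\xi)=\langle f, M_\xi T_x g\rangle$, where $M_\xi T_xg(t)=e^{2\pi i\xi\cdot t}g(t-x)$ and $\langle\cdot,\cdot\rangle$ extends $\int f\bar g$. For $1\le p,q\le\infty$ and weights $m$ on $V\times V$, $w$ on $V$, let $$\|f\|_{M^{p,q}_m}=\Big(\int\Big(\int |V_gf(x,\xi)|^p m(x,\xi)^p\,dx\Big)^{q/p}d\xi\Big)^{1/q},\qquad \|f\|_{W(\mathcal FL^p,L^q_w)}=\Big(\int\Big(\int |V_gf(x,\xi)|^p\,d\xi\Big)^{q/p}w(x)^q\,dx\Big)^{1/q}$$ (with suprema for infinite exponents); $M^{p,q}_m$ and $W(\mathcal FL^p,L^q_w)$ consist of the $f\in\mathcal S'(V)$ with finite norm, $M^p_m=M^{p,p}_m$, and the weight is omitted when it is $1$. The norms may be computed with any fixed nonzero Schwartz windows. Let $v_s(z)=(1+|z|^2)^{s/2}$ for $z\in\mathbb R^{2d}$. For $f_1,f_2\in\mathcal S(\mathbb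 R^d)$ let $V_{f_1}f_2(x,\xi)=\int f_2(t)\overline{f_1(t-x)}e^{-2\pi i\xi\cdot t}dt\in\mathcal S(\mathbb R^{2d})$, and for $f_1,f_2\in\mathcal S'(\mathbb R^d)$ let $V_{f_1}f_2\in\mathcal S'(\mathbb R^{2d})$ be its extension by duality, that is, the unique tempered distribution with $\langle V_{f_1}f_2,V_\varphi\psi\rangle=\langle f_2,\psi\rangle\overline{\langle f_1,\varphi\rangle}$ for all $\varphi,\psi\in\mathcal S(\mathbb R^d)$. Let $p_1,p_2,p,q\in[1,\infty]$ and consider the condition $$p_1,p_2\le q,\qquad \frac1{p_1}+\frac1{p_2}\ge\frac1p+\frac1q.\tag{$*$}$$ (i) If $(*)$ holds, then for every $s\in\mathbb R$ there is a constant $C$ such that for all $f_1\in M^{p_1}_{v_{|s|}}(\mathbb R^d)$ and $f_2\in M^{p_2}_{v_s}(\mathbb R^d)$ the distribution $V_{f_1}f_2$ exists (and is unique), belongs to $W(\mathcal FL^p,L^q_{v_s})(\mathbb R^{2d})$, and $$\|V_{f_1}f_2\|_{W(\mathcal FL^p,L^q_{v_s})}\le C\,\|f_1\|_{M^{p_1}_{v_{|s|}}}\|f_2\|_{M^{p_2}_{v_s}}.$$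 (ii) Conversely, if there is a constant $C$ such that $$\|V_{f_1}f_2\|_{W(\mathcal FL^p,L^q)(\mathbb R^{2d})}\le C\,\|f_1\|_{M^{p_1}(\mathbb R^d)}\|f_2\|_{M^{p_2}(\mathbb R^d)}\qquad\text{for all } f_1,f_2\in\mathcal S(\mathbb R^d),$$ then $(*)$ holds. -/

import Mathlib

open MeasureTheory SchwartzMap
open scoped ENNReal NNReal ContDiff FourierTransform RealInnerProductSpace ComplexConjugate

namespace TimeFreq

section General

variable {V : Type*} [NormedAddCommGroup V] [InnerProductSpace ℝ V]

/-- The character `t ↦ e^{2πi ξ·t}`. -/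
noncomputable def character (ξ : V) : V → ℂ :=
  fun t => Complex.exp (2 * Real.pi * Complex.I * (⟪ξ, t⟫ : ℝ))

theorem hasTemperateGrowth_cexp :
    (fun x : ℝ => Complex.exp (2 * Real.pi * Complex.I * (x : ℂ))).HasTemperateGrowth := by
  have hd : ∀ n : ℕ, iteratedDeriv n (fun x : ℝ => Complex.exp (2 * Real.pi * Complex.I * (x : ℂ)))
      = fun x : ℝ => (2 * Real.pi * Complex.I) ^ n *
        Complex.exp (2 * Real.pi * Complex.I * (x : ℂ)) := by
    intro n
    induction n with
    | zero => simp
    | succ n ih =>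
      rw [iteratedDeriv_succ, ih]
      funext x
      have h1 : HasDerivAt (fun x : ℝ => 2 * Real.pi * Complex.I * (x : ℂ))
          (2 * Real.pi * Complex.I) x := by
        simpa using (Complex.ofRealCLM.hasDerivAt (x := x)).const_mul (2 * Real.pi * Complex.I)
      rw [((h1.cexp).const_mul ((2 * Real.pi * Complex.I) ^ n)).deriv]
      ring
  refine ⟨?_, fun n => ⟨0, (2 * Real.pi) ^ n, fun x => ?_⟩⟩
  · exact Complex.contDiff_exp.comp (contDiff_const.mul Complex.ofRealCLM.contDiff)
  · rw [norm_iteratedFDeriv_eq_norm_iteratedDeriv, hd n]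
    have : ‖Complex.exp (2 * Real.pi * Complex.I * (x : ℂ))‖ = 1 := by
      rw [show 2 * Real.pi * Complex.I * (x : ℂ) = ((2 * Real.pi * x : ℝ) : ℂ) * Complex.I by
        push_cast; ring]
      exact Complex.norm_exp_ofReal_mul_I _
    rw [norm_mul, this]
    simp [abs_of_pos Real.pi_pos]

theorem hasTemperateGrowth_character (ξ : V) : (character ξ).HasTemperateGrowth :=
  hasTemperateGrowth_cexp.comp (Function.hasTemperateGrowth_inner_right ξ)

/-- The complex conjugate of a Schwartz function. -/
noncomputable def conjS (φ : 𝓢(V, ℂ)) : 𝓢(V, ℂ) :=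
  SchwartzMap.postcompCLM (𝕜 := ℝ) (Complex.conjCLE : ℂ →L[ℝ] ℂ) φ

/-- The time-frequency shift `M_ξ T_x g`, that is, `t ↦ e^{2πi ξ·t} g(t - x)`. -/
noncomputable def tfShift (x ξ : V) (g : 𝓢(V, ℂ)) : 𝓢(V, ℂ) :=
  SchwartzMap.smulLeftCLM ℂ (character ξ) (SchwartzMap.compSubConstCLM ℂ x g)

theorem conjS_apply (φ : 𝓢(V, ℂ)) (t : V) : conjS φ t = conj (φ t) := rfl

theorem tfShift_apply (x ξ : V) (g : 𝓢(V, ℂ)) (t : V) :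
    tfShift x ξ g t = Complex.exp (2 * Real.pi * Complex.I * (⟪ξ, t⟫ : ℝ)) * g (t - x) := by
  simp [tfShift, SchwartzMap.smulLeftCLM_apply_apply (hasTemperateGrowth_character ξ), character]

/-- The sesquilinear bracket `⟨u, φ⟩` between a tempered distribution and a Schwartz function,
extending `∫ u(t) conj (φ(t)) dt`. -/
noncomputable def bracket (u : 𝓢'(V, ℂ)) (φ : 𝓢(V, ℂ)) : ℂ := u (conjS φ)

/-- The short-time Fourier transform `V_g f(x, ξ) = ⟨f, M_ξ T_x g⟩` of a tempered distribution `f`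
with respect to a Schwartz window `g`. -/
noncomputable def stft (g : 𝓢(V, ℂ)) (f : 𝓢'(V, ℂ)) (x ξ : V) : ℂ := bracket f (tfShift x ξ g)

/-- The polynomial weight `v_s(z) = (1 + |z|²)^{s/2}`. -/
noncomputable def weight (s : ℝ) (z : V) : ℝ := (1 + ‖z‖ ^ 2) ^ (s / 2)

variable [MeasurableSpace V] [BorelSpace V] [FiniteDimensional ℝ V]

/-- The norm of the modulation space `M^{p,q}_m(V)`, computed with the window `g`. -/
noncomputable def modulationNorm (g : 𝓢(V, ℂ)) (p q : ℝ≥0∞) (m : WithLp 2 (V × V) → ℝ)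
    (f : 𝓢'(V, ℂ)) : ℝ≥0∞ :=
  eLpNorm (fun ξ : V =>
    eLpNorm (fun x : V => ‖stft g f x ξ‖ₑ * ENNReal.ofReal (m (WithLp.toLp 2 (x, ξ)))) p volume)
    q volume

/-- Membership in the modulation space `M^{p,q}_m(V)`. -/
def MemModulation (g : 𝓢(V, ℂ)) (p q : ℝ≥0∞) (m : WithLp 2 (V × V) → ℝ) (f : 𝓢'(V, ℂ)) : Prop :=
  modulationNorm g p q m f < ⊤

/-- The norm of the Wiener amalgam space `W(𝓕L^p, L^q_w)(V)`, computed with the window `g`. -/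
noncomputable def wienerNorm (g : 𝓢(V, ℂ)) (p q : ℝ≥0∞) (w : V → ℝ) (f : 𝓢'(V, ℂ)) : ℝ≥0∞ :=
  eLpNorm (fun x : V =>
    eLpNorm (fun ξ : V => ‖stft g f x ξ‖ₑ) p volume * ENNReal.ofReal (w x)) q volume

/-- Membership in the Wiener amalgam space `W(𝓕L^p, L^q_w)(V)`. -/
def MemWiener (g : 𝓢(V, ℂ)) (p q : ℝ≥0∞) (w : V → ℝ) (f : 𝓢'(V, ℂ)) : Prop :=
  wienerNorm g p q w f < ⊤

end General

section Schwartz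

variable {V : Type*} [NormedAddCommGroup V] [InnerProductSpace ℝ V]

theorem norm_iteratedFDeriv_comp_clm_le {W : Type*} [NormedAddCommGroup W] [NormedSpace ℝ W]
    (L : W →L[ℝ] V) (hL : ‖L‖ ≤ 1) (a : 𝓢(V, ℂ)) (n : ℕ) (z : W) :
    ‖iteratedFDeriv ℝ n (fun z => a (L z)) z‖ ≤ ‖iteratedFDeriv ℝ n a (L z)‖ := by
  have := L.iteratedFDeriv_comp_right (a.smooth n) z (i := n) le_rfl
  rw [show (fun z => a (L z)) = a ∘ L from rfl, this]
  refine (ContinuousMultilinearMap.norm_compContinuousLinearMap_le _ _).trans ?_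
  refine mul_le_of_le_one_right (norm_nonneg _) ?_
  simpa using pow_le_one₀ (norm_nonneg _) hL

theorem tensor_decay (a b : 𝓢(V, ℂ)) (k n : ℕ) : ∃ C : ℝ, ∀ z : WithLp 2 (V × V),
    ‖z‖ ^ k * ‖iteratedFDeriv ℝ n (fun z : WithLp 2 (V × V) => a z.fst * b z.snd) z‖ ≤ C := by
  let L₁ : WithLp 2 (V × V) →L[ℝ] V := WithLp.fstL 2 ℝ V V
  let L₂ : WithLp 2 (V × V) →L[ℝ] V := WithLp.sndL 2 ℝ V V
  have h₁ : ‖L₁‖ ≤ 1 := ContinuousLinearMap.opNorm_le_bound _ zero_le_one fun z => by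
    simpa [L₁] using WithLp.norm_fst_le (p := 2) V z
  have h₂ : ‖L₂‖ ≤ 1 := ContinuousLinearMap.opNorm_le_bound _ zero_le_one fun z => by
    simpa [L₂] using WithLp.norm_snd_le (p := 2) V z
  have hz : ∀ z : WithLp 2 (V × V), ‖z‖ ≤ ‖z.fst‖ + ‖z.snd‖ := fun z => by
    rw [WithLp.prod_norm_eq_of_L2]
    refine Real.sqrt_le_iff.2 ⟨by positivity, ?_⟩
    nlinarith [norm_nonneg z.fst, norm_nonneg z.snd]
  choose A hA using a.decay
  choose B hB using b.decay
  refine ⟨2 ^ (k - 1) * ∑ i ∈ Finset.range (n + 1), (n.choose i : ℝ) *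
    (A k i * B 0 (n - i) + A 0 i * B k (n - i)), fun z => ?_⟩
  have hA0 : ∀ k i, 0 ≤ A k i := fun k i => (hA k i).1.le
  have hB0 : ∀ k i, 0 ≤ B k i := fun k i => (hB k i).1.le
  have hmul := norm_iteratedFDeriv_mul_le (𝕜 := ℝ) (n := n) (N := ((⊤ : ℕ∞) : WithTop ℕ∞))
    (f := fun z => a (L₁ z)) (g := fun z => b (L₂ z))
    ((a.smooth ⊤).comp L₁.contDiff) ((b.smooth ⊤).comp L₂.contDiff) z (mod_cast le_top)
  have hk : ‖z‖ ^ k ≤ 2 ^ (k - 1) * (‖z.fst‖ ^ k + ‖z.snd‖ ^ k) :=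
    (pow_le_pow_left₀ (norm_nonneg _) (hz z) k).trans
      (add_pow_le (norm_nonneg _) (norm_nonneg _) k)
  calc _ ≤ (2 ^ (k - 1) * (‖z.fst‖ ^ k + ‖z.snd‖ ^ k)) * ∑ i ∈ Finset.range (n + 1),
        (n.choose i : ℝ) * ‖iteratedFDeriv ℝ i a z.fst‖ * ‖iteratedFDeriv ℝ (n - i) b z.snd‖ := by
        refine mul_le_mul hk (hmul.trans (Finset.sum_le_sum fun i _ => ?_)) (norm_nonneg _)
          (by positivity)
        gcongr
        · exact norm_iteratedFDeriv_comp_clm_le L₁ h₁ a i z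
        · exact norm_iteratedFDeriv_comp_clm_le L₂ h₂ b (n - i) z
    _ ≤ _ := by
        rw [mul_assoc, Finset.mul_sum]
        refine mul_le_mul_of_nonneg_left (Finset.sum_le_sum fun i _ => ?_) (by positivity)
        have e1 := (hA k i).2 z.fst
        have e2 := (hA 0 i).2 z.fst
        have e3 := (hB k (n - i)).2 z.snd
        have e4 := (hB 0 (n - i)).2 z.snd
        simp only [pow_zero, one_mul] at e2 e4
        calc _ = (n.choose i : ℝ) * ((‖z.fst‖ ^ k * ‖iteratedFDeriv ℝ i a z.fst‖) *
              ‖iteratedFDeriv ℝ (n - i) b z.snd‖ + ‖iteratedFDeriv ℝ i a z.fst‖ *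
              (‖z.snd‖ ^ k * ‖iteratedFDeriv ℝ (n - i) b z.snd‖)) := by ring
          _ ≤ _ := by
            gcongr
            · exact hA0 _ _
            · exact hA0 _ _

/-- The function `(x, y) ↦ a(x) b(y)`. -/
noncomputable def tensor (a b : 𝓢(V, ℂ)) : 𝓢(WithLp 2 (V × V), ℂ) where
  toFun z := a z.fst * b z.snd
  smooth' := ((a.smooth ⊤).comp (WithLp.fstL 2 ℝ V V).contDiff).mul
    ((b.smooth ⊤).comp (WithLp.sndL 2 ℝ V V).contDiff)
  decay' := tensor_decay a b

/-- The chirp `(η, t) ↦ e^{2πi η·t}`. -/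
noncomputable def chirp : WithLp 2 (V × V) → ℂ :=
  fun z => Complex.exp (2 * Real.pi * Complex.I * ((⟪z.fst, z.snd⟫ : ℝ) : ℂ))

theorem hasTemperateGrowth_chirp : (chirp (V := V)).HasTemperateGrowth := by
  refine hasTemperateGrowth_cexp.comp (f := fun z : WithLp 2 (V × V) => (⟪z.fst, z.snd⟫ : ℝ)) ?_
  exact (innerSL ℝ).bilinear_hasTemperateGrowth (WithLp.fstL 2 ℝ V V).hasTemperateGrowth
    (WithLp.sndL 2 ℝ V V).hasTemperateGrowth

variable [MeasurableSpace V] [BorelSpace V] [FiniteDimensional ℝ V]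

/-- The short-time Fourier transform of Schwartz functions, `φ` being the window:
`V_φ ψ(x, ξ) = ∫ ψ(t) conj (φ(t - x)) e^{-2πi ξ·t} dt`. -/
noncomputable def stftFun (φ ψ : 𝓢(V, ℂ)) (z : WithLp 2 (V × V)) : ℂ :=
  ∫ t : V, ψ t * conj (φ (t - z.fst)) *
    Complex.exp (-(2 * Real.pi * Complex.I * (⟪z.snd, t⟫ : ℝ)))

/-- An auxiliary Schwartz function whose Fourier transform is the short-time Fourier transform. -/
noncomputable def stftKernel (φ ψ : 𝓢(V, ℂ)) : 𝓢(WithLp 2 (V × V), ℂ) :=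
  SchwartzMap.smulLeftCLM ℂ chirp (tensor (𝓕 (conjS φ)) ψ)

theorem stftKernel_apply (φ ψ : 𝓢(V, ℂ)) (z : WithLp 2 (V × V)) :
    stftKernel φ ψ z = chirp z * (𝓕 (conjS φ) z.fst * ψ z.snd) := by
  rw [stftKernel, SchwartzMap.smulLeftCLM_apply_apply hasTemperateGrowth_chirp]
  rfl

theorem fourier_stftKernel (φ ψ : 𝓢(V, ℂ)) :
    ((𝓕 (stftKernel φ ψ) : 𝓢(WithLp 2 (V × V), ℂ)) : WithLp 2 (V × V) → ℂ) = stftFun φ ψ := by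
  funext z
  have hint : Integrable (fun v : WithLp 2 (V × V) =>
      Complex.exp ((↑(-2 * Real.pi * ⟪v, z⟫) : ℂ) * Complex.I) • stftKernel φ ψ v) := by
    refine (stftKernel φ ψ).integrable.norm.mono' ?_ (Filter.Eventually.of_forall fun v => ?_)
    · refine Continuous.aestronglyMeasurable ?_
      have := (stftKernel φ ψ).continuous
      fun_prop
    · rw [norm_smul, Complex.norm_exp_ofReal_mul_I, one_mul]
  have hmp := WithLp.volume_preserving_toLp V V
  have hint' := hmp.integrable_comp_of_integrable hint
  rw [SchwartzMap.fourier_coe, Real.fourier_eq',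
    ← hmp.integral_comp (MeasurableEquiv.toLp 2 (V × V)).measurableEmbedding,
    Measure.volume_eq_prod]
  refine (integral_prod_symm _ hint').trans ?_
  rw [stftFun]
  refine integral_congr_ae (Filter.Eventually.of_forall fun t => ?_)
  have hinv : (𝓕 (𝓕 (conjS φ)) : 𝓢(V, ℂ)) (z.fst - t) = conj (φ (t - z.fst)) := by
    have h1 : (𝓕⁻ (𝓕 (conjS φ)) : 𝓢(V, ℂ)) (t - z.fst) = conjS φ (t - z.fst) := by simp
    rw [SchwartzMap.fourierInv_coe, Real.fourierInv_eq_fourier_neg, neg_sub] at h1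
    rw [SchwartzMap.fourier_coe, h1, conjS_apply]
  beta_reduce
  rw [← hinv, SchwartzMap.fourier_coe (𝓕 (conjS φ)), Real.fourier_eq',
    mul_right_comm, ← integral_const_mul]
  refine integral_congr_ae (Filter.Eventually.of_forall fun η => ?_)
  simp only [Function.comp_apply, stftKernel_apply, chirp, WithLp.prod_inner_apply, smul_eq_mul,
    WithLp.toLp_fst, WithLp.toLp_snd, WithLp.ofLp_fst, WithLp.ofLp_snd]
  have : Complex.exp ((↑(-2 * Real.pi * (⟪η, z.fst⟫ + ⟪t, z.snd⟫)) : ℂ) * Complex.I) *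
      Complex.exp (2 * Real.pi * Complex.I * ((⟪η, t⟫ : ℝ) : ℂ)) =
      Complex.exp ((↑(-2 * Real.pi * ⟪η, z.fst - t⟫) : ℂ) * Complex.I) *
      Complex.exp (-(2 * Real.pi * Complex.I * (⟪z.snd, t⟫ : ℝ))) := by
    rw [← Complex.exp_add, ← Complex.exp_add, inner_sub_right, real_inner_comm t z.snd]
    congr 1
    push_cast
    ring
  linear_combination (𝓕 (conjS φ) η * ψ t) * this

/-- The short-time Fourier transform `V_φ ψ` of Schwartz functions, as a Schwartz function. -/
noncomputable def stftS (φ ψ : 𝓢(V, ℂ)) : 𝓢(WithLp 2 (V × V), ℂ) where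
  toFun := stftFun φ ψ
  smooth' := fourier_stftKernel φ ψ ▸ (𝓕 (stftKernel φ ψ)).smooth'
  decay' := fourier_stftKernel φ ψ ▸ (𝓕 (stftKernel φ ψ)).decay'

/-- `F` is the short-time Fourier transform `V_{f₁} f₂` of the tempered distribution `f₂` with
respect to the tempered distribution `f₁`. This is the extension of `stftS` by duality: the
orthogonality relations `⟨V_{f₁} f₂, V_φ ψ⟩ = ⟨f₂, ψ⟩ conj ⟨f₁, φ⟩` of Schwartz functions are
required against all Schwartz functions `φ`, `ψ`. -/
def IsSTFT (f₁ f₂ : 𝓢'(V, ℂ)) (F : 𝓢'(WithLp 2 (V × V), ℂ)) : Prop :=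
  ∀ φ ψ : 𝓢(V, ℂ), bracket F (stftS φ ψ) = bracket f₂ ψ * conj (bracket f₁ φ)

/-- The notion `IsSTFT` extends the short-time Fourier transform of Schwartz functions. -/
theorem isSTFT_stftS (f₁ f₂ : 𝓢(V, ℂ)) :
    IsSTFT (f₁ : 𝓢'(V, ℂ)) (f₂ : 𝓢'(V, ℂ)) (stftS f₁ f₂ : 𝓢'(WithLp 2 (V × V), ℂ)) := by
  intro φ ψ
  have hb : ∀ {W : Type _} [NormedAddCommGroup W] [InnerProductSpace ℝ W] [MeasurableSpace W]
      [BorelSpace W] [FiniteDimensional ℝ W] (u v : 𝓢(W, ℂ)),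
      bracket (u : 𝓢'(W, ℂ)) v = ∫ t, conj (v t) * u t := by
    intro W _ _ _ _ _ u v
    simp [bracket, conjS_apply]
  have hS : ∀ u v : 𝓢(V, ℂ), stftS u v = 𝓕 (stftKernel u v) := fun u v => by
    ext z
    exact (congrFun (fourier_stftKernel u v) z).symm
  have hP : ∀ {W : Type _} [NormedAddCommGroup W] [InnerProductSpace ℝ W] [MeasurableSpace W]
      [BorelSpace W] [FiniteDimensional ℝ W] (u v : 𝓢(W, ℂ)),
      ∫ t, conj ((𝓕 v : 𝓢(W, ℂ)) t) * (𝓕 u : 𝓢(W, ℂ)) t = ∫ t, conj (v t) * u t := by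
    intro W _ _ _ _ _ u v
    simpa [mul_comm] using SchwartzMap.integral_sesq_fourier_fourier v u (innerSL ℂ)
  rw [hb, hb, hb, hS, hS, hP]
  have hmp := WithLp.volume_preserving_toLp V V
  rw [← hmp.integral_comp (MeasurableEquiv.toLp 2 (V × V)).measurableEmbedding,
    Measure.volume_eq_prod]
  have key : ∀ w : V × V, conj (stftKernel φ ψ (WithLp.toLp 2 w)) *
      stftKernel f₁ f₂ (WithLp.toLp 2 w) =
      (conj (𝓕 (conjS φ) w.1) * 𝓕 (conjS f₁) w.1) * (conj (ψ w.2) * f₂ w.2) := by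
    intro w
    have h1 : conj (chirp (WithLp.toLp 2 w)) * chirp (WithLp.toLp 2 w) = 1 := by
      rw [← Complex.normSq_eq_conj_mul_self, Complex.normSq_eq_norm_sq, chirp,
        WithLp.toLp_fst, WithLp.toLp_snd,
        show (2 * Real.pi * Complex.I * ((⟪w.1, w.2⟫ : ℝ) : ℂ)) =
          ((2 * Real.pi * ⟪w.1, w.2⟫ : ℝ) : ℂ) * Complex.I by push_cast; ring,
        Complex.norm_exp_ofReal_mul_I]
      simp
    simp only [stftKernel_apply, map_mul, WithLp.toLp_fst, WithLp.toLp_snd]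
    linear_combination (conj (𝓕 (conjS φ) w.1) * 𝓕 (conjS f₁) w.1) * (conj (ψ w.2) * f₂ w.2) * h1
  simp only [key]
  rw [integral_prod_mul (fun x : V => conj (𝓕 (conjS φ) x) * 𝓕 (conjS f₁) x)
    (fun y : V => conj (ψ y) * f₂ y), hP, mul_comm]
  congr 1
  rw [← integral_conj]
  simp [conjS_apply]

end Schwartz

end TimeFreq

open TimeFreq

/-!
The transform is covariant: up to a phase, the short-time Fourier transform of `V_{f₁} f₂` with
window `V_{g₁} g₂` is the product of `V_{g₁} f₁` and `V_{g₂} f₂` at two points of phase space which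
differ by `z`. Hence the Wiener amalgam norm of `V_{f₁} f₂` is a mixed norm of the correlation of
`|V_{g₁} f₁|` and `|V_{g₂} f₂|`. Changing the window dominates `|V_g f|` by its convolution with a
rapidly decaying kernel, so that an `L^p` bound for `|V_g f|` implies `L^r` bounds for all `r ≥ p`.
With this local regularity, Hölder's inequality bounds the correlation under weaker conditions on
the exponents than Young's.

The right-hand side of the covariance formula makes sense for arbitrary tempered distributions and
has polynomial growth; integrating it against the short-time Fourier transform of a test function,
as in the inversion formula, defines `V_{f₁} f₂`.

For the converse, `f₁` and `f₂` are Gaussians of widths `R₁` and `R₂`. The left-hand side is then at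
least of order `min(R₁, R₂)^{n/p} max(R₁, R₂)^{n/q}` and the right-hand side is of order
`R₁^{n/p₁} R₂^{n/p₂}`; each condition follows by letting one or both of the widths tend to infinity.
-/

namespace TimeFreq

/-! ### Integration of Schwartz functions with parameters -/

section Slice

variable {E F : Type*} [NormedAddCommGroup E] [NormedSpace ℝ E] [NormedAddCommGroup F]
  [NormedSpace ℝ F]

theorem hasTemperateGrowth_prodMk_left (z : E) : (fun x : F => (z, x)).HasTemperateGrowth := by
  convert (Function.HasTemperateGrowth.const (E := F) ((z, 0) : E × F)).add
    (ContinuousLinearMap.inr ℝ E F).hasTemperateGrowth using 1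
  ext x <;> simp

/-- The restriction `x ↦ Θ(z, x)` of a Schwartz function on a product to the fibre over `z`. -/
noncomputable def slice (Θ : 𝓢(E × F, ℂ)) (z : E) : 𝓢(F, ℂ) :=
  SchwartzMap.compCLMOfAntilipschitz ℂ (K := 1) (hasTemperateGrowth_prodMk_left z)
    (AntilipschitzWith.of_le_mul_dist fun x y => by simp [Prod.dist_eq]) Θ

theorem slice_apply (Θ : 𝓢(E × F, ℂ)) (z : E) (x : F) : slice Θ z x = Θ (z, x) := rfl

theorem iteratedFDeriv_slice (Θ : 𝓢(E × F, ℂ)) (z : E) (n : ℕ) (x : F) :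
    iteratedFDeriv ℝ n (slice Θ z) x = (iteratedFDeriv ℝ n Θ (z, x)).compContinuousLinearMap
      (fun _ => ContinuousLinearMap.inr ℝ E F) := by
  have hslice : (slice Θ z : F → ℂ) =
      (fun w => Θ ((z, 0) + w)) ∘ ContinuousLinearMap.inr ℝ E F := by
    ext y
    simp [slice_apply]
  have hsmooth : ContDiff ℝ n (fun w => Θ ((z, 0) + w)) :=
    (Θ.smooth n).comp (contDiff_const.add contDiff_id)
  rw [hslice, (ContinuousLinearMap.inr ℝ E F).iteratedFDeriv_comp_right hsmooth x le_rfl,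
    iteratedFDeriv_comp_add_left]
  simp

theorem norm_compContinuousLinearMap_inr_le {n : ℕ} (A : (E × F) [×n]→L[ℝ] ℂ) :
    ‖A.compContinuousLinearMap (fun _ => ContinuousLinearMap.inr ℝ E F)‖ ≤ ‖A‖ :=
  (ContinuousMultilinearMap.norm_compContinuousLinearMap_le _ _).trans <|
    mul_le_of_le_one_right (norm_nonneg _) <| Finset.prod_le_one (fun _ _ => norm_nonneg _)
      fun _ _ => ContinuousLinearMap.norm_inr_le_one ℝ E F

theorem exists_pow_mul_norm_iteratedFDeriv_slice_le (Θ : 𝓢(E × F, ℂ)) (k n N : ℕ) :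
    ∃ C : ℝ, 0 < C ∧ ∀ z x,
      ‖x‖ ^ k * ‖iteratedFDeriv ℝ n (slice Θ z) x‖ ≤ C * (1 + ‖z‖) ^ (-(N : ℝ)) := by
  let S := 2 ^ (k + N) * (Finset.Iic (k + N, n)).sup (schwartzSeminormFamily ℝ (E × F) ℂ) Θ
  refine ⟨S + 1, by positivity, fun z x => ?_⟩
  rw [Real.rpow_neg (by positivity), Real.rpow_natCast, ← div_eq_mul_inv,
    le_div_iff₀ (by positivity)]
  calc ‖x‖ ^ k * ‖iteratedFDeriv ℝ n (slice Θ z) x‖ * (1 + ‖z‖) ^ N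
      ≤ (1 + ‖(z, x)‖) ^ k * ‖iteratedFDeriv ℝ n Θ (z, x)‖ * (1 + ‖(z, x)‖) ^ N := by
        have hx : ‖x‖ ≤ 1 + ‖(z, x)‖ := (norm_snd_le (z, x)).trans (by simp)
        have hz : ‖z‖ ≤ ‖(z, x)‖ := norm_fst_le (z, x)
        rw [iteratedFDeriv_slice]
        gcongr
        exact norm_compContinuousLinearMap_inr_le _
    _ = (1 + ‖(z, x)‖) ^ (k + N) * ‖iteratedFDeriv ℝ n Θ (z, x)‖ := by ring
    _ ≤ S := one_add_le_sup_seminorm_apply (m := (k + N, n)) le_rfl le_rfl Θ (z, x)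
    _ ≤ S + 1 := le_add_of_nonneg_right zero_le_one

theorem continuous_iteratedFDeriv_slice (Θ : 𝓢(E × F, ℂ)) (n : ℕ) (x : F) :
    Continuous fun z => iteratedFDeriv ℝ n (slice Θ z) x := by
  simp only [iteratedFDeriv_slice]
  exact (ContinuousMultilinearMap.compContinuousLinearMapL
    (fun _ => ContinuousLinearMap.inr ℝ E F)).continuous.comp
    (((Θ.smooth n).continuous_iteratedFDeriv le_rfl).comp (by fun_prop))

theorem hasFDerivAt_iteratedFDeriv (h : 𝓢(F, ℂ)) (n : ℕ) (x : F) :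
    HasFDerivAt (iteratedFDeriv ℝ n h)
      (continuousMultilinearCurryLeftEquiv ℝ (fun _ => F) ℂ (iteratedFDeriv ℝ (n + 1) h x)) x := by
  have := ((h.smooth (n + 1 : ℕ)).differentiable_iteratedFDeriv (m := n)
    (by exact_mod_cast n.lt_succ_self) x).hasFDerivAt
  rwa [fderiv_iteratedFDeriv] at this

section Integral

variable [MeasurableSpace E] [BorelSpace E] [SecondCountableTopology E]
  (μ : Measure E) [μ.HasTemperateGrowth]

theorem integrable_iteratedFDeriv_slice (Θ : 𝓢(E × F, ℂ)) (n : ℕ) (x : F) :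
    Integrable (fun z => iteratedFDeriv ℝ n (slice Θ z) x) μ := by
  obtain ⟨C, -, hC⟩ := exists_pow_mul_norm_iteratedFDeriv_slice_le Θ 0 n μ.integrablePower
  refine (μ.integrable_pow_neg_integrablePower.const_mul C).mono'
    (continuous_iteratedFDeriv_slice Θ n x).aestronglyMeasurable (.of_forall fun z => ?_)
  simpa using hC z x

theorem hasFDerivAt_integral_iteratedFDeriv_slice (Θ : 𝓢(E × F, ℂ)) (n : ℕ) (x : F) :
    HasFDerivAt (fun x => ∫ z, iteratedFDeriv ℝ n (slice Θ z) x ∂μ)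
      (continuousMultilinearCurryLeftEquiv ℝ (fun _ => F) ℂ
        (∫ z, iteratedFDeriv ℝ (n + 1) (slice Θ z) x ∂μ)) x := by
  let curry := (continuousMultilinearCurryLeftEquiv ℝ
    (fun _ : Fin (n + 1) => F) ℂ).toContinuousLinearEquiv
  obtain ⟨C, -, hC⟩ := exists_pow_mul_norm_iteratedFDeriv_slice_le Θ 0 (n + 1) μ.integrablePower
  have hcurry : curry (∫ z, iteratedFDeriv ℝ (n + 1) (slice Θ z) x ∂μ) =
      ∫ z, curry (iteratedFDeriv ℝ (n + 1) (slice Θ z) x) ∂μ :=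
    (curry.integral_comp_comm (𝕜 := ℝ) (E := F [×n + 1]→L[ℝ] ℂ)
      (F := F →L[ℝ] F [×n]→L[ℝ] ℂ) fun z => iteratedFDeriv ℝ (n + 1) (slice Θ z) x).symm
  change HasFDerivAt _ (curry _) x
  rw [hcurry]
  refine hasFDerivAt_integral_of_dominated_of_fderiv_le (s := Set.univ)
    (bound := fun z => C * (1 + ‖z‖) ^ (-(μ.integrablePower : ℝ)))
    (F' := fun x z => curry (iteratedFDeriv ℝ (n + 1) (slice Θ z) x)) Filter.univ_mem
    (.of_forall fun y => (integrable_iteratedFDeriv_slice μ Θ n y).aestronglyMeasurable)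
    (integrable_iteratedFDeriv_slice μ Θ n x)
    (curry.continuous.comp (continuous_iteratedFDeriv_slice Θ (n + 1) x)).aestronglyMeasurable
    (.of_forall fun z y _ => ?_) (μ.integrable_pow_neg_integrablePower.const_mul C)
    (.of_forall fun z y _ => hasFDerivAt_iteratedFDeriv (slice Θ z) n y)
  have hnorm : ‖curry (iteratedFDeriv ℝ (n + 1) (slice Θ z) y)‖ =
      ‖iteratedFDeriv ℝ (n + 1) (slice Θ z) y‖ :=
    LinearIsometryEquiv.norm_map (continuousMultilinearCurryLeftEquiv ℝ _ ℂ) _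
  simpa [hnorm] using hC z y

theorem iteratedFDeriv_eq_integral_slice (Θ : 𝓢(E × F, ℂ)) {f : F → ℂ}
    (hf : ∀ x, f x = ∫ z, Θ (z, x) ∂μ) (n : ℕ) (x : F) :
    iteratedFDeriv ℝ n f x = ∫ z, iteratedFDeriv ℝ n (slice Θ z) x ∂μ := by
  induction n generalizing x with
  | zero =>
    let curry₀ := (continuousMultilinearCurryFin0 ℝ F ℂ).symm.toContinuousLinearEquiv
    calc iteratedFDeriv ℝ 0 f x = curry₀ (∫ z, slice Θ z x ∂μ) := congrArg curry₀ (hf x)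
      _ = ∫ z, curry₀ (slice Θ z x) ∂μ := (curry₀.integral_comp_comm _).symm
  | succ n ih =>
    rw [iteratedFDeriv_succ_eq_comp_left, Function.comp_apply, funext ih,
      (hasFDerivAt_integral_iteratedFDeriv_slice μ Θ n x).fderiv]
    exact (continuousMultilinearCurryLeftEquiv ℝ (fun _ : Fin (n + 1) => F) ℂ).symm_apply_apply _

end Integral

/-- The space of bounded continuous functions with values in the multilinear forms of degree `n`.
The metric on the forms is spelled out because the one found by default hides their norm. -/
abbrev BoundedForms (F : Type*) [NormedAddCommGroup F] [NormedSpace ℝ F] (n : ℕ) : Type _ :=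
  @BoundedContinuousFunction F (F [×n]→L[ℝ] ℂ) _
    (NormedAddCommGroup.toSeminormedAddCommGroup (E := (F [×n]→L[ℝ] ℂ))).toPseudoMetricSpace

/-- The bounded continuous function `x ↦ ‖x‖ ^ k • D^n h(x)`, whose supremum norm is the Schwartz
seminorm of `h` with indices `k` and `n`. -/
noncomputable def weightedDeriv (k n : ℕ) : 𝓢(F, ℂ) →ₗ[ℂ] BoundedForms F n where
  toFun h := BoundedContinuousFunction.ofNormedAddCommGroup
    (fun x => ‖x‖ ^ k • iteratedFDeriv ℝ n h x)
    ((continuous_norm.pow k).smul ((h.smooth n).continuous_iteratedFDeriv le_rfl))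
    (SchwartzMap.seminorm ℂ k n h) fun x => by
      rw [norm_smul, norm_pow, norm_norm]
      exact SchwartzMap.le_seminorm ℂ k n h x
  map_add' f g := by
    ext1 x
    have := iteratedFDeriv_add_apply (x := x) (f.smooth n).contDiffAt (g.smooth n).contDiffAt
    simp [← smul_add, ← this]
  map_smul' c f := by
    ext1 x
    have := iteratedFDeriv_const_smul_apply (𝕜 := ℝ) (a := c) (x := x) (f.smooth n).contDiffAt
    simp [smul_comm c, ← this]

theorem weightedDeriv_apply (k n : ℕ) (h : 𝓢(F, ℂ)) (x : F) :
    weightedDeriv k n h x = ‖x‖ ^ k • iteratedFDeriv ℝ n h x := rfl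

theorem norm_weightedDeriv_apply (k n : ℕ) (h : 𝓢(F, ℂ)) (x : F) :
    ‖weightedDeriv k n h x‖ = ‖x‖ ^ k * ‖iteratedFDeriv ℝ n h x‖ := by
  rw [weightedDeriv_apply, norm_smul, norm_pow, norm_norm]

theorem seminorm_le_norm_weightedDeriv (k n : ℕ) (h : 𝓢(F, ℂ)) :
    SchwartzMap.seminorm ℂ k n h ≤ ‖weightedDeriv k n h‖ :=
  SchwartzMap.seminorm_le_bound ℂ k n h (norm_nonneg _) fun x =>
    norm_weightedDeriv_apply k n h x ▸ (weightedDeriv k n h).norm_coe_le_norm x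

theorem exists_comp_eq_of_norm_le {𝕜 M N : Type*} [RCLike 𝕜] [AddCommGroup M] [Module 𝕜 M]
    [NormedAddCommGroup N] [NormedSpace 𝕜 N] (T : M →ₗ[𝕜] 𝕜) (J : M →ₗ[𝕜] N) (C : ℝ)
    (hT : ∀ h, ‖T h‖ ≤ C * ‖J h‖) : ∃ Λ : N →L[𝕜] 𝕜, ∀ h, T h = Λ (J h) := by
  have hker : LinearMap.ker J ≤ LinearMap.ker T := fun h hh => by
    simpa [LinearMap.mem_ker.1 hh] using hT h
  let T' : LinearMap.range J →ₗ[𝕜] 𝕜 :=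
    (LinearMap.ker J).liftQ T hker ∘ₗ J.quotKerEquivRange.symm.toLinearMap
  have hT' (h : M) : T' (J.rangeRestrict h) = T h := by
    have : J.quotKerEquivRange.symm (J.rangeRestrict h) = (LinearMap.ker J).mkQ h :=
      (LinearEquiv.symm_apply_eq _).2 rfl
    simp [T', this]
  obtain ⟨Λ, hΛ, -⟩ := exists_extension_norm_eq (LinearMap.range J) <| T'.mkContinuous C <| by
    rintro ⟨_, h, rfl⟩
    exact (congrArg norm (hT' h)).trans_le (hT h)
  exact ⟨Λ, fun h => (hT' h).symm.trans (hΛ (J.rangeRestrict h)).symm⟩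

theorem exists_factor_weightedDeriv (T : 𝓢(F, ℂ) →L[ℂ] ℂ) : ∃ (s : Finset (ℕ × ℕ))
    (Λ : ((i : s) → BoundedForms F i.1.2) →L[ℂ] ℂ), ∀ h,
      T h = Λ fun i => weightedDeriv i.1.1 i.1.2 h := by
  obtain ⟨s, C, -, hC⟩ := Seminorm.bound_of_continuous (schwartz_withSeminorms ℂ F ℂ)
    ((normSeminorm ℂ ℂ).comp (T : 𝓢(F, ℂ) →ₗ[ℂ] ℂ)) (continuous_norm.comp T.continuous)
  let J : 𝓢(F, ℂ) →ₗ[ℂ] ((i : s) → BoundedForms F i.1.2) :=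
    LinearMap.pi fun i => weightedDeriv i.1.1 i.1.2
  have hJ : ∀ h, s.sup (schwartzSeminormFamily ℂ F ℂ) h ≤ ‖J h‖ := fun h =>
    Seminorm.finset_sup_apply_le (norm_nonneg _) fun i hi =>
      (seminorm_le_norm_weightedDeriv i.1 i.2 h).trans (norm_le_pi_norm (J h) ⟨i, hi⟩)
  exact ⟨s, exists_comp_eq_of_norm_le (T : 𝓢(F, ℂ) →ₗ[ℂ] ℂ) J C fun h =>
    (hC h).trans (mul_le_mul_of_nonneg_left (hJ h) C.2)⟩

theorem pow_mul_norm_iteratedFDeriv_sub_le {Θ : 𝓢(E × F, ℂ)} {k n : ℕ} {C : ℝ}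
    (hC : ∀ y, ‖y‖ ^ k * ‖iteratedFDeriv ℝ (n + 1) Θ y‖ ≤ C) (z z' : E) (x : F) :
    ‖x‖ ^ k * ‖iteratedFDeriv ℝ n Θ (z, x) - iteratedFDeriv ℝ n Θ (z', x)‖ ≤
      C * ‖z - z'‖ := by
  rcases (pow_nonneg (norm_nonneg x) k).eq_or_lt with hx | hx
  · have : 0 ≤ C := (by positivity : (0 : ℝ) ≤ _).trans (hC (z, x))
    rw [← hx, zero_mul]
    positivity
  have hdiff : Differentiable ℝ (iteratedFDeriv ℝ n Θ) :=
    (Θ.smooth (n + 1 : ℕ)).differentiable_iteratedFDeriv (by exact_mod_cast n.lt_succ_self)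
  have hbound : ∀ y ∈ Set.univ ×ˢ {x}, ‖fderiv ℝ (iteratedFDeriv ℝ n Θ) y‖ ≤ C / ‖x‖ ^ k := by
    rintro ⟨y, w⟩ ⟨-, rfl : w = x⟩
    rw [le_div_iff₀' hx, norm_fderiv_iteratedFDeriv]
    refine le_trans ?_ (hC (y, w))
    gcongr
    exact norm_snd_le (y, w)
  have hlip := (convex_univ.prod (convex_singleton x)).norm_image_sub_le_of_norm_fderiv_le
    (fun y _ => hdiff y) hbound (Set.mk_mem_prod (Set.mem_univ z') rfl)
    (Set.mk_mem_prod (Set.mem_univ z) rfl)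
  have hnorm : ‖(z, x) - (z', x)‖ = ‖z - z'‖ := by simp [Prod.norm_def]
  calc _ ≤ ‖x‖ ^ k * (C / ‖x‖ ^ k * ‖z - z'‖) := by
        rw [← hnorm]
        gcongr
    _ = C * ‖z - z'‖ := by field_simp

theorem continuous_weightedDeriv_slice (Θ : 𝓢(E × F, ℂ)) (k n : ℕ) :
    Continuous fun z => weightedDeriv k n (slice Θ z) := by
  obtain ⟨C, hC₀, hC⟩ := Θ.decay k (n + 1)
  refine (LipschitzWith.of_dist_le' (K := C) fun z z' => ?_).continuous
  rw [dist_eq_norm, dist_eq_norm, ← map_sub]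
  refine (BoundedContinuousFunction.norm_le (by positivity)).2 fun x => ?_
  have hsub : iteratedFDeriv ℝ n (slice Θ z - slice Θ z') x =
      (iteratedFDeriv ℝ n Θ (z, x) - iteratedFDeriv ℝ n Θ (z', x)).compContinuousLinearMap
        (fun _ => ContinuousLinearMap.inr ℝ E F) := by
    rw [show ⇑(slice Θ z - slice Θ z') = slice Θ z - slice Θ z' from rfl,
      iteratedFDeriv_sub_apply ((slice Θ z).smooth n).contDiffAt
      ((slice Θ z').smooth n).contDiffAt, iteratedFDeriv_slice, iteratedFDeriv_slice]
    rfl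
  rw [norm_weightedDeriv_apply, hsub]
  exact (mul_le_mul_of_nonneg_left (norm_compContinuousLinearMap_inr_le _) (by positivity)).trans
    (pow_mul_norm_iteratedFDeriv_sub_le hC z z' x)

section Integral

variable [MeasurableSpace E] [BorelSpace E] [SecondCountableTopology E]
  (μ : Measure E) [μ.HasTemperateGrowth]

theorem integrable_weightedDeriv_slice (Θ : 𝓢(E × F, ℂ)) (k n : ℕ) :
    Integrable (fun z => weightedDeriv k n (slice Θ z)) μ := by
  obtain ⟨C, hC₀, hC⟩ := exists_pow_mul_norm_iteratedFDeriv_slice_le Θ k n μ.integrablePower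
  refine (μ.integrable_pow_neg_integrablePower.const_mul C).mono'
    (continuous_weightedDeriv_slice Θ k n).aestronglyMeasurable (.of_forall fun z => ?_)
  exact (BoundedContinuousFunction.norm_le (by positivity)).2 fun x =>
    norm_weightedDeriv_apply k n (slice Θ z) x ▸ hC z x

theorem weightedDeriv_eq_integral_slice (Θ : 𝓢(E × F, ℂ)) {f : 𝓢(F, ℂ)}
    (hf : ∀ x, f x = ∫ z, Θ (z, x) ∂μ) (k n : ℕ) :
    weightedDeriv k n f = ∫ z, weightedDeriv k n (slice Θ z) ∂μ := by
  ext1 x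
  refine Eq.trans ?_ ((BoundedContinuousFunction.evalCLM ℝ x).integral_comp_comm
    (integrable_weightedDeriv_slice μ Θ k n))
  simp only [weightedDeriv_apply, BoundedContinuousFunction.evalCLM_apply]
  rw [integral_smul, iteratedFDeriv_eq_integral_slice μ Θ hf]

theorem integral_apply_slice (T : 𝓢(F, ℂ) →L[ℂ] ℂ) (Θ : 𝓢(E × F, ℂ)) {f : 𝓢(F, ℂ)}
    (hf : ∀ x, f x = ∫ z, Θ (z, x) ∂μ) :
    (Continuous fun z => T (slice Θ z)) ∧ Integrable (fun z => T (slice Θ z)) μ ∧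
      T f = ∫ z, T (slice Θ z) ∂μ := by
  obtain ⟨s, Λ, hΛ⟩ := exists_factor_weightedDeriv T
  have hcont (i : s) := continuous_weightedDeriv_slice Θ i.1.1 i.1.2
  have hint (i : s) := integrable_weightedDeriv_slice μ Θ i.1.1 i.1.2
  have hint' := Integrable.of_eval hint
  simp only [hΛ]
  refine ⟨Λ.continuous.comp (continuous_pi hcont), Λ.integrable_comp hint', ?_⟩
  rw [Λ.integral_comp_comm hint']
  congr 1 with i : 1
  rw [eval_integral hint, weightedDeriv_eq_integral_slice μ Θ hf]

end Integral

end Slice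

section TensorProd

variable {E F : Type*} [NormedAddCommGroup E] [InnerProductSpace ℝ E] [NormedAddCommGroup F]
  [InnerProductSpace ℝ F]

theorem norm_iteratedFDeriv_mul_prod_le (a : 𝓢(E, ℂ)) (b : 𝓢(F, ℂ)) (n : ℕ) (w : E × F) :
    ‖iteratedFDeriv ℝ n (fun w : E × F => a w.1 * b w.2) w‖ ≤ ∑ i ∈ Finset.range (n + 1),
      (n.choose i : ℝ) * ‖iteratedFDeriv ℝ i a w.1‖ * ‖iteratedFDeriv ℝ (n - i) b w.2‖ := by
  refine (norm_iteratedFDeriv_mul_le (N := ((⊤ : ℕ∞) : WithTop ℕ∞))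
    (f := fun w : E × F => a (ContinuousLinearMap.fst ℝ E F w))
    (g := fun w : E × F => b (ContinuousLinearMap.snd ℝ E F w))
    ((a.smooth ⊤).comp contDiff_fst) ((b.smooth ⊤).comp contDiff_snd) w (mod_cast le_top)).trans
    (Finset.sum_le_sum fun i _ => ?_)
  gcongr
  · exact norm_iteratedFDeriv_comp_clm_le _ (ContinuousLinearMap.norm_fst_le ℝ E F) a i w
  · exact norm_iteratedFDeriv_comp_clm_le _ (ContinuousLinearMap.norm_snd_le ℝ E F) b (n - i) w

theorem pow_mul_norm_iteratedFDeriv_mul_prod_le (a : 𝓢(E, ℂ)) (b : 𝓢(F, ℂ)) (k n : ℕ)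
    (w : E × F) :
    ‖w‖ ^ k * ‖iteratedFDeriv ℝ n (fun w : E × F => a w.1 * b w.2) w‖ ≤
      (∑ i ∈ Finset.range (n + 1), (n.choose i : ℝ) *
        (SchwartzMap.seminorm ℂ k i a + SchwartzMap.seminorm ℂ 0 i a)) *
      (Finset.Iic (k, n)).sup (schwartzSeminormFamily ℂ F ℂ) b := by
  set S := (Finset.Iic (k, n)).sup (schwartzSeminormFamily ℂ F ℂ) b
  have hb (j : ℕ) (hj : j ≤ n) (l : ℕ) (hl : l ≤ k) :
      ‖w.2‖ ^ l * ‖iteratedFDeriv ℝ j b w.2‖ ≤ S :=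
    (SchwartzMap.le_seminorm ℂ l j b w.2).trans (Seminorm.le_finset_sup_apply
      (p := schwartzSeminormFamily ℂ F ℂ) (i := (l, j)) (Finset.mem_Iic.2 ⟨hl, hj⟩))
  have hpow : ‖w‖ ^ k ≤ ‖w.1‖ ^ k + ‖w.2‖ ^ k := by
    rw [Prod.norm_def]
    rcases le_total ‖w.1‖ ‖w.2‖ with h | h
    · simp [h]
    · simp [h]
  calc _ ≤ (‖w.1‖ ^ k + ‖w.2‖ ^ k) * ∑ i ∈ Finset.range (n + 1),
        (n.choose i : ℝ) * ‖iteratedFDeriv ℝ i a w.1‖ * ‖iteratedFDeriv ℝ (n - i) b w.2‖ := by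
        gcongr
        exact norm_iteratedFDeriv_mul_prod_le a b n w
    _ ≤ _ := by
        rw [Finset.mul_sum, Finset.sum_mul]
        refine Finset.sum_le_sum fun i _ => ?_
        have ha := SchwartzMap.le_seminorm ℂ k i a w.1
        have ha₀ : ‖iteratedFDeriv ℝ i a w.1‖ ≤ SchwartzMap.seminorm ℂ 0 i a := by
          simpa using SchwartzMap.le_seminorm ℂ 0 i a w.1
        have hb' := hb (n - i) (n.sub_le i) k le_rfl
        have hb₀ : ‖iteratedFDeriv ℝ (n - i) b w.2‖ ≤ S := by
          simpa using hb (n - i) (n.sub_le i) 0 k.zero_le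
        calc _ = (n.choose i : ℝ) * ((‖w.1‖ ^ k * ‖iteratedFDeriv ℝ i a w.1‖) *
              ‖iteratedFDeriv ℝ (n - i) b w.2‖ + ‖iteratedFDeriv ℝ i a w.1‖ *
              (‖w.2‖ ^ k * ‖iteratedFDeriv ℝ (n - i) b w.2‖)) := by ring
          _ ≤ (n.choose i : ℝ) * (SchwartzMap.seminorm ℂ k i a * S +
              SchwartzMap.seminorm ℂ 0 i a * S) := by gcongr
          _ = _ := by ring

/-- The tensor product `(x, y) ↦ a(x) b(y)` of Schwartz functions on two spaces, as a continuous
linear function of `b`. -/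
noncomputable def tensorProd (a : 𝓢(E, ℂ)) : 𝓢(F, ℂ) →L[ℂ] 𝓢(E × F, ℂ) :=
  SchwartzMap.mkCLM (fun b w => a w.1 * b w.2) (fun f g x => by simp [mul_add])
    (fun c f x => by simp [mul_left_comm])
    (fun b => ((a.smooth ⊤).comp contDiff_fst).mul ((b.smooth ⊤).comp contDiff_snd))
    fun ⟨k, n⟩ => ⟨Finset.Iic (k, n), _, by positivity,
      fun b w => pow_mul_norm_iteratedFDeriv_mul_prod_le a b k n w⟩

end TensorProd

section Family

variable {V : Type*} [NormedAddCommGroup V] [InnerProductSpace ℝ V]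

theorem hasTemperateGrowth_conj_character :
    (fun w : WithLp 2 (V × V) × V =>
      Complex.exp (2 * Real.pi * Complex.I * ((-⟪w.1.snd, w.2⟫ : ℝ) : ℂ))).HasTemperateGrowth := by
  refine hasTemperateGrowth_cexp.comp (f := fun w : WithLp 2 (V × V) × V =>
    (-⟪w.1.snd, w.2⟫ : ℝ)) (Function.HasTemperateGrowth.neg ?_)
  exact (innerSL ℝ).bilinear_hasTemperateGrowth
    ((WithLp.sndL 2 ℝ V V).comp (ContinuousLinearMap.fst ℝ _ V)).hasTemperateGrowth
    (ContinuousLinearMap.snd ℝ (WithLp 2 (V × V)) V).hasTemperateGrowth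

/-- The shear `(z, t) ↦ (z, t - x)`, where `z = (x, ξ)`. -/
noncomputable def shearEquiv : (WithLp 2 (V × V) × V) ≃L[ℝ] (WithLp 2 (V × V) × V) :=
  ContinuousLinearEquiv.equivOfInverse
    ((ContinuousLinearMap.fst ℝ (WithLp 2 (V × V)) V).prod
      (ContinuousLinearMap.snd ℝ (WithLp 2 (V × V)) V -
        (WithLp.fstL 2 ℝ V V).comp (ContinuousLinearMap.fst ℝ (WithLp 2 (V × V)) V)))
    ((ContinuousLinearMap.fst ℝ (WithLp 2 (V × V)) V).prod
      (ContinuousLinearMap.snd ℝ (WithLp 2 (V × V)) V +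
        (WithLp.fstL 2 ℝ V V).comp (ContinuousLinearMap.fst ℝ (WithLp 2 (V × V)) V)))
    (fun w => by simp) (fun w => by simp)

/-- The Schwartz function `(z, t) ↦ H(z) conj (M_ξ T_x g (t))`, where `z = (x, ξ)`; integrating it
in `z` superposes time-frequency shifts of `g`. -/
noncomputable def shiftFamily (H : 𝓢(WithLp 2 (V × V), ℂ)) (g : 𝓢(V, ℂ)) :
    𝓢(WithLp 2 (V × V) × V, ℂ) :=
  SchwartzMap.smulLeftCLM ℂ (fun w : WithLp 2 (V × V) × V =>
      Complex.exp (2 * Real.pi * Complex.I * ((-⟪w.1.snd, w.2⟫ : ℝ) : ℂ)))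
    (SchwartzMap.compCLMOfContinuousLinearEquiv ℂ shearEquiv (tensorProd H (conjS g)))

theorem conj_cexp (x : ℝ) : conj (Complex.exp (2 * Real.pi * Complex.I * (x : ℂ))) =
    Complex.exp (2 * Real.pi * Complex.I * ((-x : ℝ) : ℂ)) := by
  rw [← Complex.exp_conj]
  congr 1
  simp [Complex.conj_ofNat]

theorem norm_cexp_two_pi_mul_I_mul_ofReal (x : ℝ) :
    ‖Complex.exp (2 * Real.pi * Complex.I * (x : ℂ))‖ = 1 := by
  rw [show 2 * Real.pi * Complex.I * (x : ℂ) = ((2 * Real.pi * x : ℝ) : ℂ) * Complex.I by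
    push_cast; ring, Complex.norm_exp_ofReal_mul_I]

theorem shiftFamily_apply (H : 𝓢(WithLp 2 (V × V), ℂ)) (g : 𝓢(V, ℂ)) (z : WithLp 2 (V × V))
    (t : V) : shiftFamily H g (z, t) = H z * conj (tfShift z.fst z.snd g t) := by
  rw [shiftFamily, SchwartzMap.smulLeftCLM_apply_apply hasTemperateGrowth_conj_character,
    tfShift_apply, map_mul, conj_cexp, smul_eq_mul, mul_left_comm]
  rfl

theorem slice_shiftFamily (H : 𝓢(WithLp 2 (V × V), ℂ)) (g : 𝓢(V, ℂ)) (z : WithLp 2 (V × V)) :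
    slice (shiftFamily H g) z = H z • conjS (tfShift z.fst z.snd g) := by
  ext t
  exact shiftFamily_apply H g z t

theorem conjS_smul (c : ℂ) (h : 𝓢(V, ℂ)) : conjS (c • h) = conj c • conjS h := by
  ext t
  simp [conjS_apply]

theorem bracket_smul (f : 𝓢'(V, ℂ)) (c : ℂ) (h : 𝓢(V, ℂ)) :
    bracket f (c • h) = conj c * bracket f h := by
  rw [bracket, conjS_smul, map_smul]
  rfl

theorem stft_zero_left (f : 𝓢'(V, ℂ)) (x ξ : V) : stft 0 f x ξ = 0 := by
  have : tfShift x ξ (0 : 𝓢(V, ℂ)) = (0 : ℂ) • 0 := by simp [tfShift]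
  rw [stft, this, bracket_smul, map_zero, zero_mul]

/-- The product `t ↦ h(t) conj (g(t - x))` of `h` with the conjugate of the window `g` translated to
`x`, whose Fourier transform is `V_g h(x, ·)`. -/
noncomputable def windowed (g h : 𝓢(V, ℂ)) (x : V) : 𝓢(V, ℂ) :=
  SchwartzMap.pairing (ContinuousLinearMap.mul ℂ ℂ) h (conjS (SchwartzMap.compSubConstCLM ℂ x g))

theorem windowed_apply (g h : 𝓢(V, ℂ)) (x t : V) : windowed g h x t = h t * conj (g (t - x)) := rfl

end Family

section Growth

variable {V : Type*} [NormedAddCommGroup V] [InnerProductSpace ℝ V]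

theorem exists_norm_iteratedFDeriv_character_le (n : ℕ) : ∃ (k : ℕ) (C : ℝ), 0 ≤ C ∧ ∀ i ≤ n,
    ∀ ξ t : V, ‖iteratedFDeriv ℝ i (character ξ) t‖ ≤
      C * (1 + ‖ξ‖) ^ (n + k) * (1 + ‖t‖) ^ (n + k) := by
  obtain ⟨k, C, hC₀, hC⟩ := hasTemperateGrowth_cexp.norm_iteratedFDeriv_le_uniform n
  refine ⟨k, C, hC₀, fun i hi ξ t => ?_⟩
  have hinner : 1 + ‖⟪ξ, t⟫‖ ≤ (1 + ‖ξ‖) * (1 + ‖t‖) := by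
    nlinarith [norm_inner_le_norm (𝕜 := ℝ) ξ t, norm_nonneg ξ, norm_nonneg t]
  have hξ : (1 : ℝ) ≤ 1 + ‖ξ‖ := by simp
  have ht : (1 : ℝ) ≤ 1 + ‖t‖ := by simp
  rw [show character ξ = (fun x : ℝ => Complex.exp (2 * Real.pi * Complex.I * (x : ℂ))) ∘
    innerSL ℝ ξ from rfl, (innerSL ℝ ξ).iteratedFDeriv_comp_right
      (hasTemperateGrowth_cexp.1.of_le (mod_cast le_top)) t le_rfl]
  calc _ ≤ ‖iteratedFDeriv ℝ i _ ⟪ξ, t⟫‖ * ∏ _ : Fin i, ‖innerSL ℝ ξ‖ :=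
        ContinuousMultilinearMap.norm_compContinuousLinearMap_le _ _
    _ ≤ (C * (1 + ‖⟪ξ, t⟫‖) ^ k) * ‖ξ‖ ^ i := by
        rw [Finset.prod_const, Finset.card_univ, Fintype.card_fin, innerSL_apply_norm]
        gcongr
        exact hC i hi _
    _ ≤ (C * ((1 + ‖ξ‖) * (1 + ‖t‖)) ^ k) * ((1 + ‖ξ‖) * (1 + ‖t‖)) ^ n := by
        gcongr
        calc ‖ξ‖ ^ i ≤ ((1 + ‖ξ‖) * (1 + ‖t‖)) ^ i := by
              gcongr
              nlinarith [norm_nonneg ξ, norm_nonneg t]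
          _ ≤ _ := pow_le_pow_right₀ (one_le_mul_of_one_le_of_one_le hξ ht) hi
    _ = _ := by
        rw [mul_pow, mul_pow]
        ring

theorem one_add_norm_pow_mul_norm_iteratedFDeriv_sub_le (g : 𝓢(V, ℂ)) (N : ℕ) {j n : ℕ}
    (hj : j ≤ n) (x t : V) : (1 + ‖t‖) ^ N * ‖iteratedFDeriv ℝ j g (t - x)‖ ≤
      (1 + ‖x‖) ^ N * (2 ^ N * (Finset.Iic (N, n)).sup (schwartzSeminormFamily ℝ V ℂ) g) := by
  have ht : 1 + ‖t‖ ≤ (1 + ‖x‖) * (1 + ‖t - x‖) := by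
    nlinarith [norm_le_norm_add_norm_sub' t x, norm_nonneg x, norm_nonneg (t - x)]
  calc _ ≤ ((1 + ‖x‖) * (1 + ‖t - x‖)) ^ N * ‖iteratedFDeriv ℝ j g (t - x)‖ := by gcongr
    _ = (1 + ‖x‖) ^ N * ((1 + ‖t - x‖) ^ N * ‖iteratedFDeriv ℝ j g (t - x)‖) := by
        rw [mul_pow, mul_assoc]
    _ ≤ _ := mul_le_mul_of_nonneg_left
        (one_add_le_sup_seminorm_apply (𝕜 := ℝ) (m := (N, n)) le_rfl hj g _) (by positivity)

theorem exists_pow_mul_norm_iteratedFDeriv_character_mul_le (g : 𝓢(V, ℂ)) (k n : ℕ) :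
    ∃ (N : ℕ) (C : ℝ), 0 ≤ C ∧ ∀ (z : WithLp 2 (V × V)) (t : V) (i : ℕ), i ≤ n →
      ‖t‖ ^ k * (‖iteratedFDeriv ℝ i (character z.snd) t‖ *
        ‖iteratedFDeriv ℝ (n - i) g (t - z.fst)‖) ≤ C * (1 + ‖z‖) ^ N := by
  obtain ⟨l, C, hC₀, hC⟩ := exists_norm_iteratedFDeriv_character_le (V := V) n
  set m := n + l
  set S := 2 ^ (k + m) * (Finset.Iic (k + m, n)).sup (schwartzSeminormFamily ℝ V ℂ) g
  refine ⟨m + (k + m), C * S, by positivity, fun z t i hi => ?_⟩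
  calc _ ≤ (1 + ‖t‖) ^ k * ((C * (1 + ‖z‖) ^ m * (1 + ‖t‖) ^ m) *
        ‖iteratedFDeriv ℝ (n - i) g (t - z.fst)‖) := by
        gcongr
        · simp
        · refine (hC i hi _ t).trans ?_
          gcongr
          exact WithLp.norm_snd_le (p := 2) V z
    _ = C * (1 + ‖z‖) ^ m * ((1 + ‖t‖) ^ (k + m) *
        ‖iteratedFDeriv ℝ (n - i) g (t - z.fst)‖) := by ring
    _ ≤ C * (1 + ‖z‖) ^ m * ((1 + ‖z‖) ^ (k + m) * S) := by
        refine mul_le_mul_of_nonneg_left ?_ (by positivity)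
        refine (one_add_norm_pow_mul_norm_iteratedFDeriv_sub_le g (k + m) (n.sub_le i)
          z.fst t).trans ?_
        gcongr
        exact WithLp.norm_fst_le (p := 2) V z
    _ = _ := by ring

theorem exists_seminorm_tfShift_le (g : 𝓢(V, ℂ)) (k n : ℕ) : ∃ (N : ℕ) (C : ℝ), 0 ≤ C ∧
    ∀ z : WithLp 2 (V × V),
      SchwartzMap.seminorm ℝ k n (tfShift z.fst z.snd g) ≤ C * (1 + ‖z‖) ^ N := by
  obtain ⟨N, C, hC₀, hC⟩ := exists_pow_mul_norm_iteratedFDeriv_character_mul_le g k n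
  refine ⟨N, 2 ^ n * C, by positivity, fun z =>
    SchwartzMap.seminorm_le_bound ℝ k n _ (by positivity) fun t => ?_⟩
  have hleibniz := norm_iteratedFDeriv_mul_le (n := n) (N := ((⊤ : ℕ∞) : WithTop ℕ∞))
    (hasTemperateGrowth_character z.snd).1
    (g := fun t => g (t - z.fst)) ((g.smooth ⊤).comp (contDiff_id.sub contDiff_const)) t
    (mod_cast le_top)
  rw [show ⇑(tfShift z.fst z.snd g) = fun t => character z.snd t * g (t - z.fst) from
    funext (tfShift_apply _ _ g)]
  calc _ ≤ ‖t‖ ^ k * ∑ i ∈ Finset.range (n + 1),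
        (n.choose i : ℝ) * ‖iteratedFDeriv ℝ i (character z.snd) t‖ *
          ‖iteratedFDeriv ℝ (n - i) (fun t => g (t - z.fst)) t‖ := by gcongr
    _ ≤ ∑ i ∈ Finset.range (n + 1), (n.choose i : ℝ) * (C * (1 + ‖z‖) ^ N) := by
        rw [Finset.mul_sum]
        refine Finset.sum_le_sum fun i hi => ?_
        rw [iteratedFDeriv_comp_sub, mul_assoc, mul_left_comm]
        exact mul_le_mul_of_nonneg_left (hC z t i (Finset.mem_range_succ_iff.1 hi))
          (Nat.cast_nonneg _)
    _ = _ := by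
        rw [← Finset.sum_mul, ← Nat.cast_sum, Nat.sum_range_choose]
        push_cast
        ring

/-- The continuous linear form underlying a tempered distribution. -/
noncomputable def toLinearForm (f : 𝓢'(V, ℂ)) : 𝓢(V, ℂ) →L[ℂ] ℂ :=
  (UniformConvergenceCLM.ofFun (RingHom.id ℂ) ℂ _).symm f

theorem toLinearForm_conjS (f : 𝓢'(V, ℂ)) (h : 𝓢(V, ℂ)) :
    toLinearForm f (conjS h) = bracket f h := rfl

theorem exists_norm_stft_le (g : 𝓢(V, ℂ)) (f : 𝓢'(V, ℂ)) : ∃ (N : ℕ) (C : ℝ),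
    ∀ z : WithLp 2 (V × V), ‖stft g f z.fst z.snd‖ ≤ C * (1 + ‖z‖) ^ N := by
  let T : 𝓢(V, ℂ) →L[ℝ] ℂ := ((toLinearForm f).restrictScalars ℝ).comp
    (SchwartzMap.postcompCLM (𝕜 := ℝ) (Complex.conjCLE : ℂ →L[ℝ] ℂ))
  obtain ⟨s, D, -, hD⟩ := Seminorm.bound_of_continuous (schwartz_withSeminorms ℝ V ℂ)
    ((normSeminorm ℝ ℂ).comp (T : 𝓢(V, ℂ) →ₗ[ℝ] ℂ)) (continuous_norm.comp T.continuous)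
  choose N C hC₀ hC using exists_seminorm_tfShift_le g
  refine ⟨s.sup fun i => N i.1 i.2, D * ∑ i ∈ s, C i.1 i.2, fun z => ?_⟩
  refine (hD (tfShift z.fst z.snd g)).trans ?_
  rw [mul_assoc]
  have hsum : 0 ≤ ∑ i ∈ s, C i.1 i.2 := Finset.sum_nonneg fun i _ => hC₀ _ _
  refine mul_le_mul_of_nonneg_left (Seminorm.finset_sup_apply_le ?_ fun i hi => ?_) D.2
  · exact mul_nonneg hsum (by positivity)
  · refine (hC i.1 i.2 z).trans ?_
    gcongr
    · exact Finset.single_le_sum (f := fun i : ℕ × ℕ => C i.1 i.2) (fun i _ => hC₀ _ _) hi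
    · simp
    · exact Finset.le_sup (f := fun i : ℕ × ℕ => N i.1 i.2) hi

end Growth

/-! ### The inversion formula -/

section Inversion

variable {V : Type*} [NormedAddCommGroup V] [InnerProductSpace ℝ V] [MeasurableSpace V]
  [BorelSpace V] [FiniteDimensional ℝ V]

theorem bracket_eq_integral (f : 𝓢'(V, ℂ)) (H : 𝓢(WithLp 2 (V × V), ℂ)) (g h : 𝓢(V, ℂ))
    (hh : ∀ t, conj (h t) = ∫ z : WithLp 2 (V × V), H z * conj (tfShift z.fst z.snd g t)) :
    (Continuous fun z : WithLp 2 (V × V) => H z * stft g f z.fst z.snd) ∧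
    Integrable (fun z : WithLp 2 (V × V) => H z * stft g f z.fst z.snd) ∧
    bracket f h = ∫ z : WithLp 2 (V × V), H z * stft g f z.fst z.snd := by
  have := integral_apply_slice volume (toLinearForm f) (shiftFamily H g) (f := conjS h)
    fun t => by simp only [shiftFamily_apply, conjS_apply, hh]
  simp only [slice_shiftFamily, map_smul, toLinearForm_conjS] at this
  exact this

theorem stftS_apply (g h : 𝓢(V, ℂ)) (z : WithLp 2 (V × V)) : stftS g h z = stftFun g h z := rfl

theorem stftS_eq_fourier (g h : 𝓢(V, ℂ)) : stftS g h = 𝓕 (stftKernel g h) :=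
  DFunLike.coe_injective (fourier_stftKernel g h).symm

theorem stftFun_eq_fourier (g h : 𝓢(V, ℂ)) (x ξ : V) :
    stftFun g h (WithLp.toLp 2 (x, ξ)) = 𝓕 (windowed g h x) ξ := by
  rw [SchwartzMap.fourier_coe, Real.fourier_eq', stftFun]
  refine integral_congr_ae (.of_forall fun t => ?_)
  simp only [windowed_apply, smul_eq_mul, WithLp.toLp_fst, WithLp.toLp_snd]
  rw [mul_comm, real_inner_comm]
  congr 2
  push_cast
  ring

theorem integral_stftFun_mul_tfShift_snd (g h : 𝓢(V, ℂ)) (x t : V) :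
    ∫ ξ, stftFun g h (WithLp.toLp 2 (x, ξ)) * tfShift x ξ g t =
      ((‖g (t - x)‖ ^ 2 : ℝ) : ℂ) * h t := by
  have hinv : (𝓕⁻ (𝓕 (windowed g h x)) : 𝓢(V, ℂ)) t = windowed g h x t := by simp
  rw [SchwartzMap.fourierInv_coe, Real.fourierInv_eq', windowed_apply] at hinv
  have hexp (ξ : V) : stftFun g h (WithLp.toLp 2 (x, ξ)) * tfShift x ξ g t =
      (Complex.exp ((2 * Real.pi * ⟪ξ, t⟫ : ℝ) * Complex.I) • 𝓕 (windowed g h x) ξ) *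
        g (t - x) := by
    rw [stftFun_eq_fourier, tfShift_apply, show (2 * Real.pi * Complex.I * (⟪ξ, t⟫ : ℝ) : ℂ) =
      (2 * Real.pi * ⟪ξ, t⟫ : ℝ) * Complex.I by push_cast; ring, smul_eq_mul]
    ring
  simp only [hexp]
  rw [integral_mul_const, hinv, mul_assoc, ← Complex.normSq_eq_conj_mul_self,
    Complex.normSq_eq_norm_sq, mul_comm]

theorem integrable_stftFun_mul_tfShift (g h : 𝓢(V, ℂ)) (t : V) :
    Integrable fun z : WithLp 2 (V × V) => stftFun g h z * tfShift z.fst z.snd g t := by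
  have hmeas : AEStronglyMeasurable fun z : WithLp 2 (V × V) =>
      stftFun g h z * tfShift z.fst z.snd g t := by
    refine Continuous.aestronglyMeasurable ?_
    have hstft := (stftS g h).continuous
    have hg := g.continuous
    have : Continuous fun z : WithLp 2 (V × V) => z.fst := (WithLp.fstL 2 ℝ V V).continuous
    have : Continuous fun z : WithLp 2 (V × V) => z.snd := (WithLp.sndL 2 ℝ V V).continuous
    simp only [tfShift_apply, ← stftS_apply]
    fun_prop
  refine (integrable_norm_iff hmeas).1 ?_
  refine (integrable_iteratedFDeriv_slice volume
    (shiftFamily (conjS (stftS g h)) g) 0 t).norm.congr (.of_forall fun z => ?_)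
  simp [slice_apply, shiftFamily_apply, conjS_apply, stftS_apply]

theorem integral_stftFun_mul_tfShift (g h : 𝓢(V, ℂ)) (t : V) :
    ∫ z : WithLp 2 (V × V), stftFun g h z * tfShift z.fst z.snd g t =
      (∫ x, (‖g x‖ ^ 2 : ℝ) : ℝ) * h t := by
  have hmp := WithLp.volume_preserving_toLp V V
  calc _ = ∫ w : V × V, stftFun g h (WithLp.toLp 2 w) * tfShift w.1 w.2 g t ∂volume.prod volume :=
        (hmp.integral_comp (MeasurableEquiv.toLp 2 (V × V)).measurableEmbedding _).symm
    _ = ∫ x, ∫ ξ, stftFun g h (WithLp.toLp 2 (x, ξ)) * tfShift x ξ g t := integral_prod _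
        (hmp.integrable_comp_of_integrable (integrable_stftFun_mul_tfShift g h t))
    _ = ∫ x, ((‖g (t - x)‖ ^ 2 : ℝ) : ℂ) * h t := by
        simp only [integral_stftFun_mul_tfShift_snd]
    _ = _ := by
        rw [integral_mul_const, integral_sub_left_eq_self (fun x => ((‖g x‖ ^ 2 : ℝ) : ℂ)),
          integral_complex_ofReal]

theorem stft_coe (g h : 𝓢(V, ℂ)) (z : WithLp 2 (V × V)) :
    stft g (h : 𝓢'(V, ℂ)) z.fst z.snd = stftFun g h z := by
  simp only [stft, bracket, SchwartzMap.coe_apply, conjS_apply, stftFun, tfShift_apply, map_mul,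
    conj_cexp, smul_eq_mul, Complex.ofReal_neg, mul_neg]
  exact integral_congr_ae (.of_forall fun t => by ring)

theorem integral_norm_sq_pos {g : 𝓢(V, ℂ)} (hg : g ≠ 0) : 0 < ∫ x, ‖g x‖ ^ 2 := by
  obtain ⟨x, hx⟩ := DFunLike.ne_iff.1 hg
  exact integral_pos_of_integrable_nonneg_nonzero (x := x) (g.continuous.norm.pow 2)
    ((g.memLp 2 volume).integrable_norm_pow (by norm_num)) (fun _ => by positivity)
    (by simpa using hx)

theorem bracket_eq_integral_stft (f : 𝓢'(V, ℂ)) (g h : 𝓢(V, ℂ)) :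
    (Continuous fun z : WithLp 2 (V × V) => conj (stftFun g h z) * stft g f z.fst z.snd) ∧
    Integrable (fun z : WithLp 2 (V × V) => conj (stftFun g h z) * stft g f z.fst z.snd) ∧
    ((∫ x, ‖g x‖ ^ 2 : ℝ) : ℂ) * bracket f h =
      ∫ z : WithLp 2 (V × V), conj (stftFun g h z) * stft g f z.fst z.snd := by
  have := bracket_eq_integral f (conjS (stftS g h)) g (((∫ x, ‖g x‖ ^ 2 : ℝ) : ℂ) • h)
    fun t => by
      rw [smul_apply, smul_eq_mul, ← integral_stftFun_mul_tfShift g h t, ← integral_conj]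
      simp only [map_mul, conjS_apply, stftS_apply]
  rw [bracket_smul, Complex.conj_ofReal] at this
  exact this

theorem stftFun_tfShift_self (g : 𝓢(V, ℂ)) (z : WithLp 2 (V × V)) :
    stftFun g (tfShift z.fst z.snd g) z = ((∫ x, ‖g x‖ ^ 2 : ℝ) : ℂ) := by
  rw [← integral_complex_ofReal, ← integral_sub_right_eq_self _ z.fst, stftFun]
  refine integral_congr_ae (.of_forall fun t => ?_)
  beta_reduce
  rw [tfShift_apply, Complex.exp_neg, Complex.ofReal_pow, ← Complex.mul_conj']
  field_simp [Complex.exp_ne_zero]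

-- Near `z₀`, the transform is the quotient of the integrand of the reproducing formula for
-- `h = M_ξ T_x g`, `z₀ = (x, ξ)`, by `conj (V_g h)`, which does not vanish at `z₀`.
theorem continuous_stft (g : 𝓢(V, ℂ)) (f : 𝓢'(V, ℂ)) :
    Continuous fun z : WithLp 2 (V × V) => stft g f z.fst z.snd := by
  rcases eq_or_ne g 0 with rfl | hg
  · simpa only [stft_zero_left] using continuous_const
  refine continuous_iff_continuousAt.2 fun z₀ => ?_
  let h := tfShift z₀.fst z₀.snd g
  have hden : Continuous fun z : WithLp 2 (V × V) => conj (stftFun g h z) :=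
    Complex.continuous_conj.comp (stftS g h).continuous
  have hden₀ : conj (stftFun g h z₀) ≠ 0 := by
    rw [stftFun_tfShift_self, Complex.conj_ofReal]
    exact_mod_cast (integral_norm_sq_pos hg).ne'
  refine ((bracket_eq_integral_stft f g h).1.continuousAt.div hden.continuousAt hden₀).congr ?_
  filter_upwards [hden.continuousAt.eventually_ne hden₀] with z hz
  rw [Pi.div_apply, mul_div_cancel_left₀ _ hz]

/-- The short-time Fourier transform `ψ ↦ V_φ ψ` of Schwartz functions with the fixed window `φ`, as
a continuous linear map. -/
noncomputable def stftCLM (φ : 𝓢(V, ℂ)) : 𝓢(V, ℂ) →L[ℂ] 𝓢(WithLp 2 (V × V), ℂ) :=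
  (FourierTransform.fourierCLM ℂ 𝓢(WithLp 2 (V × V), ℂ)).comp
    ((SchwartzMap.smulLeftCLM ℂ chirp).comp
      ((SchwartzMap.compCLMOfContinuousLinearEquiv ℂ
        (WithLp.prodContinuousLinearEquiv 2 ℝ V V)).comp (tensorProd (𝓕 (conjS φ)))))

theorem stftCLM_apply (φ ψ : 𝓢(V, ℂ)) : stftCLM φ ψ = stftS φ ψ :=
  (stftS_eq_fourier φ ψ).symm

end Inversion

/-! ### Covariance and change of window -/

section Covariance

variable {V : Type*} [NormedAddCommGroup V]

theorem norm_toLp_le_add {W : Type*} [NormedAddCommGroup W] (x : V) (y : W) :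
    ‖WithLp.toLp 2 (x, y)‖ ≤ ‖x‖ + ‖y‖ := by
  rw [WithLp.prod_norm_eq_of_L2]
  refine Real.sqrt_le_iff.2 ⟨by positivity, ?_⟩
  simp only [WithLp.toLp_fst, WithLp.toLp_snd]
  nlinarith [norm_nonneg x, norm_nonneg y]

/-- The point `(-ζ₂, ζ₁ + z₂)` of phase space; as a function of `ζ` it is an affine isometry. -/
noncomputable def phasePoint (z ζ : WithLp 2 (V × V)) : WithLp 2 (V × V) :=
  WithLp.toLp 2 (-ζ.snd, ζ.fst + z.snd)

theorem phasePoint_sub (z ζ : WithLp 2 (V × V)) :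
    phasePoint z ζ - z = WithLp.toLp 2 (-ζ.snd - z.fst, ζ.fst) := by
  apply WithLp.ofLp_injective
  ext <;> simp [phasePoint]

variable [InnerProductSpace ℝ V]

/-- The value at `(z, ζ)` of the short-time Fourier transform of `V_{f₁} f₂` with window
`V_{g₁} g₂`, written in terms of `V_{g₁} f₁` and `V_{g₂} f₂` so that it makes sense before
`V_{f₁} f₂` is known to exist. -/
noncomputable def doubleSTFT (g₁ g₂ : 𝓢(V, ℂ)) (f₁ f₂ : 𝓢'(V, ℂ)) (z ζ : WithLp 2 (V × V)) : ℂ :=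
  conj (Complex.exp (2 * Real.pi * Complex.I * ((⟪z.snd, ζ.snd⟫ : ℝ) : ℂ))) *
    (stft g₂ f₂ (phasePoint z ζ).fst (phasePoint z ζ).snd *
      conj (stft g₁ f₁ (phasePoint z ζ - z).fst (phasePoint z ζ - z).snd))

theorem norm_doubleSTFT (g₁ g₂ : 𝓢(V, ℂ)) (f₁ f₂ : 𝓢'(V, ℂ)) (z ζ : WithLp 2 (V × V)) :
    ‖doubleSTFT g₁ g₂ f₁ f₂ z ζ‖ = ‖stft g₁ f₁ (phasePoint z ζ - z).fst (phasePoint z ζ - z).snd‖ *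
      ‖stft g₂ f₂ (phasePoint z ζ).fst (phasePoint z ζ).snd‖ := by
  rw [doubleSTFT, norm_mul, norm_mul, RCLike.norm_conj, RCLike.norm_conj,
    norm_cexp_two_pi_mul_I_mul_ofReal, one_mul, mul_comm]

variable [MeasurableSpace V] [BorelSpace V] [FiniteDimensional ℝ V]

theorem stftFun_tfShift (g h : 𝓢(V, ℂ)) (x ξ : V) (z : WithLp 2 (V × V)) :
    stftFun g (tfShift x ξ h) z =
      Complex.exp (2 * Real.pi * Complex.I * ((⟪ξ - z.snd, x⟫ : ℝ) : ℂ)) *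
        stftFun g h (z - WithLp.toLp 2 (x, ξ)) := by
  rw [stftFun, ← integral_add_right_eq_self _ x, stftFun, ← integral_const_mul]
  refine integral_congr_ae (.of_forall fun t => ?_)
  beta_reduce
  simp only [tfShift_apply, add_sub_cancel_right, WithLp.sub_fst, WithLp.sub_snd,
    WithLp.toLp_fst, WithLp.toLp_snd]
  rw [show t + x - z.fst = t - (z.fst - x) by abel]
  have phase : Complex.exp (2 * Real.pi * Complex.I * ((⟪ξ, t + x⟫ : ℝ) : ℂ)) *
      Complex.exp (-(2 * Real.pi * Complex.I * ((⟪z.snd, t + x⟫ : ℝ) : ℂ))) =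
      Complex.exp (2 * Real.pi * Complex.I * ((⟪ξ - z.snd, x⟫ : ℝ) : ℂ)) *
      Complex.exp (-(2 * Real.pi * Complex.I * ((⟪z.snd - ξ, t⟫ : ℝ) : ℂ))) := by
    rw [← Complex.exp_add, ← Complex.exp_add]
    congr 1
    simp only [inner_add_right, inner_sub_left]
    push_cast
    ring
  linear_combination (h t * conj (g (t - (z.fst - x)))) * phase

theorem norm_stftFun_tfShift (g h : 𝓢(V, ℂ)) (x ξ : V) (z : WithLp 2 (V × V)) :
    ‖stftFun g (tfShift x ξ h) z‖ = ‖stftFun g h (z - WithLp.toLp 2 (x, ξ))‖ := by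
  rw [stftFun_tfShift, norm_mul, norm_cexp_two_pi_mul_I_mul_ofReal, one_mul]

theorem tfShift_stftS (φ₁ φ₂ : 𝓢(V, ℂ)) (z ζ : WithLp 2 (V × V)) :
    tfShift z ζ (stftS φ₁ φ₂) =
      Complex.exp (2 * Real.pi * Complex.I * ((⟪z.snd, ζ.snd⟫ : ℝ) : ℂ)) •
        stftS (tfShift (-ζ.snd - z.fst) ζ.fst φ₁) (tfShift (-ζ.snd) (ζ.fst + z.snd) φ₂) := by
  ext w
  rw [tfShift_apply, stftS_apply, smul_apply, stftS_apply, smul_eq_mul]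
  conv_rhs => rw [stftFun, ← integral_add_right_eq_self _ (-ζ.snd)]
  rw [stftFun, ← integral_const_mul, ← integral_const_mul]
  refine integral_congr_ae (.of_forall fun t => ?_)
  beta_reduce
  simp only [tfShift_apply, WithLp.sub_fst, WithLp.sub_snd, map_mul, conj_cexp,
    WithLp.prod_inner_apply, WithLp.ofLp_fst, WithLp.ofLp_snd]
  rw [show t + -ζ.snd - -ζ.snd = t by abel,
    show t + -ζ.snd - w.fst - (-ζ.snd - z.fst) = t - (w.fst - z.fst) by abel]
  have phase :
      Complex.exp (2 * Real.pi * Complex.I * ((⟪ζ.fst, w.fst⟫ + ⟪ζ.snd, w.snd⟫ : ℝ) : ℂ)) *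
      Complex.exp (-(2 * Real.pi * Complex.I * ((⟪w.snd - z.snd, t⟫ : ℝ) : ℂ))) =
      Complex.exp (2 * Real.pi * Complex.I * ((⟪z.snd, ζ.snd⟫ : ℝ) : ℂ)) *
      (Complex.exp (2 * Real.pi * Complex.I * ((⟪ζ.fst + z.snd, t + -ζ.snd⟫ : ℝ) : ℂ)) *
      Complex.exp (2 * Real.pi * Complex.I * ((-⟪ζ.fst, t + -ζ.snd - w.fst⟫ : ℝ) : ℂ)) *
      Complex.exp (-(2 * Real.pi * Complex.I * ((⟪w.snd, t + -ζ.snd⟫ : ℝ) : ℂ)))) := by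
    simp only [← Complex.exp_add]
    congr 1
    simp only [inner_add_right, inner_sub_left, inner_sub_right, inner_add_left, inner_neg_right]
    rw [real_inner_comm w.snd ζ.snd]
    push_cast
    ring
  linear_combination (φ₂ t * conj (φ₁ (t - (w.fst - z.fst)))) * phase

theorem IsSTFT.stft_eq {f₁ f₂ : 𝓢'(V, ℂ)} {F : 𝓢'(WithLp 2 (V × V), ℂ)} (hF : IsSTFT f₁ f₂ F)
    (g₁ g₂ : 𝓢(V, ℂ)) (z ζ : WithLp 2 (V × V)) :
    stft (stftS g₁ g₂) F z ζ = doubleSTFT g₁ g₂ f₁ f₂ z ζ := by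
  rw [stft, tfShift_stftS, bracket_smul, hF, doubleSTFT, phasePoint_sub]
  rfl

theorem IsSTFT.enorm_stft_eq {f₁ f₂ : 𝓢'(V, ℂ)} {F : 𝓢'(WithLp 2 (V × V), ℂ)}
    (hF : IsSTFT f₁ f₂ F) (g₁ g₂ : 𝓢(V, ℂ)) (z ζ : WithLp 2 (V × V)) :
    ‖stft (stftS g₁ g₂) F z ζ‖ₑ =
      ‖stft g₁ f₁ (phasePoint z ζ - z).fst (phasePoint z ζ - z).snd‖ₑ *
        ‖stft g₂ f₂ (phasePoint z ζ).fst (phasePoint z ζ).snd‖ₑ := by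
  rw [← enorm_mul, enorm_eq_iff_norm_eq, hF.stft_eq, norm_doubleSTFT, norm_mul]

theorem measurePreserving_phasePoint (z : WithLp 2 (V × V)) : MeasurePreserving (phasePoint z) :=
  (WithLp.volume_preserving_toLp V V).comp <|
    (((Measure.measurePreserving_neg volume).prod (measurePreserving_add_right volume z.snd)).comp
      Measure.measurePreserving_swap).comp (WithLp.volume_preserving_ofLp V V)

end Covariance

section WindowChange

variable {V : Type*} [NormedAddCommGroup V]

/-- The rapidly decaying function `(1 + |x|)^{-N}`, which dominates Schwartz functions. -/
noncomputable def decayKernel (N : ℕ) (x : V) : ℝ≥0∞ := ENNReal.ofReal ((1 + ‖x‖) ^ (-(N : ℝ)))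

theorem measurable_decayKernel [MeasurableSpace V] [OpensMeasurableSpace V] (N : ℕ) :
    Measurable (decayKernel N : V → ℝ≥0∞) := by
  unfold decayKernel
  fun_prop

variable [InnerProductSpace ℝ V]

theorem exists_enorm_le_decayKernel (Ψ : 𝓢(WithLp 2 (V × V), ℂ)) (N : ℕ) : ∃ C : ℝ≥0, ∀ x ξ : V,
    ‖Ψ (WithLp.toLp 2 (x, ξ))‖ₑ ≤ C * (decayKernel N x * decayKernel N ξ) := by
  let C := 2 ^ (N + N) *
    (Finset.Iic (N + N, 0)).sup (fun m => SchwartzMap.seminorm ℝ m.1 m.2) Ψ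
  have hC : 0 ≤ C := by positivity
  refine ⟨C.toNNReal, fun x ξ => ?_⟩
  let z : WithLp 2 (V × V) := WithLp.toLp 2 (x, ξ)
  have hx : 1 + ‖x‖ ≤ 1 + ‖z‖ := by gcongr; exact WithLp.norm_fst_le (p := 2) V z
  have hξ : 1 + ‖ξ‖ ≤ 1 + ‖z‖ := by gcongr; exact WithLp.norm_snd_le (p := 2) V z
  have hΨ : (1 + ‖x‖) ^ N * (1 + ‖ξ‖) ^ N * ‖Ψ z‖ ≤ C := by
    calc _ ≤ (1 + ‖z‖) ^ N * (1 + ‖z‖) ^ N * ‖Ψ z‖ := by gcongr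
      _ = (1 + ‖z‖) ^ (N + N) * ‖iteratedFDeriv ℝ 0 Ψ z‖ := by
          rw [norm_iteratedFDeriv_zero, pow_add]
      _ ≤ C := one_add_le_sup_seminorm_apply (𝕜 := ℝ) (m := (N + N, 0)) le_rfl le_rfl Ψ z
  rw [decayKernel, decayKernel, ← ENNReal.ofReal_mul (by positivity), ← ofReal_norm,
    ← ENNReal.ofReal_coe_nnreal, Real.coe_toNNReal _ hC, ← ENNReal.ofReal_mul hC]
  refine ENNReal.ofReal_le_ofReal ?_
  rwa [Real.rpow_neg (by positivity), Real.rpow_natCast, Real.rpow_neg (by positivity),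
    Real.rpow_natCast, ← mul_inv, ← div_eq_mul_inv, le_div_iff₀ (by positivity), mul_comm]

variable [MeasurableSpace V] [BorelSpace V] [FiniteDimensional ℝ V]

theorem lintegral_withLp_prod {f : WithLp 2 (V × V) → ℝ≥0∞} (hf : Measurable f) :
    ∫⁻ z, f z = ∫⁻ x, ∫⁻ y, f (WithLp.toLp 2 (x, y)) := by
  have hmp := WithLp.volume_preserving_toLp V V
  rw [← hmp.lintegral_comp hf, Measure.volume_eq_prod]
  exact lintegral_prod _ (hf.comp hmp.measurable).aemeasurable

theorem lintegral_withLp_prod_symm {f : WithLp 2 (V × V) → ℝ≥0∞} (hf : Measurable f) :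
    ∫⁻ z, f z = ∫⁻ y, ∫⁻ x, f (WithLp.toLp 2 (x, y)) := by
  have hmp := WithLp.volume_preserving_toLp V V
  rw [← hmp.lintegral_comp hf, Measure.volume_eq_prod]
  exact lintegral_prod_symm _ (hf.comp hmp.measurable).aemeasurable

theorem ofReal_integral_norm_sq_mul_enorm_stft_le (g h : 𝓢(V, ℂ)) (f : 𝓢'(V, ℂ)) (x ξ : V) :
    ENNReal.ofReal (∫ t, ‖g t‖ ^ 2) * ‖stft h f x ξ‖ₑ ≤
      ∫⁻ z : WithLp 2 (V × V), ‖stft g f z.fst z.snd‖ₑ *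
        ‖stftFun g h (z - WithLp.toLp 2 (x, ξ))‖ₑ := by
  have hnonneg : 0 ≤ ∫ t, ‖g t‖ ^ 2 := integral_nonneg fun t => by positivity
  calc ENNReal.ofReal (∫ t, ‖g t‖ ^ 2) * ‖stft h f x ξ‖ₑ
      = ‖((∫ t, ‖g t‖ ^ 2 : ℝ) : ℂ) * bracket f (tfShift x ξ h)‖ₑ := by
        rw [enorm_mul, ← ofReal_norm ((∫ t, ‖g t‖ ^ 2 : ℝ) : ℂ), Complex.norm_real,
          Real.norm_of_nonneg hnonneg, stft]
    _ ≤ ∫⁻ z : WithLp 2 (V × V),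
          ‖conj (stftFun g (tfShift x ξ h) z) * stft g f z.fst z.snd‖ₑ := by
        rw [(bracket_eq_integral_stft f g (tfShift x ξ h)).2.2]
        exact enorm_integral_le_lintegral_enorm _
    _ = _ := by
        refine lintegral_congr fun z => ?_
        rw [enorm_mul, mul_comm]
        congr 1
        rw [enorm_eq_iff_norm_eq, RCLike.norm_conj, norm_stftFun_tfShift]

theorem exists_enorm_stft_le {g : 𝓢(V, ℂ)} (hg : g ≠ 0) (h : 𝓢(V, ℂ)) (N : ℕ) : ∃ C : ℝ≥0,
    ∀ (f : 𝓢'(V, ℂ)) (x ξ : V), ‖stft h f x ξ‖ₑ ≤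
      C * ∫⁻ x', ∫⁻ ξ', ‖stft g f x' ξ'‖ₑ * (decayKernel N (x' - x) * decayKernel N (ξ' - ξ)) := by
  obtain ⟨C, hC⟩ := exists_enorm_le_decayKernel (stftS g h) N
  have hg₀ : (∫ t, ‖g t‖ ^ 2).toNNReal ≠ 0 := by simpa using integral_norm_sq_pos hg
  refine ⟨(∫ t, ‖g t‖ ^ 2).toNNReal⁻¹ * C, fun f x ξ => ?_⟩
  have hmeas : Measurable fun z : WithLp 2 (V × V) => ‖stft g f z.fst z.snd‖ₑ *
      (decayKernel N (z.fst - x) * decayKernel N (z.snd - ξ)) := by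
    have hstft := (continuous_stft g f).measurable
    have hfst : Measurable fun z : WithLp 2 (V × V) => z.fst :=
      (WithLp.fstL 2 ℝ V V).continuous.measurable
    have hsnd : Measurable fun z : WithLp 2 (V × V) => z.snd :=
      (WithLp.sndL 2 ℝ V V).continuous.measurable
    have hdecay := measurable_decayKernel (V := V) N
    fun_prop
  rw [ENNReal.coe_mul, ENNReal.coe_inv hg₀, mul_assoc, ← ENNReal.div_eq_inv_mul,
    ENNReal.le_div_iff_mul_le (.inl (ENNReal.coe_ne_zero.2 hg₀)) (.inl ENNReal.coe_ne_top),
    mul_comm]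
  calc _ ≤ ∫⁻ z : WithLp 2 (V × V), ‖stft g f z.fst z.snd‖ₑ *
        ‖stftFun g h (z - WithLp.toLp 2 (x, ξ))‖ₑ :=
        ofReal_integral_norm_sq_mul_enorm_stft_le g h f x ξ
    _ ≤ ∫⁻ z : WithLp 2 (V × V), C * (‖stft g f z.fst z.snd‖ₑ *
        (decayKernel N (z.fst - x) * decayKernel N (z.snd - ξ))) := by
        refine lintegral_mono fun z => ?_
        rw [mul_left_comm]
        exact mul_le_mul_right (hC (z.fst - x) (z.snd - ξ)) _
    _ = _ := by
        rw [lintegral_const_mul' _ _ ENNReal.coe_ne_top, lintegral_withLp_prod hmeas]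
        simp only [WithLp.toLp_fst, WithLp.toLp_snd]

end WindowChange

/-! ### Convolution and correlation in mixed norms -/

section Lp

variable {X : Type*} [MeasurableSpace X] {μ : Measure X}

theorem one_le_toReal {p : ℝ≥0∞} (hp : 1 ≤ p) (ht : p ≠ ⊤) : 1 ≤ p.toReal := by
  simpa using ENNReal.toReal_mono ht hp

theorem rpow_sub_mul_rpow (a : ℝ≥0∞) {r s : ℝ} (hs : 0 ≤ s) (hsr : s ≤ r) :
    a ^ (r - s) * a ^ s = a ^ r := by
  rw [← ENNReal.rpow_add_of_nonneg _ _ (sub_nonneg.2 hsr) hs, sub_add_cancel]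

theorem rpow_sub_one_mul_self (a : ℝ≥0∞) {r : ℝ} (hr : 1 ≤ r) : a ^ (r - 1) * a = a ^ r := by
  simpa only [ENNReal.rpow_one] using rpow_sub_mul_rpow a zero_le_one hr

theorem eLpNorm_ennreal_top (f : X → ℝ≥0∞) : eLpNorm f ⊤ μ = essSup f μ :=
  eLpNorm_exponent_top

theorem eLpNorm_ennreal_rpow_toReal {p : ℝ≥0∞} (h0 : p ≠ 0) (ht : p ≠ ⊤) (f : X → ℝ≥0∞) :
    eLpNorm f p μ ^ p.toReal = ∫⁻ x, f x ^ p.toReal ∂μ := by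
  rw [eLpNorm_eq_lintegral_rpow_enorm_toReal h0 ht, one_div,
    ENNReal.rpow_inv_rpow (ENNReal.toReal_pos h0 ht).ne']
  rfl

theorem eLpNorm_ennreal_le_iff {p : ℝ≥0∞} (h0 : p ≠ 0) (ht : p ≠ ⊤) {f : X → ℝ≥0∞} {A : ℝ≥0∞} :
    eLpNorm f p μ ≤ A ↔ ∫⁻ x, f x ^ p.toReal ∂μ ≤ A ^ p.toReal := by
  rw [← eLpNorm_ennreal_rpow_toReal h0 ht, ENNReal.rpow_le_rpow_iff (ENNReal.toReal_pos h0 ht)]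

theorem eLpNorm_ennreal_top_le {f : X → ℝ≥0∞} {A : ℝ≥0∞} (h : ∀ x, f x ≤ A) :
    eLpNorm f ⊤ μ ≤ A :=
  essSup_le_of_ae_le _ (.of_forall h)

theorem eLpNorm_ennreal_mono {p : ℝ≥0∞} {f g : X → ℝ≥0∞} (h : ∀ x, f x ≤ g x) :
    eLpNorm f p μ ≤ eLpNorm g p μ := eLpNorm_mono_enorm h

theorem eLpNorm_ennreal_const_mul (p : ℝ≥0∞) {c : ℝ≥0∞} (hc : c ≠ ⊤) (f : X → ℝ≥0∞) :
    eLpNorm (fun x => c * f x) p μ = c * eLpNorm f p μ := by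
  rcases eq_or_ne p 0 with rfl | h0
  · simp only [eLpNorm_exponent_zero, mul_zero]
  rcases eq_or_ne p ⊤ with rfl | ht
  · rw [eLpNorm_ennreal_top, eLpNorm_ennreal_top, ENNReal.essSup_const_mul]
  have hp : 0 < p.toReal := ENNReal.toReal_pos h0 ht
  rw [← ENNReal.rpow_left_injective hp.ne' |>.eq_iff, ENNReal.mul_rpow_of_nonneg _ _ hp.le,
    eLpNorm_ennreal_rpow_toReal h0 ht, eLpNorm_ennreal_rpow_toReal h0 ht]
  simp only [ENNReal.mul_rpow_of_nonneg _ _ hp.le]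
  exact lintegral_const_mul' _ _ (ENNReal.rpow_ne_top_of_nonneg hp.le hc)

-- Jensen's inequality for the measure with density `k`.
theorem lintegral_mul_rpow_le {r : ℝ} (hr : 1 ≤ r) {f k : X → ℝ≥0∞} (hf : Measurable f)
    (hk : Measurable k) :
    (∫⁻ x, k x * f x ∂μ) ^ r ≤ (∫⁻ x, k x ∂μ) ^ (r - 1) * ∫⁻ x, k x * f x ^ r ∂μ := by
  have jensen := eLpNorm'_le_eLpNorm'_mul_rpow_measure_univ (μ := μ.withDensity k) one_pos hr
    hf.aestronglyMeasurable
  have hr₀ : 0 < r := zero_lt_one.trans_le hr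
  simp only [eLpNorm', enorm_eq_self, ENNReal.rpow_one, div_one] at jensen
  rw [lintegral_withDensity_eq_lintegral_mul _ hk hf,
    lintegral_withDensity_eq_lintegral_mul _ hk (hf.pow_const r),
    withDensity_apply _ MeasurableSet.univ, Measure.restrict_univ] at jensen
  refine (ENNReal.rpow_le_rpow jensen hr₀.le).trans_eq ?_
  rw [ENNReal.mul_rpow_of_nonneg _ _ hr₀.le, ← ENNReal.rpow_mul, ← ENNReal.rpow_mul,
    one_div_mul_cancel hr₀.ne', ENNReal.rpow_one, mul_comm]
  congr 2
  field_simp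

theorem eLpNorm_le_of_forall_le_of_eLpNorm_le {p₀ p A : ℝ≥0∞} (hp₀ : 1 ≤ p₀) (hpp : p₀ ≤ p)
    {f : X → ℝ≥0∞} (hf : ∀ x, f x ≤ A) (hf₀ : eLpNorm f p₀ μ ≤ A) : eLpNorm f p μ ≤ A := by
  rcases eq_or_ne p ⊤ with rfl | ht
  · exact eLpNorm_ennreal_top_le hf
  rcases eq_or_ne A ⊤ with rfl | hA
  · exact le_top
  have ht₀ : p₀ ≠ ⊤ := ne_top_of_le_ne_top ht hpp
  have hpp' : p₀.toReal ≤ p.toReal := ENNReal.toReal_mono ht hpp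
  have hp₀' : 0 ≤ p₀.toReal := ENNReal.toReal_nonneg
  rw [eLpNorm_ennreal_le_iff (zero_lt_one.trans_le hp₀).ne' ht₀] at hf₀
  rw [eLpNorm_ennreal_le_iff (zero_lt_one.trans_le (hp₀.trans hpp)).ne' ht]
  calc ∫⁻ x, f x ^ p.toReal ∂μ
      = ∫⁻ x, f x ^ (p.toReal - p₀.toReal) * f x ^ p₀.toReal ∂μ := by
        simp only [rpow_sub_mul_rpow _ hp₀' hpp']
    _ ≤ ∫⁻ x, A ^ (p.toReal - p₀.toReal) * f x ^ p₀.toReal ∂μ := by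
        gcongr with x
        exact hf x
    _ = A ^ (p.toReal - p₀.toReal) * ∫⁻ x, f x ^ p₀.toReal ∂μ :=
        lintegral_const_mul' _ _ (ENNReal.rpow_ne_top_of_nonneg (sub_nonneg.2 hpp') hA)
    _ ≤ A ^ (p.toReal - p₀.toReal) * A ^ p₀.toReal := by gcongr
    _ = A ^ p.toReal := rpow_sub_mul_rpow A hp₀' hpp'

theorem lintegral_mul_div_eLpNorm_rpow_le {p : ℝ≥0∞} (h0 : p ≠ 0) (ht : p ≠ ⊤) {f : X → ℝ≥0∞}
    (hf : Measurable f) :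
    ∫⁻ x, eLpNorm f p μ * (f x / eLpNorm f p μ) ^ p.toReal ∂μ ≤ eLpNorm f p μ := by
  simp only [ENNReal.div_eq_inv_mul, ENNReal.mul_rpow_of_nonneg _ _ ENNReal.toReal_nonneg,
    ENNReal.inv_rpow]
  rw [lintegral_const_mul _ ((hf.pow_const _).const_mul _), lintegral_const_mul _ (hf.pow_const _),
    ← eLpNorm_ennreal_rpow_toReal h0 ht]
  exact mul_le_of_le_one_right' (ENNReal.inv_mul_le_one _)

end Lp

section Minkowski

variable {X Y : Type*} [MeasurableSpace X] [MeasurableSpace Y] {μ : Measure X} {ν : Measure Y}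
  [SFinite ν]

theorem measurable_essSup_right {G : X → Y → ℝ≥0∞}
    (hG : Measurable (Function.uncurry G)) : Measurable fun x => essSup (G x) ν := by
  refine measurable_of_Iic fun c => ?_
  have hpre : (fun x => essSup (G x) ν) ⁻¹' Set.Iic c =
      (fun x => ν (Prod.mk x ⁻¹' {w : X × Y | c < Function.uncurry G w})) ⁻¹' {0} := by
    ext x
    have hnull : ν (Prod.mk x ⁻¹' {w : X × Y | c < Function.uncurry G w}) = 0 ↔
        ∀ᵐ y ∂ν, G x y ≤ c := by
      rw [ae_iff]
      simp only [not_le]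
      rfl
    rw [Set.mem_preimage, Set.mem_preimage, Set.mem_singleton_iff, hnull, Set.mem_Iic]
    exact ⟨fun h => (ENNReal.ae_le_essSup (G x)).mono fun y hy => hy.trans h,
      essSup_le_of_ae_le c⟩
  rw [hpre]
  exact measurable_measure_prodMk_left (measurableSet_lt measurable_const hG)
    (measurableSet_singleton 0)

theorem measurable_eLpNorm_right (p : ℝ≥0∞) {G : X → Y → ℝ≥0∞}
    (hG : Measurable (Function.uncurry G)) : Measurable fun x => eLpNorm (G x) p ν := by
  rcases eq_or_ne p 0 with rfl | h0
  · simp only [eLpNorm_exponent_zero, measurable_const]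
  rcases eq_or_ne p ⊤ with rfl | ht
  · exact measurable_essSup_right hG
  simp only [eLpNorm_eq_lintegral_rpow_enorm_toReal h0 ht, enorm_eq_self]
  exact (Measurable.lintegral_prod_right (hG.pow_const _)).pow_const _

variable [SFinite μ]

theorem ae_ae_le_eLpNorm_top {h : X → Y → ℝ≥0∞} (hh : Measurable (Function.uncurry h)) :
    ∀ᵐ y ∂ν, ∀ᵐ x ∂μ, h x y ≤ eLpNorm (h x) ⊤ ν := by
  rw [← Measure.ae_ae_comm (p := fun x y => h x y ≤ eLpNorm (h x) ⊤ ν)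
    (measurableSet_le hh ((measurable_eLpNorm_right ⊤ hh).comp measurable_fst))]
  exact .of_forall fun x => ENNReal.ae_le_essSup (h x)

theorem ae_ae_eq_zero_of_eLpNorm_eq_zero {p : ℝ≥0∞} (h0 : p ≠ 0) {h : X → Y → ℝ≥0∞}
    (hh : Measurable (Function.uncurry h)) :
    ∀ᵐ y ∂ν, ∀ᵐ x ∂μ, eLpNorm (h x) p ν = 0 → h x y = 0 := by
  have hN := measurable_eLpNorm_right (ν := ν) p hh
  have hset : MeasurableSet {w : X × Y | eLpNorm (h w.1) p ν = 0 → h w.1 w.2 = 0} :=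
    (hN.comp measurable_fst (measurableSet_singleton 0)).himp (hh (measurableSet_singleton 0))
  rw [← Measure.ae_ae_comm hset]
  refine .of_forall fun x => ?_
  by_cases hx : eLpNorm (h x) p ν = 0
  · have hm : Measurable (h x) := hh.comp measurable_prodMk_left
    exact ((eLpNorm_eq_zero_iff hm.aestronglyMeasurable h0).1 hx).mono fun y hy _ => hy
  · exact .of_forall fun y hy => absurd hy hx

theorem ae_lintegral_rpow_le {p : ℝ≥0∞} (hp : 1 ≤ p) (ht : p ≠ ⊤) {h : X → Y → ℝ≥0∞}
    (hh : Measurable (Function.uncurry h)) (hfin : ∫⁻ x, eLpNorm (h x) p ν ∂μ ≠ ⊤) :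
    ∀ᵐ y ∂ν, (∫⁻ x, h x y ∂μ) ^ p.toReal ≤ (∫⁻ x, eLpNorm (h x) p ν ∂μ) ^ (p.toReal - 1) *
      ∫⁻ x, eLpNorm (h x) p ν * (h x y / eLpNorm (h x) p ν) ^ p.toReal ∂μ := by
  have hN := measurable_eLpNorm_right (ν := ν) p hh
  filter_upwards [ae_ae_eq_zero_of_eLpNorm_eq_zero (μ := μ) (zero_lt_one.trans_le hp).ne' hh]
    with y hy
  have hfactor : ∫⁻ x, h x y ∂μ =
      ∫⁻ x, eLpNorm (h x) p ν * (h x y / eLpNorm (h x) p ν) ∂μ := by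
    refine lintegral_congr_ae ?_
    filter_upwards [hy, ae_lt_top hN hfin] with x hx hx'
    by_cases hx₀ : eLpNorm (h x) p ν = 0
    · rw [hx hx₀, hx₀, zero_mul]
    · exact (ENNReal.mul_div_cancel hx₀ hx'.ne).symm
  rw [hfactor]
  exact lintegral_mul_rpow_le (one_le_toReal hp ht)
    ((hh.comp measurable_prodMk_right).div hN) hN

-- Minkowski's integral inequality: with `N x = ‖h x ·‖_p`, Jensen's inequality is applied to the
-- average of `h x y / N x` with respect to the measure of density `N`.
theorem eLpNorm_lintegral_le {p : ℝ≥0∞} (hp : 1 ≤ p) {h : X → Y → ℝ≥0∞}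
    (hh : Measurable (Function.uncurry h)) :
    eLpNorm (fun y => ∫⁻ x, h x y ∂μ) p ν ≤ ∫⁻ x, eLpNorm (h x) p ν ∂μ := by
  rcases eq_or_ne p ⊤ with rfl | ht
  · exact essSup_le_of_ae_le _ ((ae_ae_le_eLpNorm_top hh).mono fun y hy => lintegral_mono_ae hy)
  rcases eq_or_ne (∫⁻ x, eLpNorm (h x) p ν ∂μ) ⊤ with hfin | hfin
  · exact hfin ▸ le_top
  have h0 : p ≠ 0 := (zero_lt_one.trans_le hp).ne'
  have hr := one_le_toReal hp ht
  have hswap : Measurable fun w : Y × X => h w.2 w.1 := hh.comp measurable_swap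
  have hN : Measurable fun w : Y × X => eLpNorm (h w.2) p ν :=
    (measurable_eLpNorm_right p hh).comp measurable_snd
  rw [eLpNorm_ennreal_le_iff h0 ht]
  calc ∫⁻ y, (∫⁻ x, h x y ∂μ) ^ p.toReal ∂ν
      ≤ ∫⁻ y, (∫⁻ x, eLpNorm (h x) p ν ∂μ) ^ (p.toReal - 1) *
          ∫⁻ x, eLpNorm (h x) p ν * (h x y / eLpNorm (h x) p ν) ^ p.toReal ∂μ ∂ν :=
        lintegral_mono_ae (ae_lintegral_rpow_le hp ht hh hfin)
    _ = (∫⁻ x, eLpNorm (h x) p ν ∂μ) ^ (p.toReal - 1) *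
          ∫⁻ x, ∫⁻ y, eLpNorm (h x) p ν * (h x y / eLpNorm (h x) p ν) ^ p.toReal ∂ν ∂μ := by
        rw [lintegral_const_mul' _ _ (ENNReal.rpow_ne_top_of_nonneg (sub_nonneg.2 hr) hfin),
          lintegral_lintegral_swap (hN.mul ((hswap.div hN).pow_const _)).aemeasurable]
    _ ≤ (∫⁻ x, eLpNorm (h x) p ν ∂μ) ^ (p.toReal - 1) * ∫⁻ x, eLpNorm (h x) p ν ∂μ := by
        gcongr with x
        exact lintegral_mul_div_eLpNorm_rpow_le h0 ht (hh.comp measurable_prodMk_left)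
    _ = (∫⁻ x, eLpNorm (h x) p ν ∂μ) ^ p.toReal := rpow_sub_one_mul_self _ hr

end Minkowski

section Convolution

variable {A : Type*} [MeasurableSpace A] {μ : Measure A} {k k₁ k₂ : A → ℝ≥0∞} {M M₁ M₂ : ℝ≥0}
  {p p₀ q q₀ : ℝ≥0∞}

/-- A nonnegative convolution kernel `k` that is bounded by one and whose integral is at most `M`.
The constant `M` is normalized by `1 ≤ M`, so that it bounds the norm of `k` in every `L^r`. -/
structure IsKernel (μ : Measure A) (k : A → ℝ≥0∞) (M : ℝ≥0) : Prop where
  measurable : Measurable k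
  le_one : ∀ x, k x ≤ 1
  one_le : 1 ≤ M
  lintegral_le : ∫⁻ x, k x ∂μ ≤ M

theorem IsKernel.ne_top (hk : IsKernel μ k M) (x : A) : k x ≠ ⊤ :=
  ne_top_of_le_ne_top ENNReal.one_ne_top (hk.le_one x)

variable [AddCommGroup A] [MeasurableAdd₂ A] [μ.IsAddLeftInvariant]

theorem IsKernel.lintegral_sub_right_le (hk : IsKernel μ k M) (y : A) :
    ∫⁻ y', k (y' - y) ∂μ ≤ M :=
  (lintegral_sub_right_eq_self k y).trans_le hk.lintegral_le

theorem IsKernel.lintegral_sub_left_le [MeasurableNeg A] [μ.IsNegInvariant]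
    (hk : IsKernel μ k M) (y : A) : ∫⁻ y', k (y - y') ∂μ ≤ M :=
  (lintegral_sub_left_eq_self k y).trans_le hk.lintegral_le

variable [MeasurableNeg A]

theorem IsKernel.lintegral_mul_rpow_le (hk : IsKernel μ k M) {r : ℝ} (hr : 1 ≤ r) {f : A → ℝ≥0∞}
    (hf : Measurable f) (y : A) :
    (∫⁻ y', f y' * k (y' - y) ∂μ) ^ r ≤
      (M : ℝ≥0∞) ^ (r - 1) * ∫⁻ y', k (y' - y) * f y' ^ r ∂μ := by
  simp only [mul_comm (f _)]
  refine (TimeFreq.lintegral_mul_rpow_le hr hf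
    (hk.measurable.comp (measurable_id.sub_const y))).trans ?_
  exact mul_le_mul_left (ENNReal.rpow_le_rpow (hk.lintegral_sub_right_le y) (sub_nonneg.2 hr)) _

theorem IsKernel.lintegral_mul_le (hk : IsKernel μ k M) (hp : 1 ≤ p) {f : A → ℝ≥0∞}
    (hf : Measurable f) (y : A) : ∫⁻ y', f y' * k (y' - y) ∂μ ≤ M * eLpNorm f p μ := by
  rcases eq_or_ne p ⊤ with rfl | ht
  · calc ∫⁻ y', f y' * k (y' - y) ∂μ ≤ ∫⁻ y', essSup f μ * k (y' - y) ∂μ := by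
          refine lintegral_mono_ae ?_
          filter_upwards [ENNReal.ae_le_essSup f] with y' hy'
          gcongr
      _ = essSup f μ * ∫⁻ y', k (y' - y) ∂μ :=
          lintegral_const_mul _ (hk.measurable.comp (measurable_id.sub_const y))
      _ ≤ essSup f μ * M := by gcongr; exact hk.lintegral_sub_right_le y
      _ = M * eLpNorm f ⊤ μ := mul_comm _ _
  have hr := one_le_toReal hp ht
  have hr₀ : 0 < p.toReal := zero_lt_one.trans_le hr
  rw [← ENNReal.rpow_le_rpow_iff hr₀, ENNReal.mul_rpow_of_nonneg _ _ hr₀.le,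
    eLpNorm_ennreal_rpow_toReal (zero_lt_one.trans_le hp).ne' ht]
  refine (hk.lintegral_mul_rpow_le hr hf y).trans ?_
  gcongr with y'
  · exact_mod_cast hk.one_le
  · linarith
  · exact mul_le_of_le_one_left' (hk.le_one _)

variable [SFinite μ]

theorem IsKernel.lintegral_lintegral_mul_le (hk₁ : IsKernel μ k₁ M₁) (hk₂ : IsKernel μ k₂ M₂)
    (hp : 1 ≤ p) (hq : 1 ≤ q) {G : A → A → ℝ≥0∞} (hG : Measurable (Function.uncurry G))
    (x y : A) :
    ∫⁻ x', ∫⁻ y', G x' y' * (k₁ (x' - x) * k₂ (y' - y)) ∂μ ∂μ ≤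
      M₁ * M₂ * eLpNorm (fun x => eLpNorm (G x) p μ) q μ := by
  calc _ ≤ ∫⁻ x', M₂ * (eLpNorm (G x') p μ * k₁ (x' - x)) ∂μ := by
        refine lintegral_mono fun x' => ?_
        simp only [mul_left_comm _ (k₁ _)]
        rw [lintegral_const_mul' _ _ (hk₁.ne_top _), ← mul_assoc, mul_comm]
        gcongr
        exact hk₂.lintegral_mul_le hp (hG.comp measurable_prodMk_left) y
    _ = M₂ * ∫⁻ x', eLpNorm (G x') p μ * k₁ (x' - x) ∂μ :=
        lintegral_const_mul' _ _ ENNReal.coe_ne_top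
    _ ≤ M₂ * (M₁ * eLpNorm (fun x => eLpNorm (G x) p μ) q μ) := by
        gcongr
        exact hk₁.lintegral_mul_le hq (measurable_eLpNorm_right p hG) x
    _ = _ := by ring

variable [μ.IsNegInvariant]

theorem IsKernel.eLpNorm_lintegral_mul_le_self (hk : IsKernel μ k M) (hp : 1 ≤ p) {f : A → ℝ≥0∞}
    (hf : Measurable f) :
    eLpNorm (fun y => ∫⁻ y', f y' * k (y' - y) ∂μ) p μ ≤ M * eLpNorm f p μ := by
  rcases eq_or_ne p ⊤ with rfl | ht
  · exact eLpNorm_ennreal_top_le (hk.lintegral_mul_le hp hf)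
  have h0 : p ≠ 0 := (zero_lt_one.trans_le hp).ne'
  have hr := one_le_toReal hp ht
  have hr₀ : 0 ≤ p.toReal - 1 := sub_nonneg.2 hr
  have hkm := hk.measurable
  rw [eLpNorm_ennreal_le_iff h0 ht, ENNReal.mul_rpow_of_nonneg _ _ ENNReal.toReal_nonneg,
    eLpNorm_ennreal_rpow_toReal h0 ht]
  calc ∫⁻ y, (∫⁻ y', f y' * k (y' - y) ∂μ) ^ p.toReal ∂μ
      ≤ ∫⁻ y, (M : ℝ≥0∞) ^ (p.toReal - 1) * ∫⁻ y', k (y' - y) * f y' ^ p.toReal ∂μ ∂μ :=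
        lintegral_mono fun y => hk.lintegral_mul_rpow_le hr hf y
    _ = (M : ℝ≥0∞) ^ (p.toReal - 1) * ∫⁻ y', ∫⁻ y, k (y' - y) * f y' ^ p.toReal ∂μ ∂μ := by
        rw [lintegral_const_mul' _ _ (ENNReal.rpow_ne_top_of_nonneg hr₀ ENNReal.coe_ne_top),
          lintegral_lintegral_swap (by fun_prop)]
    _ ≤ (M : ℝ≥0∞) ^ (p.toReal - 1) * ∫⁻ y', M * f y' ^ p.toReal ∂μ := by
        gcongr with y'
        rw [lintegral_mul_const _ (by fun_prop)]
        gcongr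
        exact hk.lintegral_sub_left_le y'
    _ = (M : ℝ≥0∞) ^ p.toReal * ∫⁻ y', f y' ^ p.toReal ∂μ := by
        rw [lintegral_const_mul' _ _ ENNReal.coe_ne_top, ← mul_assoc, rpow_sub_one_mul_self _ hr]

theorem IsKernel.eLpNorm_lintegral_mul_le (hk : IsKernel μ k M) (hp₀ : 1 ≤ p₀) (hpp : p₀ ≤ p)
    {f : A → ℝ≥0∞} (hf : Measurable f) :
    eLpNorm (fun y => ∫⁻ y', f y' * k (y' - y) ∂μ) p μ ≤ M * eLpNorm f p₀ μ :=
  eLpNorm_le_of_forall_le_of_eLpNorm_le hp₀ hpp (hk.lintegral_mul_le hp₀ hf)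
    (hk.eLpNorm_lintegral_mul_le_self hp₀ hf)

theorem IsKernel.eLpNorm_lintegral_lintegral_mul_le (hk₁ : IsKernel μ k₁ M₁)
    (hk₂ : IsKernel μ k₂ M₂) (hp₀ : 1 ≤ p₀) (hpp : p₀ ≤ p) {G : A → A → ℝ≥0∞}
    (hG : Measurable (Function.uncurry G)) (x : A) :
    eLpNorm (fun y => ∫⁻ x', ∫⁻ y', G x' y' * (k₁ (x' - x) * k₂ (y' - y)) ∂μ ∂μ) p μ ≤
      M₂ * ∫⁻ x', eLpNorm (G x') p₀ μ * k₁ (x' - x) ∂μ := by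
  have hk₁m := hk₁.measurable
  have hk₂m := hk₂.measurable
  have hconv : Measurable fun w : A × A => ∫⁻ y', G w.1 y' * k₂ (y' - w.2) ∂μ := by
    have : Measurable fun w : (A × A) × A => G w.1.1 w.2 :=
      hG.comp ((measurable_fst.comp measurable_fst).prodMk measurable_snd)
    exact Measurable.lintegral_prod_right' (f := fun w : (A × A) × A =>
      G w.1.1 w.2 * k₂ (w.2 - w.1.2)) (by fun_prop)
  calc _ = eLpNorm (fun y => ∫⁻ x', k₁ (x' - x) * ∫⁻ y', G x' y' * k₂ (y' - y) ∂μ ∂μ) p μ := by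
        simp only [← lintegral_const_mul' _ _ (hk₁.ne_top _), mul_left_comm (k₁ _)]
    _ ≤ ∫⁻ x', eLpNorm (fun y => k₁ (x' - x) * ∫⁻ y', G x' y' * k₂ (y' - y) ∂μ) p μ ∂μ :=
        eLpNorm_lintegral_le (hp₀.trans hpp)
          ((hk₁m.comp (measurable_fst.sub_const x)).mul hconv)
    _ ≤ ∫⁻ x', M₂ * (eLpNorm (G x') p₀ μ * k₁ (x' - x)) ∂μ := by
        refine lintegral_mono fun x' => ?_
        rw [eLpNorm_ennreal_const_mul p (hk₁.ne_top _), ← mul_assoc, mul_comm]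
        exact mul_le_mul_left
          (hk₂.eLpNorm_lintegral_mul_le hp₀ hpp (hG.comp measurable_prodMk_left)) _
    _ = _ := lintegral_const_mul' _ _ ENNReal.coe_ne_top

theorem IsKernel.eLpNorm_eLpNorm_le (hk₁ : IsKernel μ k₁ M₁) (hk₂ : IsKernel μ k₂ M₂)
    (hp₀ : 1 ≤ p₀) (hpp : p₀ ≤ p) (hq₀ : 1 ≤ q₀) (hqq : q₀ ≤ q) {G H : A → A → ℝ≥0∞}
    (hG : Measurable (Function.uncurry G))
    (hH : ∀ x y, H x y ≤ ∫⁻ x', ∫⁻ y', G x' y' * (k₁ (x' - x) * k₂ (y' - y)) ∂μ ∂μ) :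
    eLpNorm (fun x => eLpNorm (H x) p μ) q μ ≤
      M₁ * M₂ * eLpNorm (fun x => eLpNorm (G x) p₀ μ) q₀ μ := by
  calc eLpNorm (fun x => eLpNorm (H x) p μ) q μ
      ≤ eLpNorm (fun x => M₂ * ∫⁻ x', eLpNorm (G x') p₀ μ * k₁ (x' - x) ∂μ) q μ :=
        eLpNorm_ennreal_mono fun x => (eLpNorm_ennreal_mono (hH x)).trans
          (hk₁.eLpNorm_lintegral_lintegral_mul_le hk₂ hp₀ hpp hG x)
    _ ≤ M₂ * (M₁ * eLpNorm (fun x => eLpNorm (G x) p₀ μ) q₀ μ) := by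
        rw [eLpNorm_ennreal_const_mul q ENNReal.coe_ne_top]
        gcongr
        exact hk₁.eLpNorm_lintegral_mul_le hq₀ hqq (measurable_eLpNorm_right p₀ hG)
    _ = _ := by ring

end Convolution

section Correlation

/-- The power `u ^ p` with the convention `u ^ ∞ = 0`. For `u ≤ 1`, its integral being at most one
is the part of the bound of the `L^p` norm by one that is not contained in `u ≤ 1`. -/
noncomputable def truncPow (p u : ℝ≥0∞) : ℝ≥0∞ := if p = ⊤ then 0 else u ^ p.toReal

theorem truncPow_of_ne_top {p : ℝ≥0∞} (hp : p ≠ ⊤) (u : ℝ≥0∞) : truncPow p u = u ^ p.toReal :=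
  if_neg hp

theorem truncPow_le_one (p : ℝ≥0∞) {u : ℝ≥0∞} (hu : u ≤ 1) : truncPow p u ≤ 1 := by
  unfold truncPow
  split_ifs
  · exact zero_le_one
  · exact ENNReal.rpow_le_one hu ENNReal.toReal_nonneg

theorem measurable_truncPow (p : ℝ≥0∞) : Measurable (truncPow p) := by
  unfold truncPow
  split_ifs
  · exact measurable_const
  · exact measurable_id.pow_const _

theorem rpow_le_rpow_of_truncPow_le {p : ℝ≥0∞} (hp : 1 ≤ p) {γ : ℝ} (hγ : 0 ≤ γ) {u m : ℝ≥0∞}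
    (hu : u ≤ 1) (hm : truncPow p u ≤ m) : u ^ γ ≤ m ^ (γ * p⁻¹.toReal) := by
  rcases eq_or_ne p ⊤ with rfl | ht
  · simpa using ENNReal.rpow_le_one hu hγ
  have hp₀ : p.toReal ≠ 0 := (zero_lt_one.trans_le (one_le_toReal hp ht)).ne'
  rw [truncPow_of_ne_top ht] at hm
  calc u ^ γ = (u ^ p.toReal) ^ (γ * p⁻¹.toReal) := by
        rw [← ENNReal.rpow_mul, ENNReal.toReal_inv, mul_comm γ, mul_inv_cancel_left₀ hp₀]
    _ ≤ m ^ (γ * p⁻¹.toReal) := ENNReal.rpow_le_rpow hm (by positivity)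

theorem rpow_mul_rpow_le_truncPow_add {p₁ p₂ : ℝ≥0∞} (hp₁ : 1 ≤ p₁) (hp₂ : 1 ≤ p₂) {α β : ℝ}
    (hα : 0 ≤ α) (hβ : 0 ≤ β) (h : 1 ≤ α * p₁⁻¹.toReal + β * p₂⁻¹.toReal) {u v : ℝ≥0∞}
    (hu : u ≤ 1) (hv : v ≤ 1) : u ^ α * v ^ β ≤ truncPow p₁ u + truncPow p₂ v := by
  set m := max (truncPow p₁ u) (truncPow p₂ v)
  have hm : m ≤ 1 := max_le (truncPow_le_one p₁ hu) (truncPow_le_one p₂ hv)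
  calc u ^ α * v ^ β ≤ m ^ (α * p₁⁻¹.toReal) * m ^ (β * p₂⁻¹.toReal) :=
        mul_le_mul' (rpow_le_rpow_of_truncPow_le hp₁ hα hu (le_max_left _ _))
          (rpow_le_rpow_of_truncPow_le hp₂ hβ hv (le_max_right _ _))
    _ = m ^ (α * p₁⁻¹.toReal + β * p₂⁻¹.toReal) :=
        (ENNReal.rpow_add_of_nonneg _ _ (by positivity) (by positivity)).symm
    _ ≤ m ^ (1 : ℝ) := ENNReal.rpow_le_rpow_of_exponent_ge hm h
    _ = m := ENNReal.rpow_one m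
    _ ≤ _ := max_le le_self_add le_add_self

theorem toReal_inv_add_le {p₁ p₂ p q : ℝ≥0∞} (hp₁ : 1 ≤ p₁) (hp₂ : 1 ≤ p₂) (hp : 1 ≤ p)
    (hq : 1 ≤ q) (h : p⁻¹ + q⁻¹ ≤ p₁⁻¹ + p₂⁻¹) :
    p⁻¹.toReal + q⁻¹.toReal ≤ p₁⁻¹.toReal + p₂⁻¹.toReal := by
  have inv_ne_top {r : ℝ≥0∞} (hr : 1 ≤ r) : r⁻¹ ≠ ⊤ :=
    ENNReal.inv_ne_top.2 (zero_lt_one.trans_le hr).ne'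
  rw [← ENNReal.toReal_add (inv_ne_top hp) (inv_ne_top hq),
    ← ENNReal.toReal_add (inv_ne_top hp₁) (inv_ne_top hp₂)]
  exact ENNReal.toReal_mono (ENNReal.add_ne_top.2 ⟨inv_ne_top hp₁, inv_ne_top hp₂⟩) h

theorem one_le_interpolation_exponents {P Q P₁ P₂ : ℝ} (hP : 0 < P) (hPQ : P < Q) (hP₁ : 0 < P₁)
    (hP₂ : 0 < P₂) (h : P⁻¹ + Q⁻¹ ≤ P₁⁻¹ + P₂⁻¹) :
    1 ≤ (Q - P₁) * P / (Q - P) * P₁⁻¹ + (Q - P₂) * P / (Q - P) * P₂⁻¹ := by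
  have hQ : 0 < Q := hP.trans hPQ
  have hsum : (Q - P₁) * P / (Q - P) * P₁⁻¹ + (Q - P₂) * P / (Q - P) * P₂⁻¹ =
      (P * Q * (P₁⁻¹ + P₂⁻¹) - 2 * P) / (Q - P) := by
    field_simp
    ring
  have hPQ_mul : P * Q * (P⁻¹ + Q⁻¹) = Q + P := by field_simp
  have := mul_le_mul_of_nonneg_left h (mul_pos hP hQ).le
  rw [hsum, le_div_iff₀ (sub_pos.2 hPQ)]
  linarith

theorem rpow_factorization (u : ℝ≥0∞) {P Q R : ℝ} (hP : 0 ≤ P) (hQ : 0 < Q) (hR : 0 ≤ R)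
    (hRQ : R ≤ Q) : u ^ P = (u ^ R) ^ (P / Q) * u ^ (P * (1 - R / Q)) := by
  have : 0 ≤ 1 - R / Q := sub_nonneg.2 ((div_le_one hQ).2 hRQ)
  rw [← ENNReal.rpow_mul, ← ENNReal.rpow_add_of_nonneg _ _ (by positivity) (by positivity)]
  congr 1
  ring

variable {A : Type*} [MeasurableSpace A] {μ : Measure A}

/-- A measurable function that is bounded by one and whose `L^p` norm is at most one. -/
structure IsSubunit (μ : Measure A) (p : ℝ≥0∞) (U : A → ℝ≥0∞) : Prop where
  measurable : Measurable U
  le_one : ∀ a, U a ≤ 1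
  eLpNorm_le_one : eLpNorm U p μ ≤ 1

theorem IsSubunit.lintegral_truncPow_le {p : ℝ≥0∞} {U : A → ℝ≥0∞} (hU : IsSubunit μ p U)
    (hp : 1 ≤ p) : ∫⁻ a, truncPow p (U a) ∂μ ≤ 1 := by
  rcases eq_or_ne p ⊤ with rfl | ht
  · simp [truncPow]
  have := (eLpNorm_ennreal_le_iff (zero_lt_one.trans_le hp).ne' ht).1 hU.eLpNorm_le_one
  simpa only [truncPow_of_ne_top ht, ENNReal.one_rpow] using this

theorem isSubunit_inv_mul {p c : ℝ≥0∞} {U : A → ℝ≥0∞} (hU : Measurable U) (h0 : c ≠ 0) (ht : c ≠ ⊤)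
    (hc : ∀ a, U a ≤ c) (hnorm : eLpNorm U p μ ≤ c) : IsSubunit μ p fun a => c⁻¹ * U a where
  measurable := hU.const_mul _
  le_one a := (mul_le_mul_right (hc a) _).trans_eq (ENNReal.inv_mul_cancel h0 ht)
  eLpNorm_le_one := by
    rw [eLpNorm_ennreal_const_mul p (ENNReal.inv_ne_top.2 h0)]
    exact (mul_le_mul_right hnorm _).trans_eq (ENNReal.inv_mul_cancel h0 ht)

variable [AddCommGroup A] [MeasurableAdd₂ A] [μ.IsAddLeftInvariant]

variable {p₁ p₂ p q : ℝ≥0∞} {U₁ U₂ : A → ℝ≥0∞}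

theorem IsSubunit.lintegral_rpow_mul_rpow_le_two (hU₁ : IsSubunit μ p₁ U₁)
    (hU₂ : IsSubunit μ p₂ U₂) (hp₁ : 1 ≤ p₁) (hp₂ : 1 ≤ p₂) {α β : ℝ} (hα : 0 ≤ α) (hβ : 0 ≤ β)
    (h : 1 ≤ α * p₁⁻¹.toReal + β * p₂⁻¹.toReal) (z : A) :
    ∫⁻ a, U₁ a ^ α * U₂ (a + z) ^ β ∂μ ≤ 2 := by
  calc _ ≤ ∫⁻ a, (truncPow p₁ (U₁ a) + truncPow p₂ (U₂ (a + z))) ∂μ :=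
        lintegral_mono fun a =>
          rpow_mul_rpow_le_truncPow_add hp₁ hp₂ hα hβ h (hU₁.le_one a) (hU₂.le_one _)
    _ = (∫⁻ a, truncPow p₁ (U₁ a) ∂μ) + ∫⁻ a, truncPow p₂ (U₂ a) ∂μ := by
        have hm : Measurable fun a => truncPow p₁ (U₁ a) :=
          (measurable_truncPow p₁).comp hU₁.measurable
        rw [lintegral_add_left hm, lintegral_add_right_eq_self (fun a => truncPow p₂ (U₂ a)) z]
    _ ≤ 1 + 1 := add_le_add (hU₁.lintegral_truncPow_le hp₁) (hU₂.lintegral_truncPow_le hp₂)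
    _ = 2 := one_add_one_eq_two

theorem IsSubunit.eLpNorm_mul_le_two (hU₁ : IsSubunit μ p₁ U₁) (hU₂ : IsSubunit μ p₂ U₂)
    (hp₁ : 1 ≤ p₁) (hp₂ : 1 ≤ p₂) (hp : 1 ≤ p) (h : p⁻¹ ≤ p₁⁻¹ + p₂⁻¹) (z : A) :
    eLpNorm (fun a => U₁ a * U₂ (a + z)) p μ ≤ 2 := by
  rcases eq_or_ne p ⊤ with rfl | ht
  · exact eLpNorm_ennreal_top_le fun a =>
      (mul_le_one' (hU₁.le_one a) (hU₂.le_one _)).trans one_le_two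
  have hr := one_le_toReal hp ht
  have hr₀ : 0 < p.toReal := zero_lt_one.trans_le hr
  have hexp : 1 ≤ p.toReal * p₁⁻¹.toReal + p.toReal * p₂⁻¹.toReal := by
    have := toReal_inv_add_le hp₁ hp₂ hp le_top (by simpa using h)
    calc (1 : ℝ) = p.toReal * (p⁻¹.toReal + (⊤⁻¹ : ℝ≥0∞).toReal) := by
          simp [ENNReal.toReal_inv, hr₀.ne']
      _ ≤ p.toReal * (p₁⁻¹.toReal + p₂⁻¹.toReal) := mul_le_mul_of_nonneg_left this hr₀.le
      _ = _ := mul_add _ _ _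
  rw [eLpNorm_ennreal_le_iff (zero_lt_one.trans_le hp).ne' ht]
  simp only [ENNReal.mul_rpow_of_nonneg _ _ hr₀.le]
  calc _ ≤ 2 := hU₁.lintegral_rpow_mul_rpow_le_two hU₂ hp₁ hp₂ hr₀.le hr₀.le hexp z
    _ ≤ 2 ^ p.toReal := by
      simpa using ENNReal.rpow_le_rpow_of_exponent_le one_le_two hr

theorem IsSubunit.lintegral_rpow_rpow_le_two (hU₁ : IsSubunit μ p₁ U₁) (hU₂ : IsSubunit μ p₂ U₂)
    (hp₁ : 1 ≤ p₁) (hp₂ : 1 ≤ p₂) {P Q : ℝ} (hP : 0 < P) (hPQ : P < Q) (ht₁ : p₁ ≠ ⊤) (ht₂ : p₂ ≠ ⊤)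
    (h₁ : p₁.toReal ≤ Q) (h₂ : p₂.toReal ≤ Q) (h : P⁻¹ + Q⁻¹ ≤ p₁⁻¹.toReal + p₂⁻¹.toReal) (z : A) :
    ∫⁻ a, (U₁ a ^ (P * (1 - p₁.toReal / Q)) * U₂ (a + z) ^ (P * (1 - p₂.toReal / Q))) ^
      (Q / (Q - P)) ∂μ ≤ 2 := by
  have hQ : 0 < Q := hP.trans hPQ
  have hQP : 0 < Q - P := sub_pos.2 hPQ
  have hP₁ : 0 < p₁.toReal := zero_lt_one.trans_le (one_le_toReal hp₁ ht₁)
  have hP₂ : 0 < p₂.toReal := zero_lt_one.trans_le (one_le_toReal hp₂ ht₂)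
  have hexp := one_le_interpolation_exponents hP hPQ hP₁ hP₂
    (by simpa only [ENNReal.toReal_inv] using h)
  simp only [← ENNReal.toReal_inv] at hexp
  have hpow (R : ℝ) : P * (1 - R / Q) * (Q / (Q - P)) = (Q - R) * P / (Q - P) := by field_simp
  have hr : 0 ≤ Q / (Q - P) := by positivity
  simp only [ENNReal.mul_rpow_of_nonneg _ _ hr, ← ENNReal.rpow_mul, hpow]
  have := sub_nonneg.2 h₁
  have := sub_nonneg.2 h₂
  exact hU₁.lintegral_rpow_mul_rpow_le_two hU₂ hp₁ hp₂ (by positivity) (by positivity) hexp z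

-- Hölder's inequality applied to the factorization of `rpow_factorization`, with exponents `Q / P`
-- and `Q / (Q - P)`.
theorem IsSubunit.lintegral_mul_rpow_rpow_le (hU₁ : IsSubunit μ p₁ U₁) (hU₂ : IsSubunit μ p₂ U₂)
    (hp₁ : 1 ≤ p₁) (hp₂ : 1 ≤ p₂) {P Q : ℝ} (hP : 0 < P) (hPQ : P < Q) (ht₁ : p₁ ≠ ⊤) (ht₂ : p₂ ≠ ⊤)
    (h₁ : p₁.toReal ≤ Q) (h₂ : p₂.toReal ≤ Q) (h : P⁻¹ + Q⁻¹ ≤ p₁⁻¹.toReal + p₂⁻¹.toReal) (z : A) :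
    (∫⁻ a, (U₁ a * U₂ (a + z)) ^ P ∂μ) ^ (Q / P) ≤
      2 ^ (Q / P - 1) * ∫⁻ a, U₁ a ^ p₁.toReal * U₂ (a + z) ^ p₂.toReal ∂μ := by
  have hQ : 0 < Q := hP.trans hPQ
  have hQP : 0 < Q - P := sub_pos.2 hPQ
  have hP₁ : 0 < p₁.toReal := zero_lt_one.trans_le (one_le_toReal hp₁ ht₁)
  have hP₂ : 0 < p₂.toReal := zero_lt_one.trans_le (one_le_toReal hp₂ ht₂)
  have hm₁ := hU₁.measurable
  have hm₂ := hU₂.measurable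
  have hconj : (Q / P).HolderConjugate (Q / (Q - P)) := by
    rw [Real.holderConjugate_iff]
    refine ⟨(one_lt_div hP).2 hPQ, ?_⟩
    field_simp
    ring
  set F : A → ℝ≥0∞ := fun a => U₁ a ^ p₁.toReal * U₂ (a + z) ^ p₂.toReal
  set G : A → ℝ≥0∞ := fun a =>
    U₁ a ^ (P * (1 - p₁.toReal / Q)) * U₂ (a + z) ^ (P * (1 - p₂.toReal / Q))
  have hfactor (a : A) : (U₁ a * U₂ (a + z)) ^ P = F a ^ (P / Q) * G a := by
    rw [ENNReal.mul_rpow_of_nonneg _ _ hP.le, rpow_factorization _ hP.le hQ hP₁.le h₁,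
      rpow_factorization _ hP.le hQ hP₂.le h₂, mul_mul_mul_comm,
      ← ENNReal.mul_rpow_of_nonneg _ _ (by positivity)]
  have hG : ∫⁻ a, G a ^ (Q / (Q - P)) ∂μ ≤ 2 :=
    hU₁.lintegral_rpow_rpow_le_two hU₂ hp₁ hp₂ hP hPQ ht₁ ht₂ h₁ h₂ h z
  have hF (a : A) : (F a ^ (P / Q)) ^ (Q / P) = F a := by
    rw [← ENNReal.rpow_mul, div_mul_div_cancel₀ hQ.ne', div_self hP.ne', ENNReal.rpow_one]
  calc (∫⁻ a, (U₁ a * U₂ (a + z)) ^ P ∂μ) ^ (Q / P)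
      = (∫⁻ a, F a ^ (P / Q) * G a ∂μ) ^ (Q / P) := by simp only [hfactor]
    _ ≤ ((∫⁻ a, F a ∂μ) ^ (1 / (Q / P)) * 2 ^ (1 / (Q / (Q - P)))) ^ (Q / P) := by
        refine ENNReal.rpow_le_rpow ?_ hconj.nonneg
        refine (ENNReal.lintegral_mul_le_Lp_mul_Lq μ hconj (by fun_prop) (by fun_prop)).trans ?_
        simp only [hF]
        gcongr
    _ = 2 ^ (Q / P - 1) * ∫⁻ a, F a ∂μ := by
        rw [ENNReal.mul_rpow_of_nonneg _ _ hconj.nonneg, ← ENNReal.rpow_mul, ← ENNReal.rpow_mul,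
          one_div_mul_cancel hconj.ne_zero, ENNReal.rpow_one, mul_comm]
        congr 2
        field_simp

theorem IsSubunit.eLpNorm_mul_rpow_le (hU₁ : IsSubunit μ p₁ U₁) (hU₂ : IsSubunit μ p₂ U₂)
    (hp₁ : 1 ≤ p₁) (hp₂ : 1 ≤ p₂) (hp : 1 ≤ p) (hq : q ≠ ⊤) (hpq : p ≤ q) (h₁ : p₁ ≤ q)
    (h₂ : p₂ ≤ q) (h : p⁻¹ + q⁻¹ ≤ p₁⁻¹ + p₂⁻¹) (z : A) :
    eLpNorm (fun a => U₁ a * U₂ (a + z)) p μ ^ q.toReal ≤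
      2 ^ (q.toReal / p.toReal - 1) *
        ∫⁻ a, U₁ a ^ p₁.toReal * U₂ (a + z) ^ p₂.toReal ∂μ := by
  have htp : p ≠ ⊤ := ne_top_of_le_ne_top hq hpq
  have hP : 0 < p.toReal := zero_lt_one.trans_le (one_le_toReal hp htp)
  have hR₁ : p₁.toReal ≤ q.toReal := ENNReal.toReal_mono hq h₁
  have hR₂ : p₂.toReal ≤ q.toReal := ENNReal.toReal_mono hq h₂
  have hnorm : eLpNorm (fun a => U₁ a * U₂ (a + z)) p μ ^ q.toReal =
      (∫⁻ a, (U₁ a * U₂ (a + z)) ^ p.toReal ∂μ) ^ (q.toReal / p.toReal) := by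
    rw [← eLpNorm_ennreal_rpow_toReal (zero_lt_one.trans_le hp).ne' htp, ← ENNReal.rpow_mul,
      mul_div_cancel₀ _ hP.ne']
  rw [hnorm]
  rcases (ENNReal.toReal_mono hq hpq).eq_or_lt with heq | hlt
  · rw [← heq, div_self hP.ne', sub_self, ENNReal.rpow_zero, one_mul, ENNReal.rpow_one]
    refine lintegral_mono fun a => ?_
    simp only [ENNReal.mul_rpow_of_nonneg _ _ hP.le]
    exact mul_le_mul' (ENNReal.rpow_le_rpow_of_exponent_ge (hU₁.le_one a) (hR₁.trans_eq heq.symm))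
      (ENNReal.rpow_le_rpow_of_exponent_ge (hU₂.le_one _) (hR₂.trans_eq heq.symm))
  · refine hU₁.lintegral_mul_rpow_rpow_le hU₂ hp₁ hp₂ hP hlt (ne_top_of_le_ne_top hq h₁)
      (ne_top_of_le_ne_top hq h₂) hR₁ hR₂ ?_ z
    simpa only [ENNReal.toReal_inv] using toReal_inv_add_le hp₁ hp₂ hp (hp.trans hpq) h

variable [SFinite μ]

theorem lintegral_lintegral_correlation {U₁ U₂ : A → ℝ≥0∞} (hm₁ : Measurable U₁)
    (hm₂ : Measurable U₂) :
    ∫⁻ z, ∫⁻ a, U₁ a * U₂ (a + z) ∂μ ∂μ = (∫⁻ a, U₁ a ∂μ) * ∫⁻ a, U₂ a ∂μ := by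
  rw [lintegral_lintegral_swap (by fun_prop)]
  have (a : A) : ∫⁻ z, U₁ a * U₂ (a + z) ∂μ = U₁ a * ∫⁻ b, U₂ b ∂μ := by
    rw [lintegral_const_mul _ (by fun_prop), lintegral_add_left_eq_self U₂ a]
  simp only [this]
  exact lintegral_mul_const _ hm₁

theorem IsSubunit.eLpNorm_correlation_le_two (hU₁ : IsSubunit μ p₁ U₁) (hU₂ : IsSubunit μ p₂ U₂)
    (hp₁ : 1 ≤ p₁) (hp₂ : 1 ≤ p₂) (hp : 1 ≤ p) (hpq : p ≤ q) (h₁ : p₁ ≤ q) (h₂ : p₂ ≤ q)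
    (h : p⁻¹ + q⁻¹ ≤ p₁⁻¹ + p₂⁻¹) :
    eLpNorm (fun z => eLpNorm (fun a => U₁ a * U₂ (a + z)) p μ) q μ ≤ 2 := by
  rcases eq_or_ne q ⊤ with rfl | hq
  · exact eLpNorm_ennreal_top_le
      (hU₁.eLpNorm_mul_le_two hU₂ hp₁ hp₂ hp (by simpa using h))
  have hP := one_le_toReal hp (ne_top_of_le_ne_top hq hpq)
  have hQ : 0 < q.toReal := zero_lt_one.trans_le (one_le_toReal (hp.trans hpq) hq)
  have hQP : 0 ≤ q.toReal / p.toReal - 1 :=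
    sub_nonneg.2 ((one_le_div (zero_lt_one.trans_le hP)).2 (ENNReal.toReal_mono hq hpq))
  have hI₁ := hU₁.lintegral_truncPow_le hp₁
  have hI₂ := hU₂.lintegral_truncPow_le hp₂
  simp only [truncPow_of_ne_top (ne_top_of_le_ne_top hq h₁)] at hI₁
  simp only [truncPow_of_ne_top (ne_top_of_le_ne_top hq h₂)] at hI₂
  rw [eLpNorm_ennreal_le_iff (zero_lt_one.trans_le (hp.trans hpq)).ne' hq]
  calc ∫⁻ z, eLpNorm (fun a => U₁ a * U₂ (a + z)) p μ ^ q.toReal ∂μ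
      ≤ ∫⁻ z, 2 ^ (q.toReal / p.toReal - 1) *
          ∫⁻ a, U₁ a ^ p₁.toReal * U₂ (a + z) ^ p₂.toReal ∂μ ∂μ :=
        lintegral_mono (hU₁.eLpNorm_mul_rpow_le hU₂ hp₁ hp₂ hp hq hpq h₁ h₂ h)
    _ = 2 ^ (q.toReal / p.toReal - 1) *
          ((∫⁻ a, U₁ a ^ p₁.toReal ∂μ) * ∫⁻ a, U₂ a ^ p₂.toReal ∂μ) := by
        rw [lintegral_const_mul' _ _ (ENNReal.rpow_ne_top_of_nonneg hQP ENNReal.ofNat_ne_top),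
          lintegral_lintegral_correlation (hU₁.measurable.pow_const _)
            (hU₂.measurable.pow_const _)]
    _ ≤ 2 ^ (q.toReal / p.toReal - 1) := mul_le_of_le_one_right' (mul_le_one' hI₁ hI₂)
    _ ≤ 2 ^ q.toReal := by
        refine ENNReal.rpow_le_rpow_of_exponent_le one_le_two ?_
        linarith [div_le_self hQ.le hP]

theorem eLpNorm_correlation_le (hp₁ : 1 ≤ p₁) (hp₂ : 1 ≤ p₂) (hp : 1 ≤ p) (hpq : p ≤ q)
    (h₁ : p₁ ≤ q) (h₂ : p₂ ≤ q) (h : p⁻¹ + q⁻¹ ≤ p₁⁻¹ + p₂⁻¹) (hm₁ : Measurable U₁)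
    (hm₂ : Measurable U₂) {c₁ c₂ : ℝ≥0∞} (ht₁ : c₁ ≠ ⊤) (ht₂ : c₂ ≠ ⊤) (hc₁ : ∀ a, U₁ a ≤ c₁)
    (hc₂ : ∀ a, U₂ a ≤ c₂) (hn₁ : eLpNorm U₁ p₁ μ ≤ c₁) (hn₂ : eLpNorm U₂ p₂ μ ≤ c₂) :
    eLpNorm (fun z => eLpNorm (fun a => U₁ a * U₂ (a + z)) p μ) q μ ≤ 2 * (c₁ * c₂) := by
  rcases eq_or_ne (c₁ * c₂) 0 with h0 | h0
  · have hzero (z a : A) : U₁ a * U₂ (a + z) = 0 :=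
      le_zero_iff.1 ((mul_le_mul' (hc₁ a) (hc₂ _)).trans_eq h0)
    calc _ ≤ eLpNorm (fun _ : A => (0 : ℝ≥0∞)) q μ :=
          eLpNorm_ennreal_mono fun z => by simp [hzero z]
      _ ≤ _ := by simp
  have h0₁ : c₁ ≠ 0 := left_ne_zero_of_mul h0
  have h0₂ : c₂ ≠ 0 := right_ne_zero_of_mul h0
  have hc : c₁ * c₂ ≠ ⊤ := ENNReal.mul_ne_top ht₁ ht₂
  have hscale (z a : A) :
      U₁ a * U₂ (a + z) = (c₁ * c₂) * ((c₁⁻¹ * U₁ a) * (c₂⁻¹ * U₂ (a + z))) := by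
    rw [mul_mul_mul_comm, ENNReal.mul_inv_cancel_left h0₁ ht₁, ENNReal.mul_inv_cancel_left h0₂ ht₂]
  simp only [hscale, eLpNorm_ennreal_const_mul _ hc]
  rw [mul_comm 2]
  exact mul_le_mul_right ((isSubunit_inv_mul hm₁ h0₁ ht₁ hc₁ hn₁).eLpNorm_correlation_le_two
    (isSubunit_inv_mul hm₂ h0₂ ht₂ hc₂ hn₂) hp₁ hp₂ hp hpq h₁ h₂ h) _

end Correlation

/-! ### Moderate weights and embeddings -/

section Weights

variable {V : Type*} [NormedAddCommGroup V]

/-- A moderate weight on phase space: a continuous nonnegative function which grows at most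
polynomially under translations. -/
structure IsModerate (m : V → V → ℝ) : Prop where
  continuous : Continuous (Function.uncurry m)
  nonneg : ∀ x ξ, 0 ≤ m x ξ
  exists_le : ∃ (k : ℕ) (C : ℝ≥0), ∀ x ξ x' ξ',
    m x ξ ≤ C * (m x' ξ' * ((1 + ‖x' - x‖) ^ k * (1 + ‖ξ' - ξ‖) ^ k))

theorem isModerate_one : IsModerate (fun _ _ : V => (1 : ℝ)) :=
  ⟨continuous_const, fun _ _ => zero_le_one, 0, 1, by simp⟩

theorem weight_pos (s : ℝ) (z : V) : 0 < weight s z := by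
  unfold weight
  positivity

theorem continuous_weight (s : ℝ) : Continuous (weight s : V → ℝ) := by
  unfold weight
  exact Continuous.rpow_const (by fun_prop) fun x => .inl (by positivity)

theorem weight_neg_left (s : ℝ) (z : V) : weight (-s) z = (weight s z)⁻¹ := by
  rw [weight, weight, neg_div, Real.rpow_neg (by positivity)]

theorem weight_neg_right (s : ℝ) (z : V) : weight s (-z) = weight s z := by
  rw [weight, weight, norm_neg]

theorem one_add_norm_add_sq_le (x y : V) :
    1 + ‖x + y‖ ^ 2 ≤ 2 * ((1 + ‖x‖ ^ 2) * (1 + ‖y‖ ^ 2)) := by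
  have htriangle : ‖x + y‖ ^ 2 ≤ (‖x‖ + ‖y‖) ^ 2 := by gcongr; exact norm_add_le x y
  nlinarith [sq_nonneg (‖x‖ - ‖y‖), mul_nonneg (sq_nonneg ‖x‖) (sq_nonneg ‖y‖)]

theorem weight_add_le_of_nonneg {s : ℝ} (hs : 0 ≤ s) (x y : V) :
    weight s (x + y) ≤ 2 ^ (s / 2) * (weight s x * weight s y) := by
  unfold weight
  rw [← Real.mul_rpow (by positivity) (by positivity),
    ← Real.mul_rpow (by positivity) (by positivity)]
  exact Real.rpow_le_rpow (by positivity) (one_add_norm_add_sq_le x y) (by positivity)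

theorem weight_add_le (s : ℝ) (x y : V) :
    weight s (x + y) ≤ 2 ^ (|s| / 2) * (weight s x * weight |s| y) := by
  rcases le_total 0 s with hs | hs
  · rw [abs_of_nonneg hs]
    exact weight_add_le_of_nonneg hs x y
  · have h := weight_add_le_of_nonneg (neg_nonneg.2 hs) (x + y) (-y)
    rw [add_neg_cancel_right, weight_neg_right, weight_neg_left s (x + y), weight_neg_left s x,
      mul_left_comm, inv_mul_eq_div, inv_le_iff_one_le_mul₀ (weight_pos s x),
      div_mul_eq_mul_div, one_le_div (weight_pos s _)] at h
    rw [abs_of_nonpos hs]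
    linarith

theorem weight_abs_le (s : ℝ) (x : V) : weight |s| x ≤ (1 + ‖x‖) ^ ⌈|s|⌉₊ := by
  have hone : (1 : ℝ) ≤ 1 + ‖x‖ := by linarith [norm_nonneg x]
  calc weight |s| x ≤ ((1 + ‖x‖) ^ (2 : ℝ)) ^ (|s| / 2) := by
        refine Real.rpow_le_rpow (by positivity) ?_ (by positivity)
        rw [Real.rpow_two]
        nlinarith [norm_nonneg x]
    _ = (1 + ‖x‖) ^ |s| := by rw [← Real.rpow_mul (by positivity), mul_div_cancel₀ _ two_ne_zero]
    _ ≤ (1 + ‖x‖) ^ (⌈|s|⌉₊ : ℝ) := Real.rpow_le_rpow_of_exponent_le hone (Nat.le_ceil _)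
    _ = _ := Real.rpow_natCast _ _

theorem weight_le_mul_weight (s : ℝ) (x x' : V) :
    weight s x ≤ 2 ^ (|s| / 2) * (weight s x' * (1 + ‖x' - x‖) ^ ⌈|s|⌉₊) := by
  have hpos := (weight_pos s x').le
  calc weight s x = weight s (x' + (x - x')) := by rw [add_sub_cancel]
    _ ≤ 2 ^ (|s| / 2) * (weight s x' * weight |s| (x - x')) := weight_add_le s _ _
    _ ≤ _ := by
        rw [norm_sub_rev]
        gcongr
        exact weight_abs_le s _

theorem isModerate_weight_fst (s : ℝ) : IsModerate (fun x _ : V => weight s x) := by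
  refine ⟨(continuous_weight s).comp continuous_fst, fun x _ => (weight_pos s x).le, ⌈|s|⌉₊,
    2 ^ (|s| / 2), fun x ξ x' ξ' => (weight_le_mul_weight s x x').trans ?_⟩
  have hpos := (weight_pos s x').le
  rw [NNReal.coe_rpow, NNReal.coe_ofNat]
  gcongr
  exact le_mul_of_one_le_right (by positivity) (one_le_pow₀ (by linarith [norm_nonneg (ξ' - ξ)]))

theorem one_add_norm_toLp_le (x y : V) :
    1 + ‖WithLp.toLp 2 (x, y)‖ ≤ (1 + ‖x‖) * (1 + ‖y‖) := by
  nlinarith [norm_toLp_le_add x y, mul_nonneg (norm_nonneg x) (norm_nonneg y)]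

theorem isModerate_weight (s : ℝ) :
    IsModerate (fun x ξ : V => weight s (WithLp.toLp 2 (x, ξ))) := by
  refine ⟨(continuous_weight s).comp (WithLp.prod_continuous_toLp 2 V V),
    fun x ξ => (weight_pos s _).le, ⌈|s|⌉₊, 2 ^ (|s| / 2), fun x ξ x' ξ' =>
      (weight_le_mul_weight s _ (WithLp.toLp 2 (x', ξ'))).trans ?_⟩
  have hpos := (weight_pos s (WithLp.toLp 2 (x', ξ'))).le
  rw [NNReal.coe_rpow, NNReal.coe_ofNat, ← mul_pow]
  gcongr
  exact one_add_norm_toLp_le (x' - x) (ξ' - ξ)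

end Weights

section Embeddings

variable {V : Type*} [NormedAddCommGroup V] [InnerProductSpace ℝ V] [MeasurableSpace V]
  [BorelSpace V] [FiniteDimensional ℝ V] {g : 𝓢(V, ℂ)} {p p₀ q q₀ : ℝ≥0∞}

theorem exists_isKernel_decayKernel (V : Type*) [NormedAddCommGroup V] [InnerProductSpace ℝ V]
    [MeasurableSpace V] [BorelSpace V] [FiniteDimensional ℝ V] :
    ∃ (N : ℕ) (M : ℝ≥0), IsKernel volume (decayKernel N : V → ℝ≥0∞) M := by
  set N := Module.finrank ℝ V + 1
  have hfinite : ∫⁻ x : V, decayKernel N x < ⊤ :=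
    finite_integral_one_add_norm (by push_cast [N]; linarith)
  refine ⟨N, (∫⁻ x : V, decayKernel N x).toNNReal + 1,
    measurable_decayKernel _, fun x => ?_, by simp, ?_⟩
  · exact ENNReal.ofReal_le_one.2 (Real.rpow_le_one_of_one_le_of_nonpos
      (by linarith [norm_nonneg x]) (neg_nonpos.2 (Nat.cast_nonneg _)))
  · rw [ENNReal.coe_add, ENNReal.coe_toNNReal hfinite.ne]
    exact le_self_add

theorem decayKernel_add_mul_ofReal {E : Type*} [NormedAddCommGroup E] (N k : ℕ) (x : E) :
    decayKernel (N + k) x * ENNReal.ofReal ((1 + ‖x‖) ^ k) = decayKernel N x := by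
  have hpos : 0 < 1 + ‖x‖ := by positivity
  rw [decayKernel, decayKernel, ← ENNReal.ofReal_mul (by positivity), Real.rpow_neg hpos.le,
    Real.rpow_neg hpos.le, Real.rpow_natCast, Real.rpow_natCast, pow_add]
  congr 1
  field_simp

theorem exists_enorm_stft_mul_le (hg : g ≠ 0) (h : 𝓢(V, ℂ)) (N : ℕ) {m : V → V → ℝ}
    (hm : IsModerate m) : ∃ C : ℝ≥0, ∀ (f : 𝓢'(V, ℂ)) (x ξ : V),
      ‖stft h f x ξ‖ₑ * ENNReal.ofReal (m x ξ) ≤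
        ∫⁻ x', ∫⁻ ξ', (C * (‖stft g f x' ξ'‖ₑ * ENNReal.ofReal (m x' ξ'))) *
          (decayKernel N (x' - x) * decayKernel N (ξ' - ξ)) := by
  obtain ⟨k, D, hD⟩ := hm.exists_le
  obtain ⟨C, hC⟩ := exists_enorm_stft_le hg h (N + k)
  have hmoderate : ∀ x ξ x' ξ', ENNReal.ofReal (m x ξ) ≤ D * (ENNReal.ofReal (m x' ξ') *
      (ENNReal.ofReal ((1 + ‖x' - x‖) ^ k) * ENNReal.ofReal ((1 + ‖ξ' - ξ‖) ^ k))) := by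
    intro x ξ x' ξ'
    rw [← ENNReal.ofReal_mul (by positivity), ← ENNReal.ofReal_mul (hm.nonneg _ _),
      ← ENNReal.ofReal_coe_nnreal, ← ENNReal.ofReal_mul D.coe_nonneg]
    exact ENNReal.ofReal_le_ofReal (hD x ξ x' ξ')
  refine ⟨C * D, fun f x ξ => ?_⟩
  calc _ ≤ (C * ∫⁻ x', ∫⁻ ξ', ‖stft g f x' ξ'‖ₑ *
        (decayKernel (N + k) (x' - x) * decayKernel (N + k) (ξ' - ξ))) *
          ENNReal.ofReal (m x ξ) := by
        gcongr
        exact hC f x ξ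
    _ = ∫⁻ x', ∫⁻ ξ', C * (‖stft g f x' ξ'‖ₑ *
        (decayKernel (N + k) (x' - x) * decayKernel (N + k) (ξ' - ξ))) *
          ENNReal.ofReal (m x ξ) := by
        simp only [lintegral_mul_const' _ _ ENNReal.ofReal_ne_top,
          lintegral_const_mul' _ _ ENNReal.coe_ne_top]
    _ ≤ _ := by
        refine lintegral_mono fun x' => lintegral_mono fun ξ' =>
          (mul_le_mul_right (hmoderate x ξ x' ξ') _).trans_eq ?_
        rw [← decayKernel_add_mul_ofReal N k (x' - x), ← decayKernel_add_mul_ofReal N k (ξ' - ξ),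
          ENNReal.coe_mul]
        ring

theorem measurable_enorm_stft_mul (g : 𝓢(V, ℂ)) (f : 𝓢'(V, ℂ)) {m : V → V → ℝ}
    (hm : IsModerate m) :
    Measurable (Function.uncurry fun x ξ : V =>
      ‖stft g f x ξ‖ₑ * ENNReal.ofReal (m x ξ)) := by
  have hstft : Continuous fun w : V × V => stft g f w.1 w.2 :=
    (continuous_stft g f).comp (WithLp.prod_continuous_toLp 2 V V)
  exact hstft.measurable.enorm.mul hm.continuous.measurable.ennreal_ofReal

theorem exists_enorm_stft_mul_le_swap (hg : g ≠ 0) (h : 𝓢(V, ℂ)) (N : ℕ) {m : V → V → ℝ}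
    (hm : IsModerate m) : ∃ C : ℝ≥0, ∀ (f : 𝓢'(V, ℂ)) (ξ x : V),
      ‖stft h f x ξ‖ₑ * ENNReal.ofReal (m x ξ) ≤
        ∫⁻ ξ', ∫⁻ x', (C * (‖stft g f x' ξ'‖ₑ * ENNReal.ofReal (m x' ξ'))) *
          (decayKernel N (ξ' - ξ) * decayKernel N (x' - x)) := by
  obtain ⟨C, hC⟩ := exists_enorm_stft_mul_le hg h N hm
  refine ⟨C, fun f ξ x => (hC f x ξ).trans_eq ?_⟩
  have hdecay := measurable_decayKernel (V := V) N
  rw [lintegral_lintegral_swap]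
  · simp only [mul_comm (decayKernel N (_ - x))]
  · exact (((measurable_enorm_stft_mul g f hm).const_mul (C : ℝ≥0∞)).mul
      (by fun_prop)).aemeasurable

theorem eLpNorm_eLpNorm_const_mul {A B : Type*} [MeasurableSpace A] [MeasurableSpace B]
    {μ : Measure A} {ν : Measure B} (p q : ℝ≥0∞) {c : ℝ≥0∞} (hc : c ≠ ⊤) (G : A → B → ℝ≥0∞) :
    eLpNorm (fun x => eLpNorm (fun y => c * G x y) p ν) q μ =
      c * eLpNorm (fun x => eLpNorm (G x) p ν) q μ := by
  simp only [eLpNorm_ennreal_const_mul p hc]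
  exact eLpNorm_ennreal_const_mul q hc _

theorem exists_modulationNorm_le (hg : g ≠ 0) (h : 𝓢(V, ℂ)) (hp₀ : 1 ≤ p₀) (hpp : p₀ ≤ p)
    (hq₀ : 1 ≤ q₀) (hqq : q₀ ≤ q) {m : WithLp 2 (V × V) → ℝ}
    (hm : IsModerate fun x ξ => m (WithLp.toLp 2 (x, ξ))) :
    ∃ C : ℝ≥0, ∀ f : 𝓢'(V, ℂ), modulationNorm h p q m f ≤ C * modulationNorm g p₀ q₀ m f := by
  obtain ⟨N, M, hN⟩ := exists_isKernel_decayKernel V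
  obtain ⟨C, hC⟩ := exists_enorm_stft_mul_le_swap hg h N hm
  refine ⟨M * M * C, fun f => ?_⟩
  have hG : Measurable (Function.uncurry fun ξ x =>
      C * (‖stft g f x ξ‖ₑ * ENNReal.ofReal (m (WithLp.toLp 2 (x, ξ))))) :=
    ((measurable_enorm_stft_mul g f hm).comp measurable_swap).const_mul _
  refine (hN.eLpNorm_eLpNorm_le hN hp₀ hpp hq₀ hqq hG (hC f)).trans_eq ?_
  rw [eLpNorm_eLpNorm_const_mul p₀ q₀ ENNReal.coe_ne_top, ENNReal.coe_mul, ENNReal.coe_mul,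
    mul_assoc _ (C : ℝ≥0∞), modulationNorm]

theorem exists_enorm_stft_mul_le_modulationNorm (hg : g ≠ 0) (hp : 1 ≤ p) (hq : 1 ≤ q)
    {m : WithLp 2 (V × V) → ℝ} (hm : IsModerate fun x ξ => m (WithLp.toLp 2 (x, ξ))) :
    ∃ C : ℝ≥0, ∀ (f : 𝓢'(V, ℂ)) (x ξ : V),
      ‖stft g f x ξ‖ₑ * ENNReal.ofReal (m (WithLp.toLp 2 (x, ξ))) ≤
        C * modulationNorm g p q m f := by
  obtain ⟨N, M, hN⟩ := exists_isKernel_decayKernel V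
  obtain ⟨C, hC⟩ := exists_enorm_stft_mul_le_swap hg g N hm
  refine ⟨M * M * C, fun f x ξ => ?_⟩
  have hG : Measurable (Function.uncurry fun ξ x =>
      C * (‖stft g f x ξ‖ₑ * ENNReal.ofReal (m (WithLp.toLp 2 (x, ξ))))) :=
    ((measurable_enorm_stft_mul g f hm).comp measurable_swap).const_mul _
  refine (hC f ξ x).trans ((hN.lintegral_lintegral_mul_le hN hp hq hG ξ x).trans_eq ?_)
  rw [eLpNorm_eLpNorm_const_mul p q ENNReal.coe_ne_top, ENNReal.coe_mul, ENNReal.coe_mul,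
    mul_assoc _ (C : ℝ≥0∞), modulationNorm]

theorem wienerNorm_eq (g : 𝓢(V, ℂ)) (p q : ℝ≥0∞) (w : V → ℝ) (f : 𝓢'(V, ℂ)) :
    wienerNorm g p q w f = eLpNorm (fun x : V =>
      eLpNorm (fun ξ : V => ‖stft g f x ξ‖ₑ * ENNReal.ofReal (w x)) p volume) q volume := by
  simp only [wienerNorm, mul_comm _ (ENNReal.ofReal (w _)),
    eLpNorm_ennreal_const_mul p ENNReal.ofReal_ne_top]

theorem exists_wienerNorm_le (hg : g ≠ 0) (h : 𝓢(V, ℂ)) (hp₀ : 1 ≤ p₀) (hpp : p₀ ≤ p)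
    (hq₀ : 1 ≤ q₀) (hqq : q₀ ≤ q) {w : V → ℝ} (hw : IsModerate fun x _ => w x) :
    ∃ C : ℝ≥0, ∀ f : 𝓢'(V, ℂ), wienerNorm h p q w f ≤ C * wienerNorm g p₀ q₀ w f := by
  obtain ⟨N, M, hN⟩ := exists_isKernel_decayKernel V
  obtain ⟨C, hC⟩ := exists_enorm_stft_mul_le hg h N hw
  refine ⟨M * M * C, fun f => ?_⟩
  rw [wienerNorm_eq, wienerNorm_eq]
  have hG : Measurable (Function.uncurry fun x ξ =>
      C * (‖stft g f x ξ‖ₑ * ENNReal.ofReal (w x))) :=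
    (measurable_enorm_stft_mul g f hw).const_mul _
  refine (hN.eLpNorm_eLpNorm_le hN hp₀ hpp hq₀ hqq hG (hC f)).trans_eq ?_
  rw [eLpNorm_eLpNorm_const_mul p₀ q₀ ENNReal.coe_ne_top, ENNReal.coe_mul, ENNReal.coe_mul,
    mul_assoc _ (C : ℝ≥0∞)]

theorem eLpNorm_withLp_prod_le (hp : p ≠ 0) {f : WithLp 2 (V × V) → ℝ≥0∞} (hf : Measurable f)
    {A : ℝ≥0∞} (hA : ∀ z, f z ≤ A) (hfA : eLpNorm (fun y : V =>
      eLpNorm (fun x : V => f (WithLp.toLp 2 (x, y))) p volume) p volume ≤ A) :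
    eLpNorm f p volume ≤ A := by
  rcases eq_or_ne p ⊤ with rfl | ht
  · exact eLpNorm_ennreal_top_le hA
  · rw [eLpNorm_ennreal_le_iff hp ht] at hfA ⊢
    rw [lintegral_withLp_prod_symm (hf.pow_const _)]
    simpa only [eLpNorm_ennreal_rpow_toReal hp ht] using hfA

end Embeddings

section PolynomialGrowth

variable {E : Type*} [NormedAddCommGroup E]

theorem norm_div_one_add_norm_sq_pow_le {u : E → ℂ} {C : ℝ} {N : ℕ}
    (h : ∀ x, ‖u x‖ ≤ C * (1 + ‖x‖) ^ N) (x : E) :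
    ‖u x / ((1 + ‖x‖ ^ 2 : ℝ) : ℂ) ^ N‖ ≤ C * 2 ^ N := by
  have hC : 0 ≤ C := by simpa using (norm_nonneg _).trans (h 0)
  rw [norm_div, norm_pow, Complex.norm_of_nonneg (by positivity), div_le_iff₀ (by positivity),
    mul_assoc, ← mul_pow]
  refine (h x).trans ?_
  gcongr
  nlinarith [sq_nonneg (‖x‖ - 1), sq_nonneg ‖x‖]

variable [InnerProductSpace ℝ E]

theorem hasTemperateGrowth_one_add_norm_sq_pow (N : ℕ) :
    (fun x : E => ((1 + ‖x‖ ^ 2 : ℝ) : ℂ) ^ N).HasTemperateGrowth :=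
  (Complex.ofRealCLM.hasTemperateGrowth.comp
    ((Function.HasTemperateGrowth.const 1).add
      (Function.hasTemperateGrowth_norm_sq E))).pow N

variable [MeasurableSpace E] [BorelSpace E] [FiniteDimensional ℝ E]

theorem exists_temperedDistribution_apply_eq_integral {u : E → ℂ} (hu : Continuous u)
    {C : ℝ} {N : ℕ} (h : ∀ x, ‖u x‖ ≤ C * (1 + ‖x‖) ^ N) :
    ∃ T : 𝓢'(E, ℂ), ∀ f : 𝓢(E, ℂ), Integrable (fun x => f x * u x) ∧ T f = ∫ x, f x * u x := by
  set w : E → ℂ := fun x => ((1 + ‖x‖ ^ 2 : ℝ) : ℂ) ^ N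
  have hw := hasTemperateGrowth_one_add_norm_sq_pow (E := E) N
  have hw0 (x : E) : w x ≠ 0 := pow_ne_zero _ (by exact_mod_cast (by positivity : 1 + ‖x‖ ^ 2 ≠ 0))
  have hv : AEStronglyMeasurable (fun x => u x / w x) volume :=
    (hu.div hw.1.continuous hw0).aestronglyMeasurable
  have hmem : MemLp (fun x => u x / w x) ⊤ volume :=
    memLp_top_of_bound hv _ (.of_forall (norm_div_one_add_norm_sq_pow_le h))
  have hmul (f : 𝓢(E, ℂ)) (x : E) : SchwartzMap.smulLeftCLM ℂ w f x * (u x / w x) = f x * u x := by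
    rw [SchwartzMap.smulLeftCLM_apply_apply hw, smul_eq_mul, mul_right_comm,
      mul_div_cancel₀ _ (hw0 x), mul_comm]
  refine ⟨TemperedDistribution.smulLeftCLM ℂ w (Lp.toTemperedDistribution hmem.toLp),
    fun f => ⟨?_, ?_⟩⟩
  · simpa only [hmul] using (SchwartzMap.smulLeftCLM ℂ w f).integrable.mul_bdd hv
      (.of_forall (norm_div_one_add_norm_sq_pow_le h))
  · rw [TemperedDistribution.smulLeftCLM_apply_apply, Lp.toTemperedDistribution_apply]
    refine integral_congr_ae (hmem.coeFn_toLp.mono fun x hx => ?_)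
    simp only [hx, smul_eq_mul, hmul]

end PolynomialGrowth

/-! ### Existence and uniqueness of the distributional transform -/

section Gaussian

theorem one_add_pow_mul_exp_neg_mul_sq_le {a : ℝ} (ha : 0 < a) (m : ℕ) {r : ℝ} (hr : 0 ≤ r) :
    (1 + r) ^ m * Real.exp (-a * r ^ 2) ≤ (2 / a) ^ m * m.factorial * Real.exp a := by
  have hexp : (a * (1 + r ^ 2)) ^ m ≤ Real.exp (a * (1 + r ^ 2)) * m.factorial :=
    (div_le_iff₀ (by positivity)).1 (Real.pow_div_factorial_le_exp _ (by positivity) m)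
  have hr2 : 1 + r ≤ (2 / a) * (a * (1 + r ^ 2)) := by
    rw [← mul_assoc, div_mul_cancel₀ _ ha.ne']
    nlinarith [sq_nonneg (r - 1)]
  calc (1 + r) ^ m * Real.exp (-a * r ^ 2)
      ≤ ((2 / a) * (a * (1 + r ^ 2))) ^ m * Real.exp (-a * r ^ 2) := by gcongr
    _ ≤ (2 / a) ^ m * (Real.exp (a * (1 + r ^ 2)) * m.factorial) * Real.exp (-a * r ^ 2) := by
        rw [mul_pow]
        gcongr
    _ = (2 / a) ^ m * m.factorial * (Real.exp (a * (1 + r ^ 2)) * Real.exp (-a * r ^ 2)) := by ring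
    _ = (2 / a) ^ m * m.factorial * Real.exp a := by
        rw [← Real.exp_add]
        ring_nf

variable {V : Type*} [NormedAddCommGroup V] [InnerProductSpace ℝ V] {a : ℝ}

theorem exists_norm_iteratedFDeriv_exp_neg_mul_norm_sq_le (a : ℝ) (n : ℕ) : ∃ (K : ℝ) (l : ℕ),
    0 ≤ K ∧ ∀ x : V, ‖iteratedFDeriv ℝ n (fun x => Real.exp (-a * ‖x‖ ^ 2)) x‖ ≤
      K * (1 + ‖x‖) ^ l * Real.exp (-a * ‖x‖ ^ 2) := by
  have hq : (fun x : V => -a * ‖x‖ ^ 2).HasTemperateGrowth := by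
    have := Function.hasTemperateGrowth_norm_sq (H := V)
    fun_prop
  obtain ⟨l, K, hK, h⟩ := hq.norm_iteratedFDeriv_le_uniform n
  refine ⟨n.factorial * (K + 1) ^ n, l * n, by positivity, fun x => ?_⟩
  have hle : ‖iteratedFDeriv ℝ n (Real.exp ∘ fun x : V => -a * ‖x‖ ^ 2) x‖ ≤
      n.factorial * Real.exp (-a * ‖x‖ ^ 2) * ((K + 1) * (1 + ‖x‖) ^ l) ^ n := by
    refine norm_iteratedFDeriv_comp_le (N := ∞) Real.contDiff_exp hq.1 (mod_cast le_top) x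
      (fun i _ => ?_) (fun i hi hin => (h i hin x).trans ?_)
    · rw [norm_iteratedFDeriv_eq_norm_iteratedDeriv, iteratedDeriv_eq_iterate, Real.iter_deriv_exp,
        Real.norm_of_nonneg (Real.exp_pos _).le]
    · have hone : 1 ≤ (1 + ‖x‖) ^ l := one_le_pow₀ (by linarith [norm_nonneg x])
      calc K * (1 + ‖x‖) ^ l ≤ (K + 1) * (1 + ‖x‖) ^ l := by gcongr; linarith
        _ ≤ _ := le_self_pow₀ (by nlinarith) (by omega)
  refine hle.trans_eq ?_
  rw [mul_pow, pow_mul]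
  ring

theorem exists_pow_mul_norm_iteratedFDeriv_exp_neg_mul_norm_sq_le (ha : 0 < a) (k n : ℕ) :
    ∃ C : ℝ, ∀ x : V,
      ‖x‖ ^ k * ‖iteratedFDeriv ℝ n (fun x => Real.exp (-a * ‖x‖ ^ 2)) x‖ ≤ C := by
  obtain ⟨K, l, hK, h⟩ := exists_norm_iteratedFDeriv_exp_neg_mul_norm_sq_le (V := V) a n
  refine ⟨K * ((2 / a) ^ (k + l) * (k + l).factorial * Real.exp a), fun x => ?_⟩
  calc _ ≤ (1 + ‖x‖) ^ k * (K * (1 + ‖x‖) ^ l * Real.exp (-a * ‖x‖ ^ 2)) := by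
        gcongr
        · linarith
        · exact h x
    _ = K * ((1 + ‖x‖) ^ (k + l) * Real.exp (-a * ‖x‖ ^ 2)) := by
        rw [pow_add]
        ring
    _ ≤ _ := by
        exact mul_le_mul_of_nonneg_left
          (one_add_pow_mul_exp_neg_mul_sq_le ha _ (norm_nonneg x)) hK

/-- The Gaussian `x ↦ e^{-a|x|²}` as a real-valued Schwartz function. -/
noncomputable def realGaussian (ha : 0 < a) : 𝓢(V, ℝ) where
  toFun x := Real.exp (-a * ‖x‖ ^ 2)
  smooth' := Real.contDiff_exp.comp (contDiff_const.mul (contDiff_norm_sq ℝ))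
  decay' := exists_pow_mul_norm_iteratedFDeriv_exp_neg_mul_norm_sq_le ha

/-- The Gaussian `x ↦ e^{-a|x|²}` as a complex-valued Schwartz function. -/
noncomputable def gaussian (ha : 0 < a) : 𝓢(V, ℂ) :=
  SchwartzMap.postcompCLM (𝕜 := ℝ) Complex.ofRealCLM (realGaussian ha)

theorem gaussian_apply (ha : 0 < a) (x : V) :
    gaussian ha x = (Real.exp (-a * ‖x‖ ^ 2) : ℂ) := rfl

theorem gaussian_ne_zero (ha : 0 < a) : (gaussian ha : 𝓢(V, ℂ)) ≠ 0 :=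
  DFunLike.ne_iff.2 ⟨0, by simp [gaussian_apply]⟩

end Gaussian

section Existence

variable {V : Type*} [NormedAddCommGroup V] [InnerProductSpace ℝ V]

theorem conjS_conjS (φ : 𝓢(V, ℂ)) : conjS (conjS φ) = φ := by
  ext t
  simp [conjS_apply]

theorem conjS_add (φ ψ : 𝓢(V, ℂ)) : conjS (φ + ψ) = conjS φ + conjS ψ := by
  ext t
  simp [conjS_apply]

theorem continuous_conjS : Continuous (conjS : 𝓢(V, ℂ) → 𝓢(V, ℂ)) :=
  (SchwartzMap.postcompCLM (𝕜 := ℝ) (E := V) (Complex.conjCLE : ℂ →L[ℝ] ℂ)).continuous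

theorem conj_doubleSTFT_mul (g₁ g₂ : 𝓢(V, ℂ)) (f₁ f₂ h₁ h₂ : 𝓢'(V, ℂ))
    (z ζ : WithLp 2 (V × V)) :
    conj (doubleSTFT g₁ g₂ h₁ h₂ z ζ) * doubleSTFT g₁ g₂ f₁ f₂ z ζ =
      (conj (stft g₂ h₂ (phasePoint z ζ).fst (phasePoint z ζ).snd) *
        stft g₂ f₂ (phasePoint z ζ).fst (phasePoint z ζ).snd) *
      conj (conj (stft g₁ h₁ (phasePoint z ζ - z).fst (phasePoint z ζ - z).snd) *
        stft g₁ f₁ (phasePoint z ζ - z).fst (phasePoint z ζ - z).snd) := by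
  have hphase (x : ℝ) : Complex.exp (2 * Real.pi * Complex.I * (x : ℂ)) *
      conj (Complex.exp (2 * Real.pi * Complex.I * (x : ℂ))) = 1 := by
    rw [Complex.mul_conj', norm_cexp_two_pi_mul_I_mul_ofReal, Complex.ofReal_one, one_pow]
  set b := phasePoint z ζ
  simp only [doubleSTFT, map_mul, Complex.conj_conj]
  linear_combination conj (stft g₂ h₂ b.fst b.snd) * stft g₂ f₂ b.fst b.snd *
    (stft g₁ h₁ (b - z).fst (b - z).snd * conj (stft g₁ f₁ (b - z).fst (b - z).snd)) *
    hphase ⟪z.snd, ζ.snd⟫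

theorem exists_norm_doubleSTFT_le (g₁ g₂ : 𝓢(V, ℂ)) (f₁ f₂ : 𝓢'(V, ℂ)) : ∃ (N : ℕ) (C : ℝ),
    ∀ w : WithLp 2 (WithLp 2 (V × V) × WithLp 2 (V × V)),
      ‖doubleSTFT g₁ g₂ f₁ f₂ w.fst w.snd‖ ≤ C * (1 + ‖w‖) ^ N := by
  obtain ⟨N₁, C₁, h₁⟩ := exists_norm_stft_le g₁ f₁
  obtain ⟨N₂, C₂, h₂⟩ := exists_norm_stft_le g₂ f₂
  have hC₁ : 0 ≤ C₁ := by simpa using (norm_nonneg _).trans (h₁ 0)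
  have hC₂ : 0 ≤ C₂ := by simpa using (norm_nonneg _).trans (h₂ 0)
  refine ⟨N₁ + N₂, C₁ * 4 ^ N₁ * (C₂ * 4 ^ N₂), fun w => ?_⟩
  have hfst : ‖w.fst‖ ≤ ‖w‖ := WithLp.norm_fst_le (p := 2) _ w
  have hpoint : ‖phasePoint w.fst w.snd‖ ≤ 3 * ‖w‖ := by
    have hsnd : ‖w.snd‖ ≤ ‖w‖ := WithLp.norm_snd_le (p := 2) _ w
    have hadd := norm_add_le w.snd.fst w.fst.snd
    have hle := norm_toLp_le_add (-w.snd.snd) (w.snd.fst + w.fst.snd)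
    rw [norm_neg] at hle
    rw [phasePoint]
    linarith [WithLp.norm_fst_le (p := 2) _ w.snd, WithLp.norm_snd_le (p := 2) _ w.snd,
      WithLp.norm_snd_le (p := 2) _ w.fst]
  have hsub : ‖phasePoint w.fst w.snd - w.fst‖ ≤ 4 * ‖w‖ :=
    (norm_sub_le _ _).trans (by linarith)
  rw [norm_doubleSTFT]
  calc _ ≤ C₁ * (4 * (1 + ‖w‖)) ^ N₁ * (C₂ * (4 * (1 + ‖w‖)) ^ N₂) := by
        refine mul_le_mul ((h₁ _).trans ?_) ((h₂ _).trans ?_) (norm_nonneg _) (by positivity)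
        · gcongr
          linarith
        · gcongr
          linarith [norm_nonneg w]
    _ = _ := by
        rw [mul_pow, mul_pow, pow_add]
        ring

variable [MeasurableSpace V] [BorelSpace V] [FiniteDimensional ℝ V]

theorem bracket_coe_self (g : 𝓢(V, ℂ)) :
    bracket (g : 𝓢'(V, ℂ)) g = ((∫ x, ‖g x‖ ^ 2 : ℝ) : ℂ) := by
  rw [← integral_complex_ofReal, bracket, SchwartzMap.coe_apply]
  refine integral_congr_ae (.of_forall fun t => ?_)
  beta_reduce
  rw [conjS_apply, smul_eq_mul, Complex.conj_mul', Complex.ofReal_pow]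

theorem stftS_ne_zero {g₁ g₂ : 𝓢(V, ℂ)} (hg₁ : g₁ ≠ 0) (hg₂ : g₂ ≠ 0) : stftS g₁ g₂ ≠ 0 := by
  intro h0
  have h := isSTFT_stftS g₁ g₂ g₁ g₂
  rw [h0, bracket_coe_self, bracket_coe_self, bracket_coe_self, Complex.conj_ofReal] at h
  simp only [zero_apply, norm_zero] at h
  norm_cast at h
  simp [(integral_norm_sq_pos hg₁).ne', (integral_norm_sq_pos hg₂).ne'] at h

theorem IsSTFT.unique {f₁ f₂ : 𝓢'(V, ℂ)} {F F' : 𝓢'(WithLp 2 (V × V), ℂ)}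
    (hF : IsSTFT f₁ f₂ F) (hF' : IsSTFT f₁ f₂ F') : F = F' := by
  let g : 𝓢(V, ℂ) := gaussian one_pos
  have hA : ((∫ x, ‖stftS g g x‖ ^ 2 : ℝ) : ℂ) ≠ 0 :=
    Complex.ofReal_ne_zero.2 (integral_norm_sq_pos
      (stftS_ne_zero (gaussian_ne_zero one_pos) (gaussian_ne_zero one_pos))).ne'
  have hbracket (h : 𝓢(WithLp 2 (V × V), ℂ)) : bracket F h = bracket F' h := by
    refine mul_left_cancel₀ hA ?_
    rw [(bracket_eq_integral_stft F (stftS g g) h).2.2,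
      (bracket_eq_integral_stft F' (stftS g g) h).2.2]
    simp only [hF.stft_eq, hF'.stft_eq]
  ext h
  simpa only [bracket, conjS_conjS] using hbracket (conjS h)

theorem continuous_doubleSTFT (g₁ g₂ : 𝓢(V, ℂ)) (f₁ f₂ : 𝓢'(V, ℂ)) :
    Continuous fun w : WithLp 2 (WithLp 2 (V × V) × WithLp 2 (V × V)) =>
      doubleSTFT g₁ g₂ f₁ f₂ w.fst w.snd := by
  have hpoint : Continuous fun w : WithLp 2 (WithLp 2 (V × V) × WithLp 2 (V × V)) =>
      phasePoint w.fst w.snd := by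
    unfold phasePoint
    fun_prop
  have hexp : Continuous fun w : WithLp 2 (WithLp 2 (V × V) × WithLp 2 (V × V)) =>
      Complex.exp (2 * Real.pi * Complex.I * ((⟪w.fst.snd, w.snd.snd⟫ : ℝ) : ℂ)) := by
    fun_prop
  exact (Complex.continuous_conj.comp hexp).mul (((continuous_stft g₂ f₂).comp hpoint).mul
    (Complex.continuous_conj.comp ((continuous_stft g₁ f₁).comp
      (hpoint.sub (WithLp.fstL 2 ℝ _ _).continuous))))

theorem integral_mul_comp_phasePoint {H₁ H₂ : WithLp 2 (V × V) → ℂ} (hc₁ : Continuous H₁)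
    (hc₂ : Continuous H₂) (hi₁ : Integrable H₁) (hi₂ : Integrable H₂) :
    ∫ z, ∫ ζ, H₂ (phasePoint z ζ) * conj (H₁ (phasePoint z ζ - z)) =
      (∫ z, H₂ z) * conj (∫ z, H₁ z) := by
  have hchange (z : WithLp 2 (V × V)) :
      ∫ ζ, H₂ (phasePoint z ζ) * conj (H₁ (phasePoint z ζ - z)) =
        ∫ b, H₂ b * conj (H₁ (-(z - b))) := by
    have hmp := measurePreserving_phasePoint z
    have hc : Continuous fun b => H₂ b * conj (H₁ (b - z)) := by fun_prop
    simp only [neg_sub]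
    rw [← integral_map (f := fun b => H₂ b * conj (H₁ (b - z))) hmp.aemeasurable
      hc.aestronglyMeasurable, hmp.map_eq]
  have hi₁' : Integrable fun z => conj (H₁ (-z)) :=
    Complex.conjLIE.toContinuousLinearEquiv.toContinuousLinearMap.integrable_comp hi₁.comp_neg
  have hconv : ∫ z, ∫ b, H₂ b * conj (H₁ (-(z - b))) = (∫ b, H₂ b) * ∫ z, conj (H₁ (-z)) :=
    integral_convolution (ContinuousLinearMap.mul ℂ ℂ) hi₂ hi₁'
  simp only [hchange]
  rw [hconv, integral_neg_eq_self (fun z => conj (H₁ z)), integral_conj]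

theorem integral_conj_stftS_mul_doubleSTFT (g₁ g₂ φ ψ : 𝓢(V, ℂ)) (f₁ f₂ : 𝓢'(V, ℂ))
    (hint : Integrable fun w : WithLp 2 (WithLp 2 (V × V) × WithLp 2 (V × V)) =>
      conjS (stftS (stftS g₁ g₂) (stftS φ ψ)) w * doubleSTFT g₁ g₂ f₁ f₂ w.fst w.snd) :
    ∫ w : WithLp 2 (WithLp 2 (V × V) × WithLp 2 (V × V)),
        conjS (stftS (stftS g₁ g₂) (stftS φ ψ)) w * doubleSTFT g₁ g₂ f₁ f₂ w.fst w.snd =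
      ((∫ x, ‖g₁ x‖ ^ 2 : ℝ) : ℂ) * ((∫ x, ‖g₂ x‖ ^ 2 : ℝ) : ℂ) *
        (bracket f₂ ψ * conj (bracket f₁ φ)) := by
  obtain ⟨hc₁, hi₁, he₁⟩ := bracket_eq_integral_stft f₁ g₁ φ
  obtain ⟨hc₂, hi₂, he₂⟩ := bracket_eq_integral_stft f₂ g₂ ψ
  have hdouble (z ζ : WithLp 2 (V × V)) :
      stftS (stftS g₁ g₂) (stftS φ ψ) (WithLp.toLp 2 (z, ζ)) = doubleSTFT g₁ g₂ φ ψ z ζ :=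
    (stft_coe _ _ (WithLp.toLp 2 (z, ζ))).symm.trans ((isSTFT_stftS φ ψ).stft_eq g₁ g₂ z ζ)
  have hmp := WithLp.volume_preserving_toLp (WithLp 2 (V × V)) (WithLp 2 (V × V))
  rw [← hmp.integral_comp (MeasurableEquiv.toLp 2 _).measurableEmbedding,
    Measure.volume_eq_prod]
  refine (integral_prod _ (hmp.integrable_comp_of_integrable hint)).trans ?_
  simp only [Function.comp_apply, conjS_apply, hdouble, WithLp.toLp_fst, WithLp.toLp_snd,
    conj_doubleSTFT_mul, stft_coe]
  rw [integral_mul_comp_phasePoint hc₁ hc₂ hi₁ hi₂, ← he₁, ← he₂, map_mul, Complex.conj_ofReal]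
  ring

-- The covariance formula determines the short-time Fourier transform of `V_{f₁} f₂` with window
-- `V_{g₁} g₂`, and hence, by the inversion formula, `V_{f₁} f₂` itself.
theorem exists_isSTFT (f₁ f₂ : 𝓢'(V, ℂ)) : ∃ F, IsSTFT f₁ f₂ F := by
  let g : 𝓢(V, ℂ) := gaussian one_pos
  obtain ⟨N, C, hC⟩ := exists_norm_doubleSTFT_le g g f₁ f₂
  obtain ⟨T, hT⟩ := exists_temperedDistribution_apply_eq_integral
    (continuous_doubleSTFT g g f₁ f₂) hC
  let A : ℂ := ((∫ x, ‖g x‖ ^ 2 : ℝ) : ℂ)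
  have hA : A ≠ 0 :=
    Complex.ofReal_ne_zero.2 (integral_norm_sq_pos (gaussian_ne_zero one_pos)).ne'
  let L : 𝓢(WithLp 2 (V × V), ℂ) →L[ℂ] ℂ :=
    { toFun := fun Ψ => T (conjS (stftCLM (stftS g g) (conjS Ψ)))
      map_add' := fun Ψ₁ Ψ₂ => by simp only [conjS_add, map_add]
      map_smul' := fun c Ψ => by
        simp only [conjS_smul, map_smul, Complex.conj_conj, RingHom.id_apply]
      cont := (toLinearForm T).continuous.comp (continuous_conjS.comp
        ((stftCLM (stftS g g)).continuous.comp continuous_conjS)) }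
  refine ⟨ContinuousLinearMap.toPointwiseConvergenceCLM _ _ _ _ ((A * A)⁻¹ • L), fun φ ψ => ?_⟩
  change (A * A)⁻¹ * T (conjS (stftCLM (stftS g g) (conjS (conjS (stftS φ ψ))))) = _
  rw [inv_mul_eq_iff_eq_mul₀ (mul_ne_zero hA hA), conjS_conjS, stftCLM_apply, (hT _).2]
  exact integral_conj_stftS_mul_doubleSTFT g g φ ψ f₁ f₂ (hT _).1

end Existence

/-! ### Boundedness -/

section Boundedness

variable {V : Type*} [NormedAddCommGroup V] [InnerProductSpace ℝ V] [MeasurableSpace V]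
  [BorelSpace V] [FiniteDimensional ℝ V] {g g₁ g₂ : 𝓢(V, ℂ)} {p₁ p₂ p q : ℝ≥0∞}

/-- The weighted modulus `|V_g f| v_s` on phase space, whose mixed norms are the modulation space
norms of `f`. -/
noncomputable def weightedSTFT (g : 𝓢(V, ℂ)) (s : ℝ) (f : 𝓢'(V, ℂ)) (z : WithLp 2 (V × V)) :
    ℝ≥0∞ := ‖stft g f z.fst z.snd‖ₑ * ENNReal.ofReal (weight s z)

theorem measurable_weightedSTFT (g : 𝓢(V, ℂ)) (s : ℝ) (f : 𝓢'(V, ℂ)) :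
    Measurable (weightedSTFT g s f) :=
  (continuous_stft g f).measurable.enorm.mul (continuous_weight s).measurable.ennreal_ofReal

theorem exists_weightedSTFT_le (hg : g ≠ 0) (s : ℝ) (hp : 1 ≤ p) :
    ∃ C : ℝ≥0, ∀ f : 𝓢'(V, ℂ),
      (∀ z, weightedSTFT g s f z ≤ C * modulationNorm g p p (weight s) f) ∧
      eLpNorm (weightedSTFT g s f) p volume ≤ C * modulationNorm g p p (weight s) f := by
  obtain ⟨C, hC⟩ := exists_enorm_stft_mul_le_modulationNorm hg hp hp (isModerate_weight s)
  refine ⟨C + 1, fun f => ?_⟩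
  have hpointwise (z : WithLp 2 (V × V)) :
      weightedSTFT g s f z ≤ (C + 1 : ℝ≥0) * modulationNorm g p p (weight s) f :=
    (hC f z.fst z.snd).trans (by gcongr; simp)
  refine ⟨hpointwise, eLpNorm_withLp_prod_le (one_pos.trans_le hp).ne'
    (measurable_weightedSTFT g s f) hpointwise ?_⟩
  exact le_mul_of_one_le_left' (a := modulationNorm g p p (weight s) f) (by simp)

theorem IsSTFT.enorm_stft_mul_weight_le {f₁ f₂ : 𝓢'(V, ℂ)} {F : 𝓢'(WithLp 2 (V × V), ℂ)}
    (hF : IsSTFT f₁ f₂ F) (g₁ g₂ : 𝓢(V, ℂ)) (s : ℝ) (z ζ : WithLp 2 (V × V)) :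
    ‖stft (stftS g₁ g₂) F z ζ‖ₑ * ENNReal.ofReal (weight s z) ≤
      ENNReal.ofReal (2 ^ (|s| / 2)) * (weightedSTFT g₁ |s| f₁ (phasePoint z ζ - z) *
        weightedSTFT g₂ s f₂ (phasePoint z ζ)) := by
  rw [hF.enorm_stft_eq]
  set b := phasePoint z ζ
  have hweight : ENNReal.ofReal (weight s z) ≤ ENNReal.ofReal (2 ^ (|s| / 2)) *
      (ENNReal.ofReal (weight s b) * ENNReal.ofReal (weight |s| (b - z))) := by
    rw [← ENNReal.ofReal_mul (weight_pos _ _).le, ← ENNReal.ofReal_mul (by positivity),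
      ← weight_neg_right |s| (b - z), neg_sub]
    refine ENNReal.ofReal_le_ofReal (le_of_eq_of_le ?_ (weight_add_le s b (z - b)))
    rw [add_sub_cancel]
  refine (mul_le_mul_right hweight _).trans_eq ?_
  rw [weightedSTFT, weightedSTFT]
  ring

theorem IsSTFT.wienerNorm_le {f₁ f₂ : 𝓢'(V, ℂ)} {F : 𝓢'(WithLp 2 (V × V), ℂ)}
    (hF : IsSTFT f₁ f₂ F) (g₁ g₂ : 𝓢(V, ℂ)) (p q : ℝ≥0∞) (s : ℝ) :
    wienerNorm (stftS g₁ g₂) p q (weight s) F ≤ ENNReal.ofReal (2 ^ (|s| / 2)) *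
      eLpNorm (fun z => eLpNorm (fun a => weightedSTFT g₁ |s| f₁ a * weightedSTFT g₂ s f₂ (a + z))
        p volume) q volume := by
  rw [wienerNorm_eq, ← eLpNorm_eLpNorm_const_mul p q ENNReal.ofReal_ne_top]
  refine eLpNorm_ennreal_mono fun z => ?_
  have hmeas : Measurable fun b => ENNReal.ofReal (2 ^ (|s| / 2)) *
      (weightedSTFT g₁ |s| f₁ (b - z) * weightedSTFT g₂ s f₂ b) :=
    (((measurable_weightedSTFT g₁ |s| f₁).comp (measurable_id.sub_const z)).mul
      (measurable_weightedSTFT g₂ s f₂)).const_mul _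
  calc _ ≤ eLpNorm ((fun b => ENNReal.ofReal (2 ^ (|s| / 2)) *
        (weightedSTFT g₁ |s| f₁ (b - z) * weightedSTFT g₂ s f₂ b)) ∘ phasePoint z) p volume :=
        eLpNorm_ennreal_mono (hF.enorm_stft_mul_weight_le g₁ g₂ s z)
    _ = eLpNorm (fun b => ENNReal.ofReal (2 ^ (|s| / 2)) *
        (weightedSTFT g₁ |s| f₁ (b - z) * weightedSTFT g₂ s f₂ b)) p volume :=
        eLpNorm_comp_measurePreserving hmeas.aestronglyMeasurable (measurePreserving_phasePoint z)
    _ = eLpNorm ((fun b => ENNReal.ofReal (2 ^ (|s| / 2)) *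
        (weightedSTFT g₁ |s| f₁ (b - z) * weightedSTFT g₂ s f₂ b)) ∘ (· + z)) p volume :=
        (eLpNorm_comp_measurePreserving hmeas.aestronglyMeasurable
          (measurePreserving_add_right volume z)).symm
    _ = _ := by simp only [Function.comp_def, add_sub_cancel_right]

theorem exists_wienerNorm_isSTFT_le_of_le (hp₁ : 1 ≤ p₁) (hp₂ : 1 ≤ p₂) (hp : 1 ≤ p)
    (hg₁ : g₁ ≠ 0) (hg₂ : g₂ ≠ 0) (hpq : p ≤ q) (h₁ : p₁ ≤ q) (h₂ : p₂ ≤ q)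
    (h : p⁻¹ + q⁻¹ ≤ p₁⁻¹ + p₂⁻¹) (s : ℝ) :
    ∃ C : ℝ≥0, ∀ (f₁ f₂ : 𝓢'(V, ℂ)) (F : 𝓢'(WithLp 2 (V × V), ℂ)), IsSTFT f₁ f₂ F →
      MemModulation g₁ p₁ p₁ (weight |s|) f₁ → MemModulation g₂ p₂ p₂ (weight s) f₂ →
      wienerNorm (stftS g₁ g₂) p q (weight s) F ≤
        C * (modulationNorm g₁ p₁ p₁ (weight |s|) f₁ * modulationNorm g₂ p₂ p₂ (weight s) f₂) := by
  obtain ⟨C₁, hC₁⟩ := exists_weightedSTFT_le hg₁ |s| hp₁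
  obtain ⟨C₂, hC₂⟩ := exists_weightedSTFT_le hg₂ s hp₂
  refine ⟨(2 ^ (|s| / 2) : ℝ).toNNReal * (2 * (C₁ * C₂)), fun f₁ f₂ F hF hf₁ hf₂ => ?_⟩
  obtain ⟨hpoint₁, hnorm₁⟩ := hC₁ f₁
  obtain ⟨hpoint₂, hnorm₂⟩ := hC₂ f₂
  have hcorrelation := eLpNorm_correlation_le hp₁ hp₂ hp hpq h₁ h₂ h
    (measurable_weightedSTFT g₁ |s| f₁) (measurable_weightedSTFT g₂ s f₂)
    (ENNReal.mul_ne_top ENNReal.coe_ne_top hf₁.ne) (ENNReal.mul_ne_top ENNReal.coe_ne_top hf₂.ne)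
    hpoint₁ hpoint₂ hnorm₁ hnorm₂
  refine (hF.wienerNorm_le g₁ g₂ p q s).trans
    ((mul_le_mul_right hcorrelation _).trans_eq ?_)
  push_cast
  rw [ENNReal.ofReal]
  ring

theorem exists_wienerNorm_isSTFT_le (hp₁ : 1 ≤ p₁) (hp₂ : 1 ≤ p₂) (hp : 1 ≤ p) (hg₁ : g₁ ≠ 0)
    (hg₂ : g₂ ≠ 0) (Φ : 𝓢(WithLp 2 (V × V), ℂ)) (h₁ : p₁ ≤ q) (h₂ : p₂ ≤ q)
    (h : p⁻¹ + q⁻¹ ≤ p₁⁻¹ + p₂⁻¹) (s : ℝ) :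
    ∃ C : ℝ≥0, ∀ (f₁ f₂ : 𝓢'(V, ℂ)) (F : 𝓢'(WithLp 2 (V × V), ℂ)), IsSTFT f₁ f₂ F →
      MemModulation g₁ p₁ p₁ (weight |s|) f₁ → MemModulation g₂ p₂ p₂ (weight s) f₂ →
      wienerNorm Φ p q (weight s) F ≤
        C * (modulationNorm g₁ p₁ p₁ (weight |s|) f₁ * modulationNorm g₂ p₂ p₂ (weight s) f₂) := by
  have hq : 1 ≤ q := hp₁.trans h₁
  -- Since `W(𝓕L^q, L^q) ⊆ W(𝓕L^p, L^q)` for `q ≤ p`, the exponent `p` may be lowered to `q`.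
  obtain ⟨p₀, hp₀, hpp, hpq, h₀⟩ : ∃ p₀ : ℝ≥0∞, 1 ≤ p₀ ∧ p₀ ≤ p ∧ p₀ ≤ q ∧
      p₀⁻¹ + q⁻¹ ≤ p₁⁻¹ + p₂⁻¹ := by
    rcases le_total p q with hle | hle
    · exact ⟨p, hp, le_rfl, hle, h⟩
    · exact ⟨q, hq, hle, le_rfl, add_le_add (ENNReal.inv_le_inv.2 h₁) (ENNReal.inv_le_inv.2 h₂)⟩
  obtain ⟨C, hC⟩ := exists_wienerNorm_isSTFT_le_of_le hp₁ hp₂ hp₀ hg₁ hg₂ hpq h₁ h₂ h₀ s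
  obtain ⟨D, hD⟩ := exists_wienerNorm_le (stftS_ne_zero hg₁ hg₂) Φ hp₀ hpp hq le_rfl
    (isModerate_weight_fst s)
  refine ⟨D * C, fun f₁ f₂ F hF hf₁ hf₂ => (hD F).trans ?_⟩
  rw [ENNReal.coe_mul, mul_assoc]
  exact mul_le_mul_right (hC f₁ f₂ F hF hf₁ hf₂) _

end Boundedness

/-! ### Necessity of the conditions on the exponents -/

section GaussianSTFT

variable {V : Type*} [NormedAddCommGroup V] [InnerProductSpace ℝ V] {a b : ℝ}

theorem exp_mul_exp_sub_eq (hab : a + b ≠ 0) (x t : V) :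
    Real.exp (-b * ‖t‖ ^ 2) * Real.exp (-a * ‖t - x‖ ^ 2) =
      Real.exp (-(a * b / (a + b)) * ‖x‖ ^ 2) *
        Real.exp (-(a + b) * ‖t + -(a / (a + b)) • x‖ ^ 2) := by
  rw [← Real.exp_add, ← Real.exp_add, norm_sub_sq_real, norm_add_sq_real, inner_smul_right,
    norm_smul, mul_pow, Real.norm_eq_abs, sq_abs]
  congr 1
  field_simp
  ring

variable [MeasurableSpace V] [BorelSpace V] [FiniteDimensional ℝ V]

theorem norm_fourier_const_mul_comp_add_right (c : ℂ) (G : V → ℂ) (y ξ : V) :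
    ‖𝓕 (fun t => c * G (t + y)) ξ‖ = ‖c‖ * ‖𝓕 G ξ‖ := by
  have htranslate := congrFun (VectorFourier.fourierIntegral_comp_add_right Real.fourierChar
    volume (innerₗ V) G y) ξ
  have hscale := congrFun (VectorFourier.fourierIntegral_const_smul Real.fourierChar volume
    (innerₗ V) (G ∘ fun t => t + y) c) ξ
  calc ‖𝓕 (fun t => c * G (t + y)) ξ‖
      = ‖c • VectorFourier.fourierIntegral Real.fourierChar volume (innerₗ V)
          (G ∘ fun t => t + y) ξ‖ := congrArg _ hscale
    _ = ‖c‖ * ‖𝓕 G ξ‖ := by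
        rw [htranslate, norm_smul, Circle.norm_smul]
        rfl

theorem norm_fourier_cexp_neg_mul_norm_sq (ha : 0 < a) (ξ : V) :
    ‖𝓕 (fun t : V => (Real.exp (-a * ‖t‖ ^ 2) : ℂ)) ξ‖ =
      (Real.pi / a) ^ (Module.finrank ℝ V / 2 : ℝ) * Real.exp (-(Real.pi ^ 2 / a) * ‖ξ‖ ^ 2) := by
  have hfourier := fourier_gaussian_innerProductSpace (b := (a : ℂ)) (by simpa using ha) ξ
  have hpos : 0 < Real.pi / a := by positivity
  have hexp : -(Real.pi : ℂ) ^ 2 * ‖ξ‖ ^ 2 / a = ((-(Real.pi ^ 2 / a) * ‖ξ‖ ^ 2 : ℝ) : ℂ) := by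
    push_cast
    ring
  push_cast
  rw [hfourier, norm_mul, hexp, Complex.norm_exp_ofReal, ← Complex.ofReal_div,
    Complex.norm_cpow_eq_rpow_re_of_pos hpos]
  congr 2
  simp

theorem norm_stftFun_gaussian (ha : 0 < a) (hb : 0 < b) (z : WithLp 2 (V × V)) :
    ‖stftFun (gaussian ha) (gaussian hb) z‖ =
      (Real.pi / (a + b)) ^ (Module.finrank ℝ V / 2 : ℝ) *
        (Real.exp (-(a * b / (a + b)) * ‖z.fst‖ ^ 2) *
          Real.exp (-(Real.pi ^ 2 / (a + b)) * ‖z.snd‖ ^ 2)) := by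
  have hab : 0 < a + b := add_pos ha hb
  have hwindowed : (windowed (gaussian ha) (gaussian hb) z.fst : V → ℂ) = fun t =>
      (Real.exp (-(a * b / (a + b)) * ‖z.fst‖ ^ 2) : ℂ) *
        (Real.exp (-(a + b) * ‖t + -(a / (a + b)) • z.fst‖ ^ 2) : ℂ) := by
    funext t
    rw [windowed_apply, gaussian_apply, gaussian_apply, Complex.conj_ofReal]
    exact_mod_cast exp_mul_exp_sub_eq hab.ne' z.fst t
  calc ‖stftFun (gaussian ha) (gaussian hb) z‖
      = ‖𝓕 (windowed (gaussian ha) (gaussian hb) z.fst : V → ℂ) z.snd‖ := by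
        rw [← SchwartzMap.fourier_coe, ← stftFun_eq_fourier]
        rfl
    _ = _ := by
        rw [hwindowed, norm_fourier_const_mul_comp_add_right _
          (fun t : V => (Real.exp (-(a + b) * ‖t‖ ^ 2) : ℂ)), Complex.norm_real,
          Real.norm_of_nonneg (Real.exp_pos _).le, norm_fourier_cexp_neg_mul_norm_sq hab]
        ring

end GaussianSTFT

section DilatedGaussian

variable {V : Type*} [NormedAddCommGroup V] [InnerProductSpace ℝ V] [MeasurableSpace V]
  [BorelSpace V] [FiniteDimensional ℝ V] {R : ℝ}

theorem eLpNorm_comp_inv_smul (f : V → ℝ≥0∞) (p : ℝ≥0∞) (hR : 0 < R) :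
    eLpNorm (fun x => f (R⁻¹ • x)) p volume =
      ENNReal.ofReal (R ^ Module.finrank ℝ V) ^ p⁻¹.toReal * eLpNorm f p volume := by
  have hR' : R⁻¹ ≠ 0 := (inv_pos.2 hR).ne'
  have hmap : eLpNorm f p (Measure.map (R⁻¹ • ·) volume) = eLpNorm (f ∘ (R⁻¹ • ·)) p volume :=
    (Homeomorph.smulOfNeZero (α := V) R⁻¹ hR').measurableEmbedding.eLpNorm_map_measure
  rw [Measure.map_addHaar_smul _ hR', inv_pow, inv_inv, abs_of_pos (by positivity),
    eLpNorm_smul_measure_of_ne_zero (by simpa using pow_pos hR _), one_div, smul_eq_mul] at hmap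
  exact hmap.symm

/-- The Gaussian `x ↦ e^{-π|x/R|²}`, whose width `R` is varied to test which exponents satisfy the
estimate. -/
noncomputable def dilatedGaussian (hR : 0 < R) : 𝓢(V, ℂ) :=
  gaussian (mul_pos Real.pi_pos (inv_pos.2 (pow_pos hR 2)))

theorem norm_stft_dilatedGaussian (hR : 0 < R) (x ξ : V) :
    ‖stft (gaussian Real.pi_pos) (dilatedGaussian (V := V) hR : 𝓢'(V, ℂ)) x ξ‖ =
      (1 + (R ^ 2)⁻¹)⁻¹ ^ (Module.finrank ℝ V / 2 : ℝ) *
        (Real.exp (-(Real.pi * ((R ^ 2)⁻¹ / (1 + (R ^ 2)⁻¹))) * ‖x‖ ^ 2) *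
          Real.exp (-(Real.pi / (1 + (R ^ 2)⁻¹)) * ‖ξ‖ ^ 2)) := by
  have hfactor : Real.pi / (Real.pi + Real.pi * (R ^ 2)⁻¹) = (1 + (R ^ 2)⁻¹)⁻¹ := by
    field_simp
  have hfst : Real.pi * (Real.pi * (R ^ 2)⁻¹) / (Real.pi + Real.pi * (R ^ 2)⁻¹) =
      Real.pi * ((R ^ 2)⁻¹ / (1 + (R ^ 2)⁻¹)) := by
    field_simp
  have hsnd : Real.pi ^ 2 / (Real.pi + Real.pi * (R ^ 2)⁻¹) = Real.pi / (1 + (R ^ 2)⁻¹) := by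
    field_simp
  rw [← hfactor, ← hfst, ← hsnd]
  exact (congrArg _ (stft_coe (gaussian Real.pi_pos) (dilatedGaussian hR)
    (WithLp.toLp 2 (x, ξ)))).trans (norm_stftFun_gaussian Real.pi_pos _ _)

theorem enorm_stft_dilatedGaussian_le (hR : 1 ≤ R) (x ξ : V) :
    ‖stft (gaussian Real.pi_pos)
        (dilatedGaussian (V := V) (one_pos.trans_le hR) : 𝓢'(V, ℂ)) x ξ‖ₑ ≤
      ‖(gaussian Real.pi_div_two_pos : 𝓢(V, ℂ)) ξ‖ₑ *
        ‖(gaussian Real.pi_div_two_pos : 𝓢(V, ℂ)) (R⁻¹ • x)‖ₑ := by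
  rw [← enorm_mul, enorm_le_iff_norm_le, norm_mul, norm_stft_dilatedGaussian, gaussian_apply,
    gaussian_apply, Complex.norm_real, Complex.norm_real, Real.norm_of_nonneg (Real.exp_pos _).le,
    Real.norm_of_nonneg (Real.exp_pos _).le, norm_smul, mul_pow, norm_inv, inv_pow,
    Real.norm_eq_abs, sq_abs]
  have hl : 0 < (R ^ 2)⁻¹ := by positivity
  have hl1 : (R ^ 2)⁻¹ ≤ 1 := inv_le_one_of_one_le₀ (one_le_pow₀ hR)
  set l := (R ^ 2)⁻¹
  have hfactor : (1 + l)⁻¹ ^ (Module.finrank ℝ V / 2 : ℝ) ≤ 1 :=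
    Real.rpow_le_one (by positivity) (inv_le_one_of_one_le₀ (by linarith)) (by positivity)
  have hfst : l / 2 ≤ l / (1 + l) := by gcongr; linarith
  have hsnd : Real.pi / 2 ≤ Real.pi / (1 + l) := by gcongr; linarith
  calc _ ≤ 1 * (Real.exp (-(Real.pi * (l / 2)) * ‖x‖ ^ 2) *
        Real.exp (-(Real.pi / 2) * ‖ξ‖ ^ 2)) := by gcongr
    _ = _ := by
        rw [one_mul, mul_comm]
        ring_nf

theorem exists_modulationNorm_dilatedGaussian_le (V : Type*) [NormedAddCommGroup V]
    [InnerProductSpace ℝ V] [MeasurableSpace V] [BorelSpace V] [FiniteDimensional ℝ V]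
    (p : ℝ≥0∞) : ∃ C : ℝ≥0, ∀ {R : ℝ} (hR : 1 ≤ R),
      modulationNorm (gaussian Real.pi_pos) p p (fun _ => 1)
          (dilatedGaussian (V := V) (one_pos.trans_le hR) : 𝓢'(V, ℂ)) ≤
        C * ENNReal.ofReal (R ^ Module.finrank ℝ V) ^ p⁻¹.toReal := by
  let G : 𝓢(V, ℂ) := gaussian Real.pi_div_two_pos
  have hG : eLpNorm G p volume ≠ ⊤ := (G.memLp p volume).eLpNorm_ne_top
  refine ⟨(eLpNorm G p volume).toNNReal * (eLpNorm G p volume).toNNReal, fun {R} hR => ?_⟩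
  set c := ENNReal.ofReal (R ^ Module.finrank ℝ V) ^ p⁻¹.toReal
  have hc : c ≠ ⊤ := ENNReal.rpow_ne_top_of_nonneg ENNReal.toReal_nonneg ENNReal.ofReal_ne_top
  calc _ ≤ eLpNorm (fun ξ => eLpNorm (fun x => ‖G ξ‖ₑ * ‖G (R⁻¹ • x)‖ₑ) p volume) p volume := by
        refine eLpNorm_ennreal_mono fun ξ => eLpNorm_ennreal_mono fun x => ?_
        rw [ENNReal.ofReal_one, mul_one]
        exact enorm_stft_dilatedGaussian_le hR x ξ
    _ = eLpNorm (fun ξ => (c * eLpNorm G p volume) * ‖G ξ‖ₑ) p volume := by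
        refine congrArg (eLpNorm · p volume) (funext fun ξ => ?_)
        rw [eLpNorm_ennreal_const_mul p enorm_ne_top,
          eLpNorm_comp_inv_smul (fun x => ‖G x‖ₑ) p (one_pos.trans_le hR), eLpNorm_enorm, mul_comm]
    _ = _ := by
        rw [eLpNorm_ennreal_const_mul p (ENNReal.mul_ne_top hc hG), eLpNorm_enorm,
          ENNReal.coe_mul, ENNReal.coe_toNNReal hG]
        ring

theorem exists_le_enorm_stft_dilatedGaussian (V : Type*) [NormedAddCommGroup V]
    [InnerProductSpace ℝ V] [MeasurableSpace V] [BorelSpace V] [FiniteDimensional ℝ V] :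
    ∃ c : ℝ≥0∞, c ≠ 0 ∧ ∀ {R : ℝ} (hR : 1 ≤ R) (x ξ : V), ‖x‖ ≤ 2 * R → ‖ξ‖ ≤ 2 →
      c ≤ ‖stft (gaussian Real.pi_pos)
        (dilatedGaussian (V := V) (one_pos.trans_le hR) : 𝓢'(V, ℂ)) x ξ‖ₑ := by
  refine ⟨ENNReal.ofReal (2⁻¹ ^ (Module.finrank ℝ V / 2 : ℝ) * (Real.exp (-(Real.pi * 4)) *
    Real.exp (-(Real.pi * 4)))), (ENNReal.ofReal_pos.2 (by positivity)).ne',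
    fun {R} hR x ξ hx hξ => ?_⟩
  rw [← ofReal_norm, norm_stft_dilatedGaussian]
  refine ENNReal.ofReal_le_ofReal ?_
  have hl : 0 < (R ^ 2)⁻¹ := by positivity
  have hl1 : (R ^ 2)⁻¹ ≤ 1 := inv_le_one_of_one_le₀ (one_le_pow₀ hR)
  have hlx : (R ^ 2)⁻¹ * ‖x‖ ^ 2 ≤ 4 := by
    rw [inv_mul_le_iff₀ (by positivity)]
    calc ‖x‖ ^ 2 ≤ (2 * R) ^ 2 := by gcongr
      _ = R ^ 2 * 4 := by ring
  have hξ2 : ‖ξ‖ ^ 2 ≤ 4 := (pow_le_pow_left₀ (norm_nonneg ξ) hξ 2).trans_eq (by norm_num)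
  set l := (R ^ 2)⁻¹
  have hfst : l / (1 + l) ≤ l := div_le_self hl.le (by linarith)
  have hsnd : Real.pi / (1 + l) ≤ Real.pi := div_le_self Real.pi_pos.le (by linarith)
  gcongr
  · linarith
  · rw [neg_mul, neg_le_neg_iff, mul_assoc]
    gcongr
    exact (mul_le_mul_of_nonneg_right hfst (sq_nonneg _)).trans hlx
  · rw [neg_mul, neg_le_neg_iff]
    gcongr

end DilatedGaussian

section LowerBounds

theorem le_of_forall_mul_rpow_le {c C : ℝ≥0∞} (hc : c ≠ 0) (hC : C ≠ ⊤) {n : ℕ} (hn : n ≠ 0)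
    {a b : ℝ} (h : ∀ R : ℝ, 1 ≤ R →
      c * ENNReal.ofReal (R ^ n) ^ a ≤ C * ENNReal.ofReal (R ^ n) ^ b) : a ≤ b := by
  by_contra! hab
  have hgrowth : Filter.Tendsto (fun R : ℝ => c * ENNReal.ofReal (R ^ n) ^ (a - b))
      Filter.atTop (nhds ⊤) := by
    have hpow := ((ENNReal.tendsto_rpow_at_top (sub_pos.2 hab)).comp
      ENNReal.tendsto_ofReal_atTop).comp (Filter.tendsto_pow_atTop (α := ℝ) hn)
    simpa only [ENNReal.mul_top hc, Function.comp_def] using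
      ENNReal.Tendsto.const_mul (a := c) hpow (.inl ENNReal.top_ne_zero)
  obtain ⟨R, hlt, hR⟩ := ((hgrowth.eventually (lt_mem_nhds hC.lt_top)).and
    (Filter.eventually_ge_atTop 1)).exists
  have hX : ENNReal.ofReal (R ^ n) ≠ 0 := (ENNReal.ofReal_pos.2 (by positivity)).ne'
  refine hlt.not_ge ?_
  rw [ENNReal.rpow_sub _ _ hX ENNReal.ofReal_ne_top, ← mul_div_assoc]
  exact ENNReal.div_le_of_le_mul (h R hR)

theorem mul_rpow_le_eLpNorm {α : Type*} [MeasurableSpace α] {μ : Measure α} {f : α → ℝ≥0∞}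
    {c p : ℝ≥0∞} {S : Set α} (hp : p ≠ 0) (hS : MeasurableSet S) (hμ : μ S ≠ 0)
    (h : ∀ x ∈ S, c ≤ f x) : c * μ S ^ p⁻¹.toReal ≤ eLpNorm f p μ := by
  calc c * μ S ^ p⁻¹.toReal = eLpNorm (fun _ => c) p (μ.restrict S) := by
        rw [eLpNorm_const c hp (by simpa using hμ), enorm_eq_self, Measure.restrict_apply_univ,
          ENNReal.toReal_inv, one_div]
    _ ≤ eLpNorm f p (μ.restrict S) := eLpNorm_mono_enorm_ae <|
        (ae_restrict_mem hS).mono fun x hx => by simpa only [enorm_eq_self] using h x hx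
    _ ≤ eLpNorm f p μ := eLpNorm_restrict_le f p μ S

theorem exists_closedBall_subset_inter {E : Type*} [SeminormedAddCommGroup E] {x : E} {R₁ R₂ : ℝ}
    (hR₁ : 0 ≤ R₁) (hR₂ : 0 ≤ R₂) (hx : ‖x‖ ≤ max R₁ R₂) : ∃ c, Metric.closedBall c (min R₁ R₂) ⊆
      Metric.closedBall x (2 * R₁) ∩ Metric.closedBall 0 (2 * R₂) := by
  rcases le_total R₁ R₂ with hle | hle
  · rw [max_eq_right hle] at hx
    rw [min_eq_left hle]
    exact ⟨x, Set.subset_inter (Metric.closedBall_subset_closedBall (by linarith))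
      (Metric.closedBall_subset_closedBall' (by rw [dist_zero_right]; linarith))⟩
  · rw [max_eq_left hle] at hx
    rw [min_eq_right hle]
    exact ⟨0, Set.subset_inter
      (Metric.closedBall_subset_closedBall' (by rw [dist_zero_left]; linarith))
      (Metric.closedBall_subset_closedBall (by linarith))⟩

end LowerBounds

section Necessity

variable {V : Type*} [NormedAddCommGroup V]

/-- The product of two closed balls, as a subset of phase space. -/
def ballProd (c : V) (r : ℝ) (c' : V) (r' : ℝ) : Set (WithLp 2 (V × V)) :=
  WithLp.ofLp ⁻¹' (Metric.closedBall c r ×ˢ Metric.closedBall c' r')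

theorem mem_ballProd {c c' : V} {r r' : ℝ} {z : WithLp 2 (V × V)} :
    z ∈ ballProd c r c' r' ↔
      z.fst ∈ Metric.closedBall c r ∧ z.snd ∈ Metric.closedBall c' r' := Iff.rfl

variable [InnerProductSpace ℝ V] [MeasurableSpace V] [BorelSpace V] [FiniteDimensional ℝ V]

theorem measurableSet_ballProd (c : V) (r : ℝ) (c' : V) (r' : ℝ) :
    MeasurableSet (ballProd c r c' r') :=
  (WithLp.volume_preserving_ofLp V V).measurable
    (Metric.isClosed_closedBall.measurableSet.prod Metric.isClosed_closedBall.measurableSet)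

theorem volume_ballProd (c c' : V) {r r' : ℝ} (hr : 0 ≤ r) (hr' : 0 ≤ r') :
    volume (ballProd c r c' r') =
      ENNReal.ofReal (r ^ Module.finrank ℝ V) * ENNReal.ofReal (r' ^ Module.finrank ℝ V) *
        volume (Metric.ball (0 : V) 1) ^ 2 := by
  rw [ballProd, (WithLp.volume_preserving_ofLp V V).measure_preimage
    (Metric.isClosed_closedBall.measurableSet.prod
      Metric.isClosed_closedBall.measurableSet).nullMeasurableSet, Measure.volume_eq_prod,
    Measure.prod_prod, Measure.addHaar_closedBall _ _ hr, Measure.addHaar_closedBall _ _ hr']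
  ring

theorem volume_ballProd_ne_zero (c c' : V) {r r' : ℝ} (hr : 0 < r) (hr' : 0 < r') :
    volume (ballProd c r c' r') ≠ 0 := by
  rw [volume_ballProd c c' hr.le hr'.le]
  exact mul_ne_zero (mul_ne_zero (ENNReal.ofReal_pos.2 (pow_pos hr _)).ne'
    (ENNReal.ofReal_pos.2 (pow_pos hr' _)).ne')
    (pow_ne_zero 2 (Metric.measure_ball_pos volume 0 one_pos).ne')

variable {g : 𝓢(V, ℂ)} {f₁ f₂ : 𝓢'(V, ℂ)} {F : 𝓢'(WithLp 2 (V × V), ℂ)} {c₁ c₂ p q : ℝ≥0∞}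
  {R₁ R₂ : ℝ}

theorem IsSTFT.mul_rpow_le_eLpNorm_stft (hF : IsSTFT f₁ f₂ F) (hp : p ≠ 0) (hR₁ : 0 < R₁)
    (hR₂ : 0 < R₂) (h₁ : ∀ x ξ : V, ‖x‖ ≤ 2 * R₁ → ‖ξ‖ ≤ 2 → c₁ ≤ ‖stft g f₁ x ξ‖ₑ)
    (h₂ : ∀ x ξ : V, ‖x‖ ≤ 2 * R₂ → ‖ξ‖ ≤ 2 → c₂ ≤ ‖stft g f₂ x ξ‖ₑ) {z : WithLp 2 (V × V)}
    (hz : z ∈ ballProd 0 (max R₁ R₂) 0 1) :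
    c₁ * c₂ * (ENNReal.ofReal (min R₁ R₂ ^ Module.finrank ℝ V) *
        volume (Metric.ball (0 : V) 1) ^ 2) ^ p⁻¹.toReal ≤
      eLpNorm (fun ζ => ‖stft (stftS g g) F z ζ‖ₑ) p volume := by
  obtain ⟨hzfst, hzsnd⟩ := mem_ballProd.1 hz
  rw [mem_closedBall_zero_iff] at hzfst hzsnd
  have hmin : 0 < min R₁ R₂ := lt_min hR₁ hR₂
  obtain ⟨c, hc⟩ := exists_closedBall_subset_inter hR₁.le hR₂.le
    ((norm_neg z.fst).trans_le hzfst)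
  have hvolume := volume_ballProd (0 : V) c zero_le_one hmin.le
  rw [one_pow, ENNReal.ofReal_one, one_mul] at hvolume
  rw [← hvolume]
  refine mul_rpow_le_eLpNorm hp (measurableSet_ballProd _ _ _ _)
    (volume_ballProd_ne_zero _ _ one_pos hmin) fun ζ hζ => ?_
  obtain ⟨hζfst, hζsnd⟩ := mem_ballProd.1 hζ
  obtain ⟨hnear, hzero⟩ := hc hζsnd
  rw [mem_closedBall_zero_iff] at hζfst hzero
  rw [mem_closedBall_iff_norm, ← norm_neg, neg_sub', neg_neg] at hnear
  rw [hF.enorm_stft_eq, phasePoint_sub]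
  exact mul_le_mul' (h₁ _ _ hnear (hζfst.trans one_le_two))
    (h₂ _ _ ((norm_neg ζ.snd).trans_le hzero)
      ((norm_add_le _ _).trans (by linarith)))

theorem IsSTFT.mul_rpow_le_wienerNorm (hF : IsSTFT f₁ f₂ F) (hp : p ≠ 0) (hq : q ≠ 0)
    (hR₁ : 0 < R₁) (hR₂ : 0 < R₂)
    (h₁ : ∀ x ξ : V, ‖x‖ ≤ 2 * R₁ → ‖ξ‖ ≤ 2 → c₁ ≤ ‖stft g f₁ x ξ‖ₑ)
    (h₂ : ∀ x ξ : V, ‖x‖ ≤ 2 * R₂ → ‖ξ‖ ≤ 2 → c₂ ≤ ‖stft g f₂ x ξ‖ₑ) :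
    c₁ * c₂ * (ENNReal.ofReal (min R₁ R₂ ^ Module.finrank ℝ V) *
        volume (Metric.ball (0 : V) 1) ^ 2) ^ p⁻¹.toReal *
      (ENNReal.ofReal (max R₁ R₂ ^ Module.finrank ℝ V) *
        volume (Metric.ball (0 : V) 1) ^ 2) ^ q⁻¹.toReal ≤
      wienerNorm (stftS g g) p q (fun _ => 1) F := by
  have hmax : 0 < max R₁ R₂ := lt_max_of_lt_left hR₁
  have hvolume := volume_ballProd (0 : V) 0 hmax.le zero_le_one
  rw [one_pow, ENNReal.ofReal_one, mul_one] at hvolume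
  rw [← hvolume]
  refine mul_rpow_le_eLpNorm hq (measurableSet_ballProd _ _ _ _)
    (volume_ballProd_ne_zero _ _ hmax one_pos) fun z hz => ?_
  rw [ENNReal.ofReal_one, mul_one]
  exact hF.mul_rpow_le_eLpNorm_stft hp hR₁ hR₂ h₁ h₂ hz

theorem exists_wienerNorm_stftS_le_modulationNorm {p₁ p₂ : ℝ≥0∞} (hp₁ : 1 ≤ p₁) (hp₂ : 1 ≤ p₂)
    (hp : 1 ≤ p) (hq : 1 ≤ q) (g₁ g₂ : 𝓢(V, ℂ)) {Φ : 𝓢(WithLp 2 (V × V), ℂ)} (hΦ : Φ ≠ 0)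
    {C : ℝ≥0} (hC : ∀ f₁ f₂ : 𝓢(V, ℂ),
      wienerNorm Φ p q (fun _ => 1) (stftS f₁ f₂ : 𝓢'(WithLp 2 (V × V), ℂ)) ≤
        C * modulationNorm g₁ p₁ p₁ (fun _ => 1) (f₁ : 𝓢'(V, ℂ)) *
          modulationNorm g₂ p₂ p₂ (fun _ => 1) (f₂ : 𝓢'(V, ℂ))) {g : 𝓢(V, ℂ)} (hg : g ≠ 0) :
    ∃ D : ℝ≥0, ∀ f₁ f₂ : 𝓢(V, ℂ),
      wienerNorm (stftS g g) p q (fun _ => 1) (stftS f₁ f₂ : 𝓢'(WithLp 2 (V × V), ℂ)) ≤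
        D * (modulationNorm g p₁ p₁ (fun _ => 1) (f₁ : 𝓢'(V, ℂ)) *
          modulationNorm g p₂ p₂ (fun _ => 1) (f₂ : 𝓢'(V, ℂ))) := by
  obtain ⟨D₁, hD₁⟩ := exists_modulationNorm_le hg g₁ hp₁ le_rfl hp₁ le_rfl
    (m := fun _ => 1) isModerate_one
  obtain ⟨D₂, hD₂⟩ := exists_modulationNorm_le hg g₂ hp₂ le_rfl hp₂ le_rfl
    (m := fun _ => 1) isModerate_one
  obtain ⟨D, hD⟩ := exists_wienerNorm_le hΦ (stftS g g) hp le_rfl hq le_rfl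
    (w := fun _ => 1) isModerate_one
  refine ⟨D * C * D₁ * D₂, fun f₁ f₂ => ?_⟩
  calc _ ≤ D * wienerNorm Φ p q (fun _ => 1) (stftS f₁ f₂ : 𝓢'(WithLp 2 (V × V), ℂ)) := hD _
    _ ≤ D * (C * modulationNorm g₁ p₁ p₁ (fun _ => 1) (f₁ : 𝓢'(V, ℂ)) *
          modulationNorm g₂ p₂ p₂ (fun _ => 1) (f₂ : 𝓢'(V, ℂ))) := by gcongr; exact hC f₁ f₂
    _ ≤ D * (C * (D₁ * modulationNorm g p₁ p₁ (fun _ => 1) (f₁ : 𝓢'(V, ℂ))) *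
          (D₂ * modulationNorm g p₂ p₂ (fun _ => 1) (f₂ : 𝓢'(V, ℂ)))) := by
        gcongr
        exacts [hD₁ f₁, hD₂ f₂]
    _ = _ := by
        push_cast
        ring

theorem exists_mul_rpow_le_mul_rpow {p₁ p₂ : ℝ≥0∞} (hp : p ≠ 0) (hq : q ≠ 0) {D : ℝ≥0}
    (hD : ∀ f₁ f₂ : 𝓢(V, ℂ),
      wienerNorm (stftS (gaussian Real.pi_pos) (gaussian Real.pi_pos)) p q (fun _ => 1)
          (stftS f₁ f₂ : 𝓢'(WithLp 2 (V × V), ℂ)) ≤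
        D * (modulationNorm (gaussian Real.pi_pos) p₁ p₁ (fun _ => 1) (f₁ : 𝓢'(V, ℂ)) *
          modulationNorm (gaussian Real.pi_pos) p₂ p₂ (fun _ => 1) (f₂ : 𝓢'(V, ℂ)))) :
    ∃ c C : ℝ≥0∞, c ≠ 0 ∧ C ≠ ⊤ ∧ ∀ R₁ R₂ : ℝ, 1 ≤ R₁ → 1 ≤ R₂ →
      c * (ENNReal.ofReal (min R₁ R₂ ^ Module.finrank ℝ V) ^ p⁻¹.toReal *
        ENNReal.ofReal (max R₁ R₂ ^ Module.finrank ℝ V) ^ q⁻¹.toReal) ≤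
      C * (ENNReal.ofReal (R₁ ^ Module.finrank ℝ V) ^ p₁⁻¹.toReal *
        ENNReal.ofReal (R₂ ^ Module.finrank ℝ V) ^ p₂⁻¹.toReal) := by
  obtain ⟨K₁, hK₁⟩ := exists_modulationNorm_dilatedGaussian_le V p₁
  obtain ⟨K₂, hK₂⟩ := exists_modulationNorm_dilatedGaussian_le V p₂
  obtain ⟨k, hk, hlower⟩ := exists_le_enorm_stft_dilatedGaussian V
  have hball : volume (Metric.ball (0 : V) 1) ^ 2 ≠ 0 :=
    pow_ne_zero 2 (Metric.measure_ball_pos volume 0 one_pos).ne'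
  have hball' : volume (Metric.ball (0 : V) 1) ^ 2 ≠ ⊤ := ENNReal.pow_ne_top measure_ball_lt_top.ne
  set v := volume (Metric.ball (0 : V) 1) ^ 2
  have hv (r : ℝ) : v ^ r ≠ 0 := (ENNReal.rpow_pos (pos_iff_ne_zero.2 hball) hball').ne'
  refine ⟨k * k * v ^ p⁻¹.toReal * v ^ q⁻¹.toReal, D * K₁ * K₂,
    mul_ne_zero (mul_ne_zero (mul_ne_zero hk hk) (hv _)) (hv _),
    mod_cast ENNReal.coe_ne_top (r := D * K₁ * K₂), fun R₁ R₂ hR₁ hR₂ => ?_⟩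
  have hlow := (isSTFT_stftS _ _).mul_rpow_le_wienerNorm hp hq (one_pos.trans_le hR₁)
    (one_pos.trans_le hR₂) (hlower hR₁) (hlower hR₂)
  have hup := mul_le_mul' (hK₁ hR₁) (hK₂ hR₂)
  rw [ENNReal.mul_rpow_of_nonneg _ _ ENNReal.toReal_nonneg,
    ENNReal.mul_rpow_of_nonneg _ _ ENNReal.toReal_nonneg] at hlow
  calc _ = _ := by ring
    _ ≤ _ := hlow.trans ((hD _ _).trans (mul_le_mul_right hup _))
    _ = _ := by ring

theorem exponents_le_of_wienerNorm_le [Nontrivial V] {p₁ p₂ : ℝ≥0∞} (hp₁ : 1 ≤ p₁) (hp₂ : 1 ≤ p₂)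
    (hp : 1 ≤ p) (hq : 1 ≤ q) (g₁ g₂ : 𝓢(V, ℂ)) {Φ : 𝓢(WithLp 2 (V × V), ℂ)} (hΦ : Φ ≠ 0)
    {C : ℝ≥0} (hC : ∀ f₁ f₂ : 𝓢(V, ℂ),
      wienerNorm Φ p q (fun _ => 1) (stftS f₁ f₂ : 𝓢'(WithLp 2 (V × V), ℂ)) ≤
        C * modulationNorm g₁ p₁ p₁ (fun _ => 1) (f₁ : 𝓢'(V, ℂ)) *
          modulationNorm g₂ p₂ p₂ (fun _ => 1) (f₂ : 𝓢'(V, ℂ))) :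
    p₁ ≤ q ∧ p₂ ≤ q ∧ p⁻¹ + q⁻¹ ≤ p₁⁻¹ + p₂⁻¹ := by
  obtain ⟨D, hD⟩ := exists_wienerNorm_stftS_le_modulationNorm hp₁ hp₂ hp hq g₁ g₂ hΦ hC
    (gaussian_ne_zero Real.pi_pos)
  have hne {r : ℝ≥0∞} (hr : 1 ≤ r) : r ≠ 0 := (zero_lt_one.trans_le hr).ne'
  have hinv {r : ℝ≥0∞} (hr : 1 ≤ r) : r⁻¹ ≠ ⊤ := ENNReal.inv_ne_top.2 (hne hr)
  have hn : Module.finrank ℝ V ≠ 0 := Module.finrank_pos.ne'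
  obtain ⟨c, M, hc, hM, hcM⟩ := exists_mul_rpow_le_mul_rpow (hne hp) (hne hq) hD
  refine ⟨?_, ?_, ?_⟩
  · rw [← ENNReal.inv_le_inv, ← ENNReal.toReal_le_toReal (hinv hq) (hinv hp₁)]
    refine le_of_forall_mul_rpow_le hc hM hn fun R hR => ?_
    simpa [min_eq_right hR, max_eq_left hR] using hcM R 1 hR le_rfl
  · rw [← ENNReal.inv_le_inv, ← ENNReal.toReal_le_toReal (hinv hq) (hinv hp₂)]
    refine le_of_forall_mul_rpow_le hc hM hn fun R hR => ?_
    simpa [min_eq_left hR, max_eq_right hR] using hcM 1 R le_rfl hR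
  · rw [← ENNReal.toReal_le_toReal (ENNReal.add_ne_top.2 ⟨hinv hp, hinv hq⟩)
      (ENNReal.add_ne_top.2 ⟨hinv hp₁, hinv hp₂⟩), ENNReal.toReal_add (hinv hp) (hinv hq),
      ENNReal.toReal_add (hinv hp₁) (hinv hp₂)]
    refine le_of_forall_mul_rpow_le hc hM hn fun R hR => ?_
    rw [ENNReal.rpow_add_of_nonneg _ _ ENNReal.toReal_nonneg ENNReal.toReal_nonneg,
      ENNReal.rpow_add_of_nonneg _ _ ENNReal.toReal_nonneg ENNReal.toReal_nonneg]
    simpa only [min_self, max_self] using hcM R R hR hR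

end Necessity

end TimeFreq

theorem corollary4p3_general {V : Type*} [NormedAddCommGroup V] [InnerProductSpace ℝ V]
    [MeasurableSpace V] [BorelSpace V] [FiniteDimensional ℝ V] [Nontrivial V] {p₁ p₂ p q : ℝ≥0∞}
    (hp₁ : 1 ≤ p₁) (hp₂ : 1 ≤ p₂) (hp : 1 ≤ p) (hq : 1 ≤ q) {g₁ g₂ : 𝓢(V, ℂ)} (hg₁ : g₁ ≠ 0)
    (hg₂ : g₂ ≠ 0) {Φ : 𝓢(WithLp 2 (V × V), ℂ)} (hΦ : Φ ≠ 0) :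
    ((p₁ ≤ q ∧ p₂ ≤ q ∧ p⁻¹ + q⁻¹ ≤ p₁⁻¹ + p₂⁻¹) →
      ∀ s : ℝ, ∃ C : ℝ≥0, ∀ f₁ f₂ : 𝓢'(V, ℂ),
        MemModulation g₁ p₁ p₁ (weight |s|) f₁ → MemModulation g₂ p₂ p₂ (weight s) f₂ →
        ∃ F, IsSTFT f₁ f₂ F ∧ (∀ F', IsSTFT f₁ f₂ F' → F' = F) ∧
          MemWiener Φ p q (weight s) F ∧
          wienerNorm Φ p q (weight s) F ≤
            C * modulationNorm g₁ p₁ p₁ (weight |s|) f₁ * modulationNorm g₂ p₂ p₂ (weight s) f₂) ∧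
    ((∃ C : ℝ≥0, ∀ f₁ f₂ : 𝓢(V, ℂ),
        wienerNorm Φ p q (fun _ => 1) (stftS f₁ f₂ : 𝓢'(_, ℂ)) ≤
          C * modulationNorm g₁ p₁ p₁ (fun _ => 1) (f₁ : 𝓢'(_, ℂ)) *
            modulationNorm g₂ p₂ p₂ (fun _ => 1) (f₂ : 𝓢'(_, ℂ))) →
      p₁ ≤ q ∧ p₂ ≤ q ∧ p⁻¹ + q⁻¹ ≤ p₁⁻¹ + p₂⁻¹) := by
  refine ⟨fun ⟨h₁, h₂, h⟩ s => ?_, fun ⟨C, hC⟩ =>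
    exponents_le_of_wienerNorm_le hp₁ hp₂ hp hq g₁ g₂ hΦ hC⟩
  obtain ⟨C, hC⟩ := exists_wienerNorm_isSTFT_le hp₁ hp₂ hp hg₁ hg₂ Φ h₁ h₂ h s
  refine ⟨C, fun f₁ f₂ hf₁ hf₂ => ?_⟩
  obtain ⟨F, hF⟩ := exists_isSTFT f₁ f₂
  have hle := hC f₁ f₂ F hF hf₁ hf₂
  have hfinite := hle.trans_lt
    (ENNReal.mul_lt_top ENNReal.coe_lt_top (ENNReal.mul_lt_top hf₁ hf₂))
  exact ⟨F, hF, fun F' hF' => hF'.unique hF, hfinite, hle.trans_eq (mul_assoc _ _ _).symm⟩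

theorem corollary4p3 (d : ℕ) (hd : 0 < d) (p₁ p₂ p q : ℝ≥0∞)
    (hp₁ : 1 ≤ p₁) (hp₂ : 1 ≤ p₂) (hp : 1 ≤ p) (hq : 1 ≤ q)
    -- the windows with which the norms are computed
    (g₁ g₂ : 𝓢(EuclideanSpace ℝ (Fin d), ℂ)) (hg₁ : g₁ ≠ 0) (hg₂ : g₂ ≠ 0)
    (Φ : 𝓢(WithLp 2 (EuclideanSpace ℝ (Fin d) × EuclideanSpace ℝ (Fin d)), ℂ)) (hΦ : Φ ≠ 0) :
    ((p₁ ≤ q ∧ p₂ ≤ q ∧ p⁻¹ + q⁻¹ ≤ p₁⁻¹ + p₂⁻¹) →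
      ∀ s : ℝ, ∃ C : ℝ≥0, ∀ f₁ f₂ : 𝓢'(EuclideanSpace ℝ (Fin d), ℂ),
        MemModulation g₁ p₁ p₁ (weight |s|) f₁ → MemModulation g₂ p₂ p₂ (weight s) f₂ →
        ∃ F, IsSTFT f₁ f₂ F ∧ (∀ F', IsSTFT f₁ f₂ F' → F' = F) ∧
          MemWiener Φ p q (weight s) F ∧
          wienerNorm Φ p q (weight s) F ≤
            C * modulationNorm g₁ p₁ p₁ (weight |s|) f₁ * modulationNorm g₂ p₂ p₂ (weight s) f₂) ∧
    ((∃ C : ℝ≥0, ∀ f₁ f₂ : 𝓢(EuclideanSpace ℝ (Fin d), ℂ),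
        wienerNorm Φ p q (fun _ => 1) (stftS f₁ f₂ : 𝓢'(_, ℂ)) ≤
          C * modulationNorm g₁ p₁ p₁ (fun _ => 1) (f₁ : 𝓢'(_, ℂ)) *
            modulationNorm g₂ p₂ p₂ (fun _ => 1) (f₂ : 𝓢'(_, ℂ))) →
      p₁ ≤ q ∧ p₂ ≤ q ∧ p⁻¹ + q⁻¹ ≤ p₁⁻¹ + p₂⁻¹) := by
  have : Nonempty (Fin d) := ⟨⟨0, hd⟩⟩
  exact corollary4p3_general hp₁ hp₂ hp hq hg₁ hg₂ hΦ
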